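/- Let $G$ be a connected semisimple Lie group with finite centre, $K<G$ a maximal compact subgroup, and $T<K$ a maximal torus whose Lie algebra $\mathfrak t$ is a Cartan subalgebra of $\mathfrak g$. Let $\mathfrak p\subset\mathfrak g$ be the orthogonal complement of $\mathfrak k$ for the Killing form, and regard $\mathfrak k^*$ as a subspace of $\mathfrak g^*$ by extending functionals by zero on $\mathfrak p$; identify $\mathfrak t^*$ with the $\mathrm{Ad}^*(T)$-fixed elements of $\mathfrak k^*$. Let $R_n$ be the set of roots of $(\mathfrak g,\mathfrak t)$ that are not roots of $(\mathfrak k,\mathfrak t)$, let $\mathfrak t^*_+\subset\mathfrak t^*$ be a closed positive Weyl chamber for $(\mathfrak k,\mathfrak t)$, and put $$\mathrm{ncw}=\{\xi\in\mathfrak t^*:\ (\alpha,\xi)=0\text{ for some }\alpha\in R_n\},\qquad \mathfrak k^*_{\mathrm{se}}=\mathrm{Ad}^*(K)\bigl(\mathfrak t^*_+\setminus \mathrm{ncw}\bigr),$$ where $(\cdot,\cdot)$ is the Weyl group invariant pairing given by the Killing form. For a smooth action of a Lie group $H$ on a symplectic manifold $(M,\omega)$ that preserves $\omega$, a momentum map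 is a smooth, $\mathrm{Ad}^*$-equivariant map $\Phi:M\to\mathfrak h^*$ such that $\omega_m(v,X_m)=d\langle\Phi,X\rangle_m(v)$ for all $X\in\mathfrak h$, $m\in M$ and $v\in T_mM$, where $X_m=\frac{d}{dt}\big|_{t=0}\exp(tX)\cdot m$. The action is then called Hamiltonian. Let $(N,\nu)$ be a symplectic manifold with a Hamiltonian action of $K$ and momentum map $\Phi^N:N\to\mathfrak k^*$, and suppose that $\Phi^N(N)\subset\mathfrak k^*_{\mathrm{se}}$. Let $M=G\times_KN$ be the quotient of $G\times N$ by the $K$-action $k\cdot(g,n)=(gk^{-1},kn)$; it is a smooth manifold, with the unique smooth structure for which the quotient map $p:G\times N\to M$ is a submersion. Let $G$ act on $M$ by left multiplication on the first factor. For $X\in\mathfrak p$ and $v\in T_nN$, write $v+X$ for $T_{(e,n)}p(X,v)\in T_{[e,n]}M$; this gives an identification $T_nN\oplus\mathfrak p\cong T_{[e,n]}M$. Then: 1. There is a unique $G$-invariant 2-form $\omega$ on $M$ such that $$\omega_{[e,n]}(v+X,w+Y)=\nu_n(v,w)-\langle\Phi^N(n),[X,Y]\rangle$$ for all $n\in N$,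 $v,w\in T_nN$ and $X,Y\in\mathfrak p$, and $\omega$ is symplectic (smooth, closed and nondegenerate). 2. The map $\Phi^M:M\to\mathfrak g^*$, $\Phi^M[g,n]=\mathrm{Ad}^*(g)\Phi^N(n)$, is well defined and is a momentum map for the (smooth) action of $G$ on $(M,\omega)$. -/

import Mathlib

open scoped Manifold ContDiff TensorProduct

noncomputable section

/-- A smooth real Lie group has the (finite) smoothness on which Mathlib's Lie bracket of the tangent
space at the identity is built. -/
instance instLEInftyMinSmoothnessThree : ENat.LEInfty (minSmoothness ℝ 3) := by
  rw [minSmoothness_of_isRCLikeNormedField]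
  infer_instance

/-! ### Differential 2-forms on manifolds -/

section Forms

variable {E : Type*} [NormedAddCommGroup E] [NormedSpace ℝ E]
  {M : Type*} [TopologicalSpace M] [ChartedSpace E M]

/-- A (not necessarily smooth) differential 2-form: an alternating bilinear form on every tangent
space. -/
abbrev TwoForm (E : Type*) [NormedAddCommGroup E] [NormedSpace ℝ E]
    (M : Type*) [TopologicalSpace M] [ChartedSpace E M] : Type _ :=
  ∀ x : M, (TangentSpace 𝓘(ℝ, E) x) [⋀^Fin 2]→L[ℝ] ℝ

/-- The coordinate expression of a 2-form in the chart around `x₀`: its pullback along the inverse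
of that chart, a 2-form on the (open) target of the chart. -/
def TwoForm.inChart (Ω : TwoForm E M) (x₀ : M) (y : E) : E [⋀^Fin 2]→L[ℝ] ℝ :=
  (Ω ((chartAt E x₀).symm y)).compContinuousLinearMap
    (mfderiv 𝓘(ℝ, E) 𝓘(ℝ, E) (chartAt E x₀).symm y)

/-- The 2-form is smooth. -/
def TwoForm.IsSmooth (Ω : TwoForm E M) : Prop :=
  ∀ x₀ : M, ContDiffOn ℝ ∞ (Ω.inChart x₀) (chartAt E x₀).target

/-- The exterior derivative of the 2-form vanishes. -/
def TwoForm.IsClosed (Ω : TwoForm E M) : Prop :=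
  ∀ x₀ : M, ∀ y ∈ (chartAt E x₀).target, extDeriv (Ω.inChart x₀) y = 0

/-- The 2-form is nondegenerate at every point. -/
def TwoForm.IsNondegenerate (Ω : TwoForm E M) : Prop :=
  ∀ (x : M) (v : TangentSpace 𝓘(ℝ, E) x),
    (∀ w : TangentSpace 𝓘(ℝ, E) x, Ω x ![v, w] = 0) → v = 0

/-- Symplectic forms. -/
structure TwoForm.IsSymplectic (Ω : TwoForm E M) : Prop where
  smooth : Ω.IsSmooth
  closed : Ω.IsClosed
  nondegenerate : Ω.IsNondegenerate

/-- Invariance of a 2-form under a group action: `h^* Ω = Ω` for every group element `h`. -/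
def TwoForm.IsInvariant (H : Type*) [Group H] [MulAction H M] (Ω : TwoForm E M) : Prop :=
  ∀ (h : H) (x : M) (v w : TangentSpace 𝓘(ℝ, E) x),
    Ω (h • x) ![mfderiv 𝓘(ℝ, E) 𝓘(ℝ, E) (fun y : M => h • y) x v,
      mfderiv 𝓘(ℝ, E) 𝓘(ℝ, E) (fun y : M => h • y) x w] = Ω x ![v, w]

end Forms

/-! ### Lie groups, the (co)adjoint action and momentum maps -/

/-- The Lie algebra of a Lie group modelled on `E`: the tangent space at the identity. -/
abbrev LieAlg (E : Type*) [NormedAddCommGroup E] [NormedSpace ℝ E]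
    (G : Type*) [TopologicalSpace G] [ChartedSpace E G] [Group G] : Type _ :=
  GroupLieAlgebra 𝓘(ℝ, E) G

section Adjoint

variable (E : Type*) [NormedAddCommGroup E] [NormedSpace ℝ E]
  {G : Type*} [TopologicalSpace G] [ChartedSpace E G] [Group G]

/-- The adjoint action of `g` on the Lie algebra: the derivative at `1` of `x ↦ g x g⁻¹`. -/
def adjointAction (g : G) : LieAlg E G →L[ℝ] LieAlg E G :=
  (mfderiv 𝓘(ℝ, E) 𝓘(ℝ, E) (fun x : G => g * x * g⁻¹) 1 : E →L[ℝ] E)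

/-- The coadjoint action: `⟨Ad*(g) ξ, X⟩ = ⟨ξ, Ad(g⁻¹) X⟩`. -/
def coadjointAction (g : G) (ξ : Module.Dual ℝ (LieAlg E G)) : Module.Dual ℝ (LieAlg E G) :=
  ξ ∘ₗ (adjointAction E g⁻¹).toLinearMap

end Adjoint

section Momentum

variable {E : Type*} [NormedAddCommGroup E] [NormedSpace ℝ E]
  {M : Type*} [TopologicalSpace M] [ChartedSpace E M]
  {EH : Type*} [NormedAddCommGroup EH] [NormedSpace ℝ EH]
  {H : Type*} [TopologicalSpace H] [ChartedSpace EH H] [Group H] [MulAction H M]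

/-- The value `X_x` at `x` of the vector field on `M` generated by `X`, i.e. the derivative at
the identity of `h ↦ h • x`, applied to `X`. -/
def fundamentalVector (X : LieAlg EH H) (x : M) : TangentSpace 𝓘(ℝ, E) x :=
  (mfderiv 𝓘(ℝ, EH) 𝓘(ℝ, E) (fun h : H => h • x) 1 : EH →L[ℝ] E) X

/-- `Φ` is a momentum map for the action of `H` on `(M, Ω)`: it is smooth, equivariant for
the coadjoint action, and `Ω(v, X_x) = d⟨Φ, X⟩_x(v)`. -/
structure IsMomentumMap (Ω : TwoForm E M) (Φ : M → Module.Dual ℝ (LieAlg EH H)) : Prop where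
  smooth : ∀ X : LieAlg EH H, ContMDiff 𝓘(ℝ, E) 𝓘(ℝ, ℝ) ∞ (fun x : M => Φ x X)
  equivariant : ∀ (h : H) (x : M), Φ (h • x) = coadjointAction EH h (Φ x)
  hamilton : ∀ (X : LieAlg EH H) (x : M) (v : TangentSpace 𝓘(ℝ, E) x),
    Ω x ![v, fundamentalVector X x] =
      (mfderiv 𝓘(ℝ, E) 𝓘(ℝ, ℝ) (fun y : M => Φ y X) x v : ℝ)

/-- A Hamiltonian action of the Lie group `H` on the symplectic manifold `(M, Ω)`, with
momentum map `Φ`. -/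
structure IsHamiltonianAction (Ω : TwoForm E M) (Φ : M → Module.Dual ℝ (LieAlg EH H)) :
    Prop where
  symplectic : Ω.IsSymplectic
  smooth_action : ContMDiffSMul 𝓘(ℝ, EH) 𝓘(ℝ, E) ∞ H M
  invariant : Ω.IsInvariant H
  momentum : IsMomentumMap Ω Φ

end Momentum

/-! ### Subgroups -/

section Subgroups

/-- `K` is a maximal compact subgroup of `G`. -/
def IsMaximalCompactSubgroup {G : Type*} [TopologicalSpace G] [Group G] (K : Subgroup G) : Prop :=
  Maximal (fun S : Subgroup G => IsCompact (S : Set G)) K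

/-- `T` is a maximal torus of the Lie group `K`: it is maximal among the compact connected
abelian subgroups. -/
def IsMaximalTorus {K : Type*} [TopologicalSpace K] [Group K] (T : Subgroup K) : Prop :=
  Maximal (fun S : Subgroup K => IsCompact (S : Set K) ∧ IsConnected (S : Set K) ∧
    ∀ a ∈ S, ∀ b ∈ S, a * b = b * a) T

variable (E : Type*) [NormedAddCommGroup E] [NormedSpace ℝ E]
  {G : Type*} [TopologicalSpace G] [ChartedSpace E G] [Group G]
  (EK : Type*) [NormedAddCommGroup EK] [NormedSpace ℝ EK]
  (K : Subgroup G) [ChartedSpace EK K]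

/-- The given smooth structure on the subgroup `K` makes it an embedded Lie subgroup of `G`. -/
structure IsLieSubgroup : Prop where
  lieGroup : LieGroup 𝓘(ℝ, EK) ∞ K
  embedding : Manifold.IsSmoothEmbedding 𝓘(ℝ, EK) 𝓘(ℝ, E) ∞ (Subtype.val : K → G)

/-- The inclusion of the Lie algebra of `K` into the Lie algebra of `G`. -/
def lieIncl : LieAlg EK K →L[ℝ] LieAlg E G :=
  (mfderiv 𝓘(ℝ, EK) 𝓘(ℝ, E) (Subtype.val : K → G) 1 : EK →L[ℝ] E)

/-- The orthogonal complement `𝔭` of `𝔨` in `𝔤` for the Killing form of `𝔤`. -/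
def killingComplement [CompleteSpace E] [LieGroup 𝓘(ℝ, E) ∞ G] : Submodule ℝ (LieAlg E G) :=
  (killingForm ℝ (LieAlg E G)).orthogonal (lieIncl E EK K).range

/-- The embedding of `𝔨*` into `𝔤*` whose image is the annihilator of `𝔭`: `ξ` is extended
by zero on `𝔭`. -/
def extendDual [CompleteSpace E] [LieGroup 𝓘(ℝ, E) ∞ G] (ξ : Module.Dual ℝ (LieAlg EK K)) :
    Module.Dual ℝ (LieAlg E G) :=
  Classical.epsilon fun η : Module.Dual ℝ (LieAlg E G) =>
    (∀ X : LieAlg EK K, η (lieIncl E EK K X) = ξ X) ∧ ∀ Y ∈ killingComplement E EK K, η Y = 0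

end Subgroups

/-! ### Roots, Weyl chambers, and the strongly elliptic set -/

/-- `α : 𝔱 → ℂ` is a root of `(𝔩, 𝔱)`, where the abelian algebra `𝔱` is mapped to `𝔩` by `j`:
it is nonzero and has a nonzero weight vector in the complexification of `𝔩`. -/
def IsRootOf {V 𝔩 : Type*} [AddCommGroup V] [Module ℝ V] [LieRing 𝔩] [LieAlgebra ℝ 𝔩]
    (j : V →ₗ[ℝ] 𝔩) (α : V →ₗ[ℝ] ℂ) : Prop :=
  α ≠ 0 ∧ ∃ Z : ℂ ⊗[ℝ] 𝔩, Z ≠ 0 ∧ ∀ X : V, ⁅(1 : ℂ) ⊗ₜ[ℝ] j X, Z⁆ = α X • Z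

section Elliptic

variable (E : Type*) [NormedAddCommGroup E] [NormedSpace ℝ E] [CompleteSpace E]
  {G : Type*} [TopologicalSpace G] [ChartedSpace E G] [Group G] [LieGroup 𝓘(ℝ, E) ∞ G]
  (EK : Type*) [NormedAddCommGroup EK] [NormedSpace ℝ EK] [CompleteSpace EK]
  {K : Subgroup G} [ChartedSpace EK K] [LieGroup 𝓘(ℝ, EK) ∞ K]
  (ET : Type*) [NormedAddCommGroup ET] [NormedSpace ℝ ET]
  (T : Subgroup K) [ChartedSpace ET T]

/-- The inclusion of the Lie algebra `𝔱` of `T` into the Lie algebra `𝔤` of `G`. -/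
def torusIncl : LieAlg ET T →ₗ[ℝ] LieAlg E G :=
  (lieIncl E EK K).toLinearMap ∘ₗ (lieIncl EK ET T).toLinearMap

/-- The Lie algebra of `T` is a Cartan subalgebra of the Lie algebra of `G`. -/
def IsCartanIn : Prop :=
  ∃ 𝔥 : LieSubalgebra ℝ (LieAlg E G),
    𝔥.toSubmodule = LinearMap.range (torusIncl E EK ET T) ∧ 𝔥.IsCartanSubalgebra

/-- The compact roots: the roots of `(𝔨, 𝔱)`. -/
def compactRoots : Set (LieAlg ET T →ₗ[ℝ] ℂ) :=
  {α | IsRootOf (lieIncl EK ET T).toLinearMap α}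

/-- The noncompact roots: the roots of `(𝔤, 𝔱)` that are not roots of `(𝔨, 𝔱)`. -/
def noncompactRoots : Set (LieAlg ET T →ₗ[ℝ] ℂ) :=
  {α | IsRootOf (torusIncl E EK ET T) α} \ compactRoots EK ET T

/-- `𝔱*`, identified with the subspace of `Ad*(T)`-fixed elements of `𝔨*`. -/
def torusDual : Set (Module.Dual ℝ (LieAlg EK K)) :=
  {ξ | ∀ t ∈ T, coadjointAction EK t ξ = ξ}

/-- The element `H_ξ` of `𝔱` that corresponds to the restriction of `ξ` to `𝔱` under the Killing
form of `𝔤`. -/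
def killingVector (ξ : Module.Dual ℝ (LieAlg EK K)) : LieAlg ET T :=
  Classical.epsilon fun X : LieAlg ET T => ∀ Y : LieAlg ET T,
    killingForm ℝ (LieAlg E G) (torusIncl E EK ET T X) (torusIncl E EK ET T Y) =
      ξ (lieIncl EK ET T Y)

/-- The Weyl group invariant pairing `(α, ξ)` of `α ∈ (𝔱*)_ℂ` and `ξ ∈ 𝔱*` given by the Killing
form. -/
def weightPairing (α : LieAlg ET T →ₗ[ℝ] ℂ) (ξ : Module.Dual ℝ (LieAlg EK K)) : ℂ :=
  α (killingVector E EK ET T ξ)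

/-- The union of the noncompact walls in `𝔱*`. -/
def noncompactWalls : Set (Module.Dual ℝ (LieAlg EK K)) :=
  {ξ ∈ torusDual EK T | ∃ α ∈ noncompactRoots E EK ET T, weightPairing E EK ET T α ξ = 0}

/-- `C` is a (closed) Weyl chamber in `𝔱*` for `(𝔨, 𝔱)`: for some `lam` that lies on no wall of a
compact root, `C` consists of the `ξ` that lie, for every compact root, in the same closed
half-space as `lam`. Roots take imaginary values on `𝔱`. -/
def IsWeylChamber (C : Set (Module.Dual ℝ (LieAlg EK K))) : Prop :=
  ∃ lam ∈ torusDual EK T, (∀ α ∈ compactRoots EK ET T, weightPairing E EK ET T α lam ≠ 0) ∧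
    C = {ξ ∈ torusDual EK T | ∀ α ∈ compactRoots EK ET T,
      0 ≤ (weightPairing E EK ET T α ξ).im * (weightPairing E EK ET T α lam).im}

/-- The set of strongly elliptic elements of `𝔨*`: the union of the coadjoint `K`-orbits through
the points of the positive Weyl chamber `C` off the noncompact walls. -/
def stronglyEllipticSet (C : Set (Module.Dual ℝ (LieAlg EK K))) :
    Set (Module.Dual ℝ (LieAlg EK K)) :=
  {η | ∃ k : K, ∃ ξ ∈ C \ noncompactWalls E EK ET T, η = coadjointAction EK k ξ}

end Elliptic

/-! ### The fibred product `G ×_K N` -/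

section FibredProduct

variable {G : Type*} [Group G] (K : Subgroup G) (N : Type*) [MulAction K N]

/-- The orbit relation of the action `k · (g, n) = (g k⁻¹, k n)` of `K` on `G × N`. -/
def fibredSetoid : Setoid (G × N) where
  r a b := ∃ k : K, b = (a.1 * (k : G)⁻¹, k • a.2)
  iseqv :=
    { refl := fun a => ⟨1, by simp⟩
      symm := by
        rintro a b ⟨k, rfl⟩
        exact ⟨k⁻¹, by simp⟩
      trans := by
        rintro a b c ⟨k, rfl⟩ ⟨l, rfl⟩
        exact ⟨l * k, by simp [mul_assoc, mul_smul]⟩ }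

/-- The fibred product `G ×_K N`. -/
def FibredProduct : Type _ := Quotient (fibredSetoid K N)

namespace FibredProduct

instance [TopologicalSpace G] [TopologicalSpace N] : TopologicalSpace (FibredProduct K N) :=
  inferInstanceAs (TopologicalSpace (Quotient (fibredSetoid K N)))

variable {N}

/-- The class `[g, n]`. -/
def mk (a : G × N) : FibredProduct K N := Quotient.mk (fibredSetoid K N) a

/-- The action of `G` on `G ×_K N` by left multiplication on the first factor. -/
instance : MulAction G (FibredProduct K N) where
  smul g := Quotient.map (sa := fibredSetoid K N) (sb := fibredSetoid K N)
    (fun a => (g * a.1, a.2)) (by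
      rintro a b ⟨k, rfl⟩
      exact ⟨k, by simp [mul_assoc]⟩)
  one_smul x := by
    induction x using Quotient.inductionOn with
    | h a => exact congrArg (Quotient.mk (fibredSetoid K N)) (by simp)
  mul_smul g h x := by
    induction x using Quotient.inductionOn with
    | h a => exact congrArg (Quotient.mk (fibredSetoid K N)) (by simp [mul_assoc])

theorem smul_mk (g : G) (a : G × N) : g • mk K a = mk K (g * a.1, a.2) := rfl

end FibredProduct

end FibredProduct

section Induction

variable (E : Type*) [NormedAddCommGroup E] [NormedSpace ℝ E]
  {G : Type*} [TopologicalSpace G] [ChartedSpace E G] [Group G]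
  (EK : Type*) [NormedAddCommGroup EK] [NormedSpace ℝ EK]
  (K : Subgroup G) [ChartedSpace EK K]
  (F : Type*) [NormedAddCommGroup F] [NormedSpace ℝ F]
  (N : Type*) [TopologicalSpace N] [ChartedSpace F N] [MulAction K N]
  (EM : Type*) [NormedAddCommGroup EM] [NormedSpace ℝ EM]

/-- The given atlas on the topological quotient `G ×_K N` is that of the quotient manifold: it is
a smooth atlas for which the quotient map `G × N → G ×_K N` is a submersion. (There is
at most one such smooth structure.) -/
structure IsQuotientManifold [ChartedSpace EM (FibredProduct K N)] : Prop where
  isManifold : IsManifold 𝓘(ℝ, EM) ∞ (FibredProduct K N)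
  submersion : Manifold.IsSubmersion (𝓘(ℝ, E).prod 𝓘(ℝ, F)) 𝓘(ℝ, EM) ∞
    (FibredProduct.mk K : G × N → FibredProduct K N)

/-- The Euclidean model space of `G ×_K N`, of dimension `dim G + dim N - dim K`. -/
abbrev FibredModel (E EK F : Type*) [NormedAddCommGroup E] [NormedSpace ℝ E]
    [NormedAddCommGroup EK] [NormedSpace ℝ EK] [NormedAddCommGroup F] [NormedSpace ℝ F] : Type :=
  EuclideanSpace ℝ (Fin (Module.finrank ℝ E + Module.finrank ℝ F - Module.finrank ℝ EK))

variable {N} {F} in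
/-- The image in `T_{[e,n]}(G ×_K N)` of `X ∈ 𝔤` and `v ∈ T_n N` under the derivative of the
quotient map at `(e, n)`. For `X ∈ 𝔭` this is the identification
`T_n N ⊕ 𝔭 ≅ T_{[e,n]}(G ×_K N)`. -/
def tangentAtUnit [ChartedSpace EM (FibredProduct K N)] (n : N) (v : TangentSpace 𝓘(ℝ, F) n)
    (X : LieAlg E G) : TangentSpace 𝓘(ℝ, EM) (FibredProduct.mk K ((1 : G), n)) :=
  (mfderiv (𝓘(ℝ, E).prod 𝓘(ℝ, F)) 𝓘(ℝ, EM)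
    (FibredProduct.mk K : G × N → FibredProduct K N) ((1 : G), n) : E × F →L[ℝ] EM) (X, v)

variable {N} {F} {EM} in
/-- `Ω` is the 2-form on `G ×_K N` induced by `(N, ν, Φ)`: it is `G`-invariant and
`Ω_{[e,n]}(v + X, w + Y) = ν_n(v, w) - ⟨Φ(n), [X, Y]⟩` for `X, Y ∈ 𝔭` and `v, w ∈ T_n N`. -/
structure IsInducedForm [CompleteSpace E] [LieGroup 𝓘(ℝ, E) ∞ G]
    [ChartedSpace EM (FibredProduct K N)] (ν : TwoForm F N)
    (Φ : N → Module.Dual ℝ (LieAlg EK K)) (Ω : TwoForm EM (FibredProduct K N)) : Prop where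
  invariant : Ω.IsInvariant G
  formula : ∀ (n : N) (v w : TangentSpace 𝓘(ℝ, F) n),
    ∀ X ∈ killingComplement E EK K, ∀ Y ∈ killingComplement E EK K,
      Ω (FibredProduct.mk K ((1 : G), n))
          ![tangentAtUnit E K EM n v X, tangentAtUnit E K EM n w Y] =
        ν n ![v, w] - extendDual E EK K (Φ n) ⁅X, Y⁆

end Induction

end

/-! Let 𝔭 be the Killing complement of 𝔨, π : 𝔤 → 𝔨 the projection along 𝔭, and θ the left
Maurer–Cartan form of G. The form on G ×_K N is found upstairs: on G × N consider ν + d⟨Φ, π θ⟩. By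
the Maurer–Cartan equation (`contDiffAt_leftLogDeriv`) its value on left-trivialized tangent vectors
(X, v), (Y, w) at (g, n) is ν(v, w) + ⟨dΦ(v), πY⟩ - ⟨dΦ(w), πX⟩ - ⟨Φ(n), π[X, Y]⟩, which is
`baseForm`; its transport to G × N is `liftForm`. It is closed because dν = 0 and d² = 0
(`liftForm_pullback_eq`), and it is invariant under left translation by G because θ is.

This form descends to the quotient. It is K-invariant since Φ and π are equivariant
(`baseForm_smul`), and it kills the directions (-z, z_N) of the K-orbits; this last fact is exactly
the momentum equation together with its infinitesimal equivariance (`baseForm_vertical`). Hence two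
local lifts of a map into the quotient pull it back to the same form (`liftForm_tderiv_eq`), and
pulling back along local sections defines Ω (`exists_isPullbackForm`). Smoothness and closedness are
checked on local sections. On T_nN ⊕ 𝔭 the terms with dΦ vanish, which leaves the prescribed formula
(`IsPullbackForm.apply_horizontal`); as left translates of these vectors exhaust the tangent spaces,
Ω is unique.

Nondegeneracy reduces to that of ν and of (X, Y) ↦ ⟨ξ, [X, Y]⟩ on 𝔭, for ξ = Φ(n). By equivariance ξ
may be taken in 𝔱*. It is then B(H, ·) on 𝔤 for some H in 𝔱, B being the Killing form, and B(H, [X,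
Y]) = B([H, X], Y), so the radical is the centralizer of H in 𝔭. If that is nonzero, its
complexification contains a simultaneous eigenvector of 𝔱. Its weight is nonzero because 𝔱 is
self-normalizing and lies in 𝔨, it is noncompact because root spaces are lines, and it vanishes at
H: ξ lies on a noncompact wall (`eq_zero_of_lie_eq_zero_of_noncompact`,
`eq_zero_of_pairing_eq_zero`).

That 𝔤 = 𝔨 ⊕ 𝔭 comes from compactness of K: averaging gives an inner product for which ad X is skew
for X in 𝔨, so tr (ad X)² = 0 forces X = 0 (`killingForm_self_eq_zero`).

For the momentum map, the vector field of Z on the quotient lifts to the right-invariant field of Z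
on G, whose left trivialization is Ad(g⁻¹)Z. Inserting it into `liftForm` yields the derivative of
⟨Φ(n), π Ad(g⁻¹)Z⟩ (`tderiv_comoment_Ad_inv`).

The manifold structure of G ×_K N rests on a slice of K at the identity, given by the inverse
function theorem (`IsLieSubgroup.exists_slice`, `exists_manifold_of_slices`). -/

open scoped Topology

noncomputable section

set_option linter.unusedSectionVars false

/-! ### Manifold derivatives as maps between model spaces -/

section TangentDerivative

variable {E₁ : Type*} [NormedAddCommGroup E₁] [NormedSpace ℝ E₁] {H₁ : Type*} [TopologicalSpace H₁]
  {I₁ : ModelWithCorners ℝ E₁ H₁} {M₁ : Type*} [TopologicalSpace M₁] [ChartedSpace H₁ M₁]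
  {E₂ : Type*} [NormedAddCommGroup E₂] [NormedSpace ℝ E₂] {H₂ : Type*} [TopologicalSpace H₂]
  {I₂ : ModelWithCorners ℝ E₂ H₂} {M₂ : Type*} [TopologicalSpace M₂] [ChartedSpace H₂ M₂]
  {E₃ : Type*} [NormedAddCommGroup E₃] [NormedSpace ℝ E₃] {H₃ : Type*} [TopologicalSpace H₃]
  {I₃ : ModelWithCorners ℝ E₃ H₃} {M₃ : Type*} [TopologicalSpace M₃] [ChartedSpace H₃ M₃]

variable (I₁ I₂) in
/-- The manifold derivative, as a map between the model vector spaces. -/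
def tderiv (f : M₁ → M₂) (x : M₁) : E₁ →L[ℝ] E₂ := mfderiv I₁ I₂ f x

theorem tderiv_comp {g : M₂ → M₃} {f : M₁ → M₂} {x : M₁}
    (hg : MDifferentiableAt I₂ I₃ g (f x)) (hf : MDifferentiableAt I₁ I₂ f x) :
    tderiv I₁ I₃ (fun y => g (f y)) x = (tderiv I₂ I₃ g (f x)).comp (tderiv I₁ I₂ f x) :=
  mfderiv_comp x hg hf

theorem tderiv_comp_apply {g : M₂ → M₃} {f : M₁ → M₂} {x : M₁}
    (hg : MDifferentiableAt I₂ I₃ g (f x)) (hf : MDifferentiableAt I₁ I₂ f x) (v : E₁) :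
    tderiv I₁ I₃ (fun y => g (f y)) x v = tderiv I₂ I₃ g (f x) (tderiv I₁ I₂ f x v) := by
  rw [tderiv_comp hg hf]; rfl

theorem tderiv_congr {f g : M₁ → M₂} {x : M₁} (h : f =ᶠ[𝓝 x] g) :
    tderiv I₁ I₂ f x = tderiv I₁ I₂ g x :=
  h.mfderiv_eq

theorem tderiv_id (x : M₁) : tderiv I₁ I₁ (fun y : M₁ => y) x = ContinuousLinearMap.id ℝ E₁ :=
  mfderiv_id

theorem tderiv_const (x : M₁) (y : M₂) : tderiv I₁ I₂ (fun _ : M₁ => y) x = 0 :=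
  mfderiv_const

theorem tderiv_prodMk {f : M₁ → M₂} {g : M₁ → M₃} {x : M₁}
    (hf : MDifferentiableAt I₁ I₂ f x) (hg : MDifferentiableAt I₁ I₃ g x) :
    tderiv I₁ (I₂.prod I₃) (fun y => (f y, g y)) x
      = (tderiv I₁ I₂ f x).prod (tderiv I₁ I₃ g x) :=
  hf.mfderiv_prod hg

theorem tderiv_fst (x : M₁ × M₂) :
    tderiv (I₁.prod I₂) I₁ Prod.fst x = ContinuousLinearMap.fst ℝ E₁ E₂ :=
  mfderiv_fst

theorem tderiv_snd (x : M₁ × M₂) :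
    tderiv (I₁.prod I₂) I₂ Prod.snd x = ContinuousLinearMap.snd ℝ E₁ E₂ :=
  mfderiv_snd

theorem tderiv_eq_fderiv {f : E₁ → E₂} {x : E₁} :
    tderiv 𝓘(ℝ, E₁) 𝓘(ℝ, E₂) f x = fderiv ℝ f x :=
  mfderiv_eq_fderiv

theorem tderiv_eq_fderiv_chart [ChartedSpace E₁ M₁] [ChartedSpace E₂ M₂] {f : M₁ → M₂} {x : M₁}
    (hf : MDifferentiableAt 𝓘(ℝ, E₁) 𝓘(ℝ, E₂) f x) :
    tderiv 𝓘(ℝ, E₁) 𝓘(ℝ, E₂) f x =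
      fderiv ℝ (fun y => chartAt E₂ (f x) (f ((chartAt E₁ x).symm y))) (chartAt E₁ x x) := by
  unfold tderiv
  rw [hf.mfderiv]
  simp only [modelWithCornersSelf_coe, Set.range_id, fderivWithin_univ]
  rfl

theorem tderiv_eq_fderiv_chart_right [ChartedSpace E₂ M₂] {f : E₁ → M₂} {x : E₁}
    (hf : MDifferentiableAt 𝓘(ℝ, E₁) 𝓘(ℝ, E₂) f x) :
    tderiv 𝓘(ℝ, E₁) 𝓘(ℝ, E₂) f x = fderiv ℝ (fun y => chartAt E₂ (f x) (f y)) x :=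
  tderiv_eq_fderiv_chart hf

/-- Tangent spaces are identified with the model space through the preferred chart at the point
itself. This is why computations in the chart at the identity of a Lie group give invariant answers
without correction terms. -/
theorem tderiv_chartAt_self [ChartedSpace E₁ M₁] [IsManifold 𝓘(ℝ, E₁) ∞ M₁] (x : M₁) :
    tderiv 𝓘(ℝ, E₁) 𝓘(ℝ, E₁) (chartAt E₁ x) x = ContinuousLinearMap.id ℝ E₁ := by
  have h : MDifferentiableAt 𝓘(ℝ, E₁) 𝓘(ℝ, E₁) (chartAt E₁ x) x :=
    mdifferentiableAt_atlas (chart_mem_atlas E₁ x) (mem_chart_source E₁ x)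
  rw [tderiv_eq_fderiv_chart h]
  have : (fun y => chartAt E₁ (chartAt E₁ x x) (chartAt E₁ x ((chartAt E₁ x).symm y)))
      =ᶠ[𝓝 (chartAt E₁ x x)] id := by
    filter_upwards [(chartAt E₁ x).open_target.mem_nhds (mem_chart_target E₁ x)] with y hy
    exact (chartAt E₁ x).right_inv hy
  rw [this.fderiv_eq, fderiv_id]

theorem tderiv_chartAt_symm_self [ChartedSpace E₁ M₁] [IsManifold 𝓘(ℝ, E₁) ∞ M₁] (x : M₁) :
    tderiv 𝓘(ℝ, E₁) 𝓘(ℝ, E₁) (chartAt E₁ x).symm (chartAt E₁ x x) =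
      ContinuousLinearMap.id ℝ E₁ := by
  have h : MDifferentiableAt 𝓘(ℝ, E₁) 𝓘(ℝ, E₁) (chartAt E₁ x).symm (chartAt E₁ x x) :=
    mdifferentiableAt_atlas_symm (chart_mem_atlas E₁ x) (mem_chart_target E₁ x)
  rw [tderiv_eq_fderiv_chart_right h]
  have : (fun y => chartAt E₁ ((chartAt E₁ x).symm (chartAt E₁ x x)) ((chartAt E₁ x).symm y))
      =ᶠ[𝓝 (chartAt E₁ x x)] id := by
    rw [(chartAt E₁ x).left_inv (mem_chart_source E₁ x)]
    filter_upwards [(chartAt E₁ x).open_target.mem_nhds (mem_chart_target E₁ x)] with y hy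
    simp [(chartAt E₁ x).right_inv hy]
  rw [this.fderiv_eq, fderiv_id]

theorem ContMDiffAt.mdiff {f : M₁ → M₂} {x : M₁} (h : ContMDiffAt I₁ I₂ ∞ f x) :
    MDifferentiableAt I₁ I₂ f x :=
  h.mdifferentiableAt (by simp)

theorem ContMDiff.mdiff {f : M₁ → M₂} (h : ContMDiff I₁ I₂ ∞ f) (x : M₁) :
    MDifferentiableAt I₁ I₂ f x :=
  h.contMDiffAt.mdiff

theorem contMDiffAt_chartAt [ChartedSpace E₁ M₁] [IsManifold 𝓘(ℝ, E₁) ∞ M₁] {x y : M₁}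
    (h : y ∈ (chartAt E₁ x).source) : ContMDiffAt 𝓘(ℝ, E₁) 𝓘(ℝ, E₁) ∞ (chartAt E₁ x) y :=
  (contMDiffOn_chart.contMDiffAt ((chartAt E₁ x).open_source.mem_nhds h))

theorem contMDiffAt_chartAt_symm [ChartedSpace E₁ M₁] [IsManifold 𝓘(ℝ, E₁) ∞ M₁] {x : M₁} {y : E₁}
    (h : y ∈ (chartAt E₁ x).target) : ContMDiffAt 𝓘(ℝ, E₁) 𝓘(ℝ, E₁) ∞ (chartAt E₁ x).symm y :=
  (contMDiffOn_chart_symm.contMDiffAt ((chartAt E₁ x).open_target.mem_nhds h))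

end TangentDerivative

theorem isSymmSndFDerivAt_of_contDiffAt {V W : Type*} [NormedAddCommGroup V] [NormedSpace ℝ V]
    [NormedAddCommGroup W] [NormedSpace ℝ W] {f : V → W} {x : V} (h : ContDiffAt ℝ ∞ f x)
    (u v : V) : fderiv ℝ (fderiv ℝ f) x u v = fderiv ℝ (fderiv ℝ f) x v u :=
  h.isSymmSndFDerivAt (by rw [minSmoothness_of_isRCLikeNormedField]; exact ENat.LEInfty.out) u v

/-- Mixed partial derivatives commute. -/
theorem fderiv_fderiv_comm {V W X : Type*} [NormedAddCommGroup V] [NormedSpace ℝ V]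
    [NormedAddCommGroup W] [NormedSpace ℝ W] [NormedAddCommGroup X] [NormedSpace ℝ X]
    {f : V → W → X} {a : V} {b : W} (h : ContDiffAt ℝ ∞ (Function.uncurry f) (a, b))
    (u : V) (v : W) :
    fderiv ℝ (fun z => fderiv ℝ (f z) b) a u v =
      fderiv ℝ (fun x => fderiv ℝ (fun z => f z x) a) b v u := by
  set F := Function.uncurry f with hF
  have hd : ∀ᶠ p in 𝓝 (a, b), DifferentiableAt ℝ F p := by
    have := (h.of_le (m := 1) ENat.LEInfty.out).eventually (by simp)
    filter_upwards [this] with p hp using hp.differentiableAt (by simp)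
  have h2 : DifferentiableAt ℝ (fderiv ℝ F) (a, b) :=
    (h.fderiv_right (m := 1) (by rw [one_add_one_eq_two]; exact ENat.LEInfty.out)).differentiableAt
      (by simp)
  have e1 : (fun z => fderiv ℝ (f z) b) =ᶠ[𝓝 a]
      fun z => (fderiv ℝ F (z, b)).comp (ContinuousLinearMap.inr ℝ V W) := by
    have : Filter.Tendsto (fun z : V => (z, b)) (𝓝 a) (𝓝 (a, b)) :=
      (Continuous.prodMk_left b).continuousAt
    filter_upwards [this.eventually hd] with z hz
    exact (HasFDerivAt.comp (f := fun x : W => (z, x)) b hz.hasFDerivAt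
      (hasFDerivAt_prodMk_right z b)).fderiv
  have e2 : (fun x => fderiv ℝ (fun z => f z x) a) =ᶠ[𝓝 b]
      fun x => (fderiv ℝ F (a, x)).comp (ContinuousLinearMap.inl ℝ V W) := by
    have : Filter.Tendsto (fun x : W => (a, x)) (𝓝 b) (𝓝 (a, b)) :=
      (Continuous.prodMk_right a).continuousAt
    filter_upwards [this.eventually hd] with x hx
    exact (HasFDerivAt.comp (f := fun z : V => (z, x)) a hx.hasFDerivAt
      (hasFDerivAt_prodMk_left a x)).fderiv
  rw [e1.fderiv_eq, e2.fderiv_eq]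
  have d1 := (HasFDerivAt.comp (f := fun z : V => (z, b)) a h2.hasFDerivAt
    (hasFDerivAt_prodMk_left a b)).clm_comp
    (hasFDerivAt_const (ContinuousLinearMap.inr ℝ V W) a)
  have d2 := (HasFDerivAt.comp (f := fun x : W => (a, x)) b h2.hasFDerivAt
    (hasFDerivAt_prodMk_right a b)).clm_comp
    (hasFDerivAt_const (ContinuousLinearMap.inl ℝ V W) b)
  have d1' := d1.fderiv
  have d2' := d2.fderiv
  simp only [Function.comp_def] at d1' d2'
  rw [d1', d2']
  -- Both sides are now values of the second derivative of the uncurried map, at the pairs (u, 0),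
  -- (0, v) in the two orders.
  simpa using isSymmSndFDerivAt_of_contDiffAt h (u, 0) (0, v)

/-! ### The bracket and the adjoint action in the chart at the identity -/

section LieGroupCalculus

variable (E : Type*) [NormedAddCommGroup E] [NormedSpace ℝ E]
  (G : Type*) [TopologicalSpace G] [ChartedSpace E G] [Group G]

/-- The multiplication of a Lie group, read in the preferred chart at the identity. -/
def chartMul (z x : E) : E :=
  chartAt E (1 : G) ((chartAt E (1 : G)).symm z * (chartAt E (1 : G)).symm x)

/-- The coordinates of the identity. -/
def chartOne : E := chartAt E (1 : G) 1

/-- The derivative at the identity of left multiplication, in the chart at the identity. -/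
def chartMulLeft (z : E) : E →L[ℝ] E := fderiv ℝ (chartMul E G z) (chartOne E G)

/-- The derivative at the identity of right multiplication, in the chart at the identity. -/
def chartMulRight (z : E) : E →L[ℝ] E := fderiv ℝ (fun x => chartMul E G x z) (chartOne E G)

/-- The Lie bracket of a Lie group as a continuous bilinear map on the model space. -/
def lieBr : E →L[ℝ] E →L[ℝ] E :=
  fderiv ℝ (chartMulLeft E G) (chartOne E G) - (fderiv ℝ (chartMulLeft E G) (chartOne E G)).flip

variable {G}

/-- The adjoint action on the model space. -/
def Ad (g : G) : E →L[ℝ] E := tderiv 𝓘(ℝ, E) 𝓘(ℝ, E) (fun x : G => g * x * g⁻¹) 1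

/-- Left trivialization of the tangent bundle. -/
def leftTriv (g : G) : E →L[ℝ] E := tderiv 𝓘(ℝ, E) 𝓘(ℝ, E) (fun x : G => g⁻¹ * x) g

variable {E}

variable [LieGroup 𝓘(ℝ, E) ∞ G]

theorem chartOne_mem : chartOne E G ∈ (chartAt E (1 : G)).target := mem_chart_target E 1

theorem chart_symm_chartOne : (chartAt E (1 : G)).symm (chartOne E G) = 1 :=
  (chartAt E (1 : G)).left_inv (mem_chart_source E 1)

theorem contDiffAt_chartMul {z x : E} (hz : z ∈ (chartAt E (1 : G)).target)
    (hx : x ∈ (chartAt E (1 : G)).target)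
    (h : (chartAt E (1 : G)).symm z * (chartAt E (1 : G)).symm x ∈ (chartAt E (1 : G)).source) :
    ContDiffAt ℝ ∞ (Function.uncurry (chartMul E G)) (z, x) := by
  rw [← contMDiffAt_iff_contDiffAt]
  have hz' : ContMDiffAt 𝓘(ℝ, E × E) 𝓘(ℝ, E) ∞
      (fun p : E × E => (chartAt E (1 : G)).symm p.1) (z, x) :=
    ContMDiffAt.comp (z, x) (contMDiffAt_chartAt_symm hz) contDiff_fst.contMDiff.contMDiffAt
  have hx' : ContMDiffAt 𝓘(ℝ, E × E) 𝓘(ℝ, E) ∞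
      (fun p : E × E => (chartAt E (1 : G)).symm p.2) (z, x) :=
    ContMDiffAt.comp (z, x) (contMDiffAt_chartAt_symm hx) contDiff_snd.contMDiff.contMDiffAt
  exact ContMDiffAt.comp (z, x) (contMDiffAt_chartAt h) (hz'.mul hx')

theorem contDiffAt_chartMul_one :
    ContDiffAt ℝ ∞ (Function.uncurry (chartMul E G)) (chartOne E G, chartOne E G) :=
  contDiffAt_chartMul chartOne_mem chartOne_mem (by
    rw [chart_symm_chartOne, one_mul]; exact mem_chart_source E 1)

theorem contDiffAt_chartMulLeft : ContDiffAt ℝ ∞ (chartMulLeft E G) (chartOne E G) :=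
  ContDiffAt.fderiv (f := chartMul E G) (g := fun _ => chartOne E G)
    contDiffAt_chartMul_one contDiffAt_const (n := ∞) (by simp)

theorem contDiffAt_chartMulRight : ContDiffAt ℝ ∞ (chartMulRight E G) (chartOne E G) := by
  refine ContDiffAt.fderiv (f := fun z x => chartMul E G x z) (g := fun _ => chartOne E G)
    (n := ∞) ?_ contDiffAt_const (by simp)
  exact ContDiffAt.comp (chartOne E G, chartOne E G) (g := Function.uncurry (chartMul E G))
    (f := Prod.swap) contDiffAt_chartMul_one (contDiff_snd.prodMk contDiff_fst).contDiffAt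

theorem tderiv_chart_mul_left {z : E}
    (h : (chartAt E (1 : G)).symm z ∈ (chartAt E (1 : G)).source) :
    tderiv 𝓘(ℝ, E) 𝓘(ℝ, E) (fun x : G => chartAt E (1 : G) ((chartAt E (1 : G)).symm z * x)) 1
      = chartMulLeft E G z := by
  rw [tderiv_eq_fderiv_chart]
  · rfl
  · refine MDifferentiableAt.comp (I' := 𝓘(ℝ, E)) 1 (contMDiffAt_chartAt (E₁ := E) ?_).mdiff
      (contMDiff_mul_left (I := 𝓘(ℝ, E)) (n := ∞) |>.mdiff _)
    simpa using h

theorem tderiv_chart_mul_right {z : E}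
    (h : (chartAt E (1 : G)).symm z ∈ (chartAt E (1 : G)).source) :
    tderiv 𝓘(ℝ, E) 𝓘(ℝ, E) (fun x : G => chartAt E (1 : G) (x * (chartAt E (1 : G)).symm z)) 1
      = chartMulRight E G z := by
  rw [tderiv_eq_fderiv_chart]
  · rfl
  · refine MDifferentiableAt.comp (I' := 𝓘(ℝ, E)) 1 (contMDiffAt_chartAt (E₁ := E) ?_).mdiff
      (contMDiff_mul_right (I := 𝓘(ℝ, E)) (n := ∞) |>.mdiff _)
    simpa using h

theorem chartMulLeft_one : chartMulLeft E G (chartOne E G) = ContinuousLinearMap.id ℝ E := by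
  rw [← tderiv_chart_mul_left (by rw [chart_symm_chartOne]; exact mem_chart_source E 1),
    chart_symm_chartOne]
  simp only [one_mul]
  exact tderiv_chartAt_self 1

theorem chartMulRight_one : chartMulRight E G (chartOne E G) = ContinuousLinearMap.id ℝ E := by
  rw [← tderiv_chart_mul_right (by rw [chart_symm_chartOne]; exact mem_chart_source E 1),
    chart_symm_chartOne]
  simp only [mul_one]
  exact tderiv_chartAt_self 1

/-- Both sides are the mixed second derivative of the multiplication at (1, 1), taken in the two
orders. -/
theorem fderiv_chartMulRight (X Y : E) :
    fderiv ℝ (chartMulRight E G) (chartOne E G) X Y =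
      fderiv ℝ (chartMulLeft E G) (chartOne E G) Y X :=
  (fderiv_fderiv_comm contDiffAt_chartMul_one Y X).symm

theorem eventually_mem_chart_one :
    ∀ᶠ z in 𝓝 (chartOne E G), z ∈ (chartAt E (1 : G)).target :=
  (chartAt E (1 : G)).open_target.mem_nhds chartOne_mem

variable [CompleteSpace E]

-- In the chart at 1 the left-invariant field of v is z ↦ `chartMulLeft E G z v`, and `chartMulLeft`
-- is the identity at 1. The bracket of two such fields at 1 is therefore the antisymmetrized
-- derivative of `chartMulLeft`. From here on the bracket is a concrete bilinear map that can be
-- differentiated and composed.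
open VectorField in
theorem bracket_eq_lieBr (X Y : LieAlg E G) : ⁅X, Y⁆ = lieBr E G X Y := by
  have key : ∀ v : E,
      (mpullbackWithin 𝓘(ℝ, E) 𝓘(ℝ, E) (extChartAt 𝓘(ℝ, E) (1 : G)).symm
        (mulInvariantVectorField v) (Set.range 𝓘(ℝ, E)) : E → E)
        =ᶠ[𝓝 (chartOne E G)] fun z => chartMulLeft E G z v := by
    intro v
    filter_upwards [eventually_mem_chart_one (E := E) (G := G)] with z hz
    have hs := (chartAt E (1 : G)).map_target hz
    rw [mpullbackWithin_apply]
    simp only [modelWithCornersSelf_coe, Set.range_id, mfderivWithin_univ]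
    set g := (chartAt E (1 : G)).symm z with hg
    have hφ := (contMDiffAt_chartAt (E₁ := E) hs).mdiff
    have hψ := (contMDiffAt_chartAt_symm (E₁ := E) (x := (1 : G)) hz).mdiff
    have e1 : (tderiv 𝓘(ℝ, E) 𝓘(ℝ, E) (chartAt E (1 : G)) g).comp
        (tderiv 𝓘(ℝ, E) 𝓘(ℝ, E) (chartAt E (1 : G)).symm z) = ContinuousLinearMap.id ℝ E := by
      rw [← tderiv_comp (f := (chartAt E (1 : G)).symm) hφ hψ, ← tderiv_id (I₁ := 𝓘(ℝ, E)) z]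
      apply tderiv_congr
      filter_upwards [(chartAt E (1 : G)).open_target.mem_nhds hz] with y hy
      exact (chartAt E (1 : G)).right_inv hy
    have e2 : (tderiv 𝓘(ℝ, E) 𝓘(ℝ, E) (chartAt E (1 : G)).symm z).comp
        (tderiv 𝓘(ℝ, E) 𝓘(ℝ, E) (chartAt E (1 : G)) g) = ContinuousLinearMap.id ℝ E := by
      have hz' : z = chartAt E (1 : G) g := ((chartAt E (1 : G)).right_inv hz).symm
      rw [hz'] at hψ ⊢
      rw [← tderiv_comp (f := chartAt E (1 : G)) hψ hφ, ← tderiv_id (I₁ := 𝓘(ℝ, E)) g]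
      apply tderiv_congr
      filter_upwards [(chartAt E (1 : G)).open_source.mem_nhds hs] with y hy
      exact (chartAt E (1 : G)).left_inv hy
    have e3 : (tderiv 𝓘(ℝ, E) 𝓘(ℝ, E) (chartAt E (1 : G)).symm z).inverse =
        tderiv 𝓘(ℝ, E) 𝓘(ℝ, E) (chartAt E (1 : G)) g :=
      ContinuousLinearMap.inverse_eq e2 e1
    have e4 : chartMulLeft E G z v = tderiv 𝓘(ℝ, E) 𝓘(ℝ, E) (chartAt E (1 : G)) g
        (tderiv 𝓘(ℝ, E) 𝓘(ℝ, E) (fun x : G => g * x) 1 v) := by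
      have h1 : MDifferentiableAt 𝓘(ℝ, E) 𝓘(ℝ, E) (chartAt E (1 : G)) (g * 1) := by
        rwa [mul_one]
      have h2 := tderiv_comp_apply (g := chartAt E (1 : G)) (f := fun x : G => g * x) h1
        ((contMDiff_mul_left (I := 𝓘(ℝ, E)) (n := ∞)).mdiff _) v
      rw [mul_one] at h2
      rw [← tderiv_chart_mul_left hs, ← h2]
    rw [e4, ← e3]
    rfl
  have hc : ∀ v : E, fderiv ℝ (fun z => chartMulLeft E G z v) (chartOne E G) =
      (fderiv ℝ (chartMulLeft E G) (chartOne E G)).flip v := by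
    intro v
    have := (((contDiffAt_chartMulLeft (E := E) (G := G)).differentiableAt (by simp)).hasFDerivAt.clm_apply
      (hasFDerivAt_const v _)).fderiv
    rw [this]
    ext u
    simp
  have h1 : ⁅X, Y⁆ =
      lieBracket ℝ (fun z => chartMulLeft E G z X) (fun z => chartMulLeft E G z Y)
        (chartOne E G) := by
    rw [GroupLieAlgebra.bracket_def, ← mlieBracketWithin_univ, mlieBracketWithin_apply]
    have hid : (mfderiv 𝓘(ℝ, E) 𝓘(ℝ, E) (extChartAt 𝓘(ℝ, E) (1 : G)) (1 : G)).inverse =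
        ContinuousLinearMap.id ℝ E := by
      have : mfderiv 𝓘(ℝ, E) 𝓘(ℝ, E) (extChartAt 𝓘(ℝ, E) (1 : G)) (1 : G) =
        ContinuousLinearMap.id ℝ E := tderiv_chartAt_self (E₁ := E) (1 : G)
      rw [this]
      exact ContinuousLinearMap.inverse_id
    rw [hid]
    have aux : ∀ V W V' W' : E → E, V =ᶠ[𝓝 (chartOne E G)] V' → W =ᶠ[𝓝 (chartOne E G)] W' →
        ContinuousLinearMap.id ℝ E (lieBracketWithin ℝ V W
          ((extChartAt 𝓘(ℝ, E) (1 : G)).symm ⁻¹' Set.univ ∩ Set.range 𝓘(ℝ, E)) (chartOne E G)) =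
        lieBracket ℝ V' W' (chartOne E G) := by
      intro V W V' W' hV hW
      have huniv : (extChartAt 𝓘(ℝ, E) (1 : G)).symm ⁻¹' Set.univ ∩ Set.range 𝓘(ℝ, E) =
        (Set.univ : Set E) := by simp
      rw [huniv, lieBracketWithin_univ]
      exact hV.lieBracket_vectorField_eq hW
    exact aux _ _ _ _ (key X) (key Y)
  have h2 : ∀ X Y : E, lieBracket ℝ (fun z => chartMulLeft E G z X)
      (fun z => chartMulLeft E G z Y) (chartOne E G) = lieBr E G X Y := by
    intro X Y
    rw [lieBracket, hc, hc, chartMulLeft_one]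
    simp [lieBr]
  exact h1.trans (h2 X Y)


omit [CompleteSpace E] in
theorem Ad_one : Ad E (1 : G) = ContinuousLinearMap.id ℝ E := by
  unfold Ad
  simp only [one_mul, inv_one, mul_one]
  exact tderiv_id 1

omit [CompleteSpace E] in
theorem contMDiff_conj (g : G) : ContMDiff 𝓘(ℝ, E) 𝓘(ℝ, E) ∞ (fun x : G => g * x * g⁻¹) :=
  (contMDiff_const.mul contMDiff_id).mul contMDiff_const

omit [CompleteSpace E] in
theorem Ad_mul (g h : G) : Ad E (g * h) = (Ad E g).comp (Ad E h) := by
  have h1 : MDifferentiableAt 𝓘(ℝ, E) 𝓘(ℝ, E) (fun x : G => g * x * g⁻¹) (h * 1 * h⁻¹) :=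
    (contMDiff_conj g).mdiff _
  have := tderiv_comp (I₁ := 𝓘(ℝ, E)) (g := fun x : G => g * x * g⁻¹)
    (f := fun x : G => h * x * h⁻¹) h1 ((contMDiff_conj h).mdiff 1)
  rw [mul_one, mul_inv_cancel] at this
  unfold Ad
  rw [← this]
  congr 1
  ext x
  simp [mul_assoc]

omit [CompleteSpace E] in
theorem Ad_mul_apply (g h : G) (X : E) : Ad E (g * h) X = Ad E g (Ad E h X) := by
  rw [Ad_mul]; rfl

omit [CompleteSpace E] in
theorem Ad_inv_apply_Ad (g : G) (X : E) : Ad E g⁻¹ (Ad E g X) = X := by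
  rw [← Ad_mul_apply, inv_mul_cancel, Ad_one]; rfl

omit [CompleteSpace E] in
theorem Ad_apply_Ad_inv (g : G) (X : E) : Ad E g (Ad E g⁻¹ X) = X := by
  rw [← Ad_mul_apply, mul_inv_cancel, Ad_one]; rfl

omit [CompleteSpace E] in
-- This is gx = (g x g⁻¹) g, differentiated in x at 1. Read as a linear equation for Ad(g), it gives
-- both smoothness near 1 and the derivative.
theorem chartMulRight_comp_Ad {z : E}
    (h : (chartAt E (1 : G)).symm z ∈ (chartAt E (1 : G)).source) :
    (chartMulRight E G z).comp (Ad E ((chartAt E (1 : G)).symm z)) = chartMulLeft E G z := by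
  rw [← tderiv_chart_mul_right h, ← tderiv_chart_mul_left h]
  set g := (chartAt E (1 : G)).symm z
  have h1 : MDifferentiableAt 𝓘(ℝ, E) 𝓘(ℝ, E) (fun x : G => chartAt E (1 : G) (x * g))
      (g * 1 * g⁻¹) := by
    refine MDifferentiableAt.comp (I' := 𝓘(ℝ, E)) _ (contMDiffAt_chartAt (E₁ := E) ?_).mdiff
      (contMDiff_mul_right (I := 𝓘(ℝ, E)) (n := ∞) |>.mdiff _)
    simpa using h
  have := tderiv_comp (I₁ := 𝓘(ℝ, E)) (f := fun x : G => g * x * g⁻¹) h1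
    ((contMDiff_conj g).mdiff 1)
  rw [mul_one, mul_inv_cancel] at this
  unfold Ad
  rw [← this]
  simp

theorem eventually_isInvertible {V W : Type*} [NormedAddCommGroup V] [NormedSpace ℝ V]
    [CompleteSpace V] [NormedAddCommGroup W] [NormedSpace ℝ W] {A : W → V →L[ℝ] V} {c : W}
    (hA : ContinuousAt A c) (h : A c = ContinuousLinearMap.id ℝ V) :
    ∀ᶠ z in 𝓝 c, (A z).IsInvertible := by
  have := ContinuousLinearEquiv.nhds (ContinuousLinearEquiv.refl ℝ V)
  have h2 : A c = ((ContinuousLinearEquiv.refl ℝ V : V ≃L[ℝ] V) : V →L[ℝ] V) := h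
  rw [← h2] at this
  exact hA.eventually this

theorem contDiffAt_inverse_of_eq_id {V W : Type*} [NormedAddCommGroup V] [NormedSpace ℝ V]
    [CompleteSpace V] [NormedAddCommGroup W] [NormedSpace ℝ W] {A : W → V →L[ℝ] V} {c : W}
    (hA : ContDiffAt ℝ ∞ A c) (h : A c = ContinuousLinearMap.id ℝ V) :
    ContDiffAt ℝ ∞ (fun z => (A z).inverse) c := by
  have h1 : ContDiffAt ℝ ∞ (ContinuousLinearMap.inverse : (V →L[ℝ] V) → V →L[ℝ] V) (A c) := by
    rw [h]
    exact contDiffAt_map_inverse (ContinuousLinearEquiv.refl ℝ V)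
  exact h1.comp c hA

/-- A solution `B` of `A z ∘ B z = C z` is smooth near a point where `A` is the identity. -/
theorem contDiffAt_of_comp_eq {V W X : Type*} [NormedAddCommGroup V] [NormedSpace ℝ V]
    [CompleteSpace V] [NormedAddCommGroup W] [NormedSpace ℝ W] [NormedAddCommGroup X]
    [NormedSpace ℝ X] {A : W → V →L[ℝ] V} {B C : W → X →L[ℝ] V} {c : W}
    (hA : ContDiffAt ℝ ∞ A c) (h : A c = ContinuousLinearMap.id ℝ V) (hC : ContDiffAt ℝ ∞ C c)
    (hB : ∀ᶠ z in 𝓝 c, (A z).comp (B z) = C z) :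
    ContDiffAt ℝ ∞ B c ∧ ∀ u v, fderiv ℝ B c u v = fderiv ℝ C c u v - fderiv ℝ A c u (B c v) := by
  have e : B =ᶠ[𝓝 c] fun z => (A z).inverse.comp (C z) := by
    filter_upwards [hB, eventually_isInvertible hA.continuousAt h] with z hz ⟨e, he⟩
    rw [← hz, ← he, ContinuousLinearMap.inverse_equiv]
    ext v
    simp
  have hBs : ContDiffAt ℝ ∞ B c :=
    ((contDiffAt_inverse_of_eq_id hA h).clm_comp hC).congr_of_eventuallyEq e
  refine ⟨hBs, fun u v => ?_⟩
  have h1 := ((hA.differentiableAt (by simp)).hasFDerivAt.clm_comp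
    (hBs.differentiableAt (by simp)).hasFDerivAt).fderiv
  rw [Filter.EventuallyEq.fderiv_eq hB] at h1
  rw [h1, h]
  simp

/-- The derivative of Ad at 1 is ad: differentiating R(z) ∘ Ad(z) = L(z) at the identity gives DL -
DR, and DR is DL with its arguments exchanged. -/
theorem Ad_chart_symm :
    ContDiffAt ℝ ∞ (fun z => Ad E ((chartAt E (1 : G)).symm z)) (chartOne E G) ∧
    ∀ X Y, fderiv ℝ (fun z => Ad E ((chartAt E (1 : G)).symm z)) (chartOne E G) X Y =
      lieBr E G X Y := by
  obtain ⟨h1, h2⟩ := contDiffAt_of_comp_eq (B := fun z => Ad E ((chartAt E (1 : G)).symm z))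
    (contDiffAt_chartMulRight (E := E) (G := G)) chartMulRight_one
    contDiffAt_chartMulLeft (by
      filter_upwards [eventually_mem_chart_one (E := E) (G := G)] with z hz
      exact chartMulRight_comp_Ad ((chartAt E (1 : G)).map_target hz))
  refine ⟨h1, fun X Y => ?_⟩
  rw [h2, chart_symm_chartOne, Ad_one]
  simp [lieBr, fderiv_chartMulRight]

/-- Smoothness near 1 spreads to g₀ through Ad(g) = Ad(g₀) ∘ Ad(g₀⁻¹ g). -/
theorem contMDiff_Ad : ContMDiff 𝓘(ℝ, E) 𝓘(ℝ, E →L[ℝ] E) ∞ (fun g : G => Ad E g) := by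
  have h1 : ContMDiffAt 𝓘(ℝ, E) 𝓘(ℝ, E →L[ℝ] E) ∞ (fun g : G => Ad E g) 1 := by
    have h2 : ContMDiffAt 𝓘(ℝ, E) 𝓘(ℝ, E →L[ℝ] E) ∞
        (fun g : G => Ad E ((chartAt E (1 : G)).symm (chartAt E (1 : G) g))) 1 :=
      ContMDiffAt.comp (I' := 𝓘(ℝ, E)) (1 : G)
        (g := fun z => Ad E ((chartAt E (1 : G)).symm z)) (f := chartAt E (1 : G))
        (Ad_chart_symm (E := E) (G := G)).1.contMDiffAt (contMDiffAt_chartAt (mem_chart_source E 1))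
    refine h2.congr_of_eventuallyEq ?_
    filter_upwards [(chartAt E (1 : G)).open_source.mem_nhds (mem_chart_source E 1)] with g hg
    rw [(chartAt E (1 : G)).left_inv hg]
  intro g₀
  have h3 : (fun g : G => Ad E g) = fun g => (Ad E g₀).comp (Ad E (g₀⁻¹ * g)) := by
    ext1 g
    rw [← Ad_mul, mul_inv_cancel_left]
  rw [h3]
  have h4 : ContMDiffAt 𝓘(ℝ, E) 𝓘(ℝ, E →L[ℝ] E) ∞ (fun g : G => Ad E (g₀⁻¹ * g)) g₀ := by
    refine ContMDiffAt.comp (I' := 𝓘(ℝ, E)) g₀ (g := fun g : G => Ad E g)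
      (f := fun g => g₀⁻¹ * g) ?_ contMDiff_mul_left.contMDiffAt
    rwa [inv_mul_cancel]
  exact ContMDiffAt.clm_comp contMDiffAt_const h4

theorem tderiv_Ad_one (X : E) :
    tderiv 𝓘(ℝ, E) 𝓘(ℝ, E →L[ℝ] E) (fun g : G => Ad E g) 1 X = lieBr E G X := by
  rw [tderiv_eq_fderiv_chart (contMDiff_Ad.mdiff 1)]
  ext1 Y
  exact Ad_chart_symm.2 X Y

omit [CompleteSpace E] in
theorem leftTriv_one : leftTriv E (1 : G) = ContinuousLinearMap.id ℝ E := by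
  unfold leftTriv
  simp only [inv_one, one_mul]
  exact tderiv_id 1

end LieGroupCalculus

/-! ### The logarithmic derivative and the Maurer–Cartan equation -/

section LogDerivative

variable (E : Type*) [NormedAddCommGroup E] [NormedSpace ℝ E]
  {G : Type*} [TopologicalSpace G] [ChartedSpace E G] [Group G] [LieGroup 𝓘(ℝ, E) ∞ G]
  {V : Type*} [NormedAddCommGroup V] [NormedSpace ℝ V]

/-- The pullback of the left Maurer–Cartan form by `f`. -/
def leftLogDeriv (f : V → G) (y : V) : V →L[ℝ] E :=
  (leftTriv E (f y)).comp (tderiv 𝓘(ℝ, V) 𝓘(ℝ, E) f y)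

variable {E}

theorem tderiv_inv_mul {M EM : Type*} [NormedAddCommGroup EM] [NormedSpace ℝ EM]
    {HM : Type*} [TopologicalSpace HM] {I : ModelWithCorners ℝ EM HM}
    [TopologicalSpace M] [ChartedSpace HM M] {f : M → G} {y : M}
    (hf : MDifferentiableAt I 𝓘(ℝ, E) f y) :
    tderiv I 𝓘(ℝ, E) (fun y' => (f y)⁻¹ * f y') y =
      (leftTriv E (f y)).comp (tderiv I 𝓘(ℝ, E) f y) :=
  tderiv_comp (g := fun x : G => (f y)⁻¹ * x) (contMDiff_mul_left.mdiff _) hf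

/-- Replacing f by f(y₀)⁻¹ f does not change the logarithmic derivative and brings the values near
1, where one chart suffices. In that chart the ordinary derivative is the left translation applied
to the logarithmic one. -/
theorem chartMulLeft_comp_leftLogDeriv {f : V → G} {y₀ y : V}
    (hf : MDifferentiableAt 𝓘(ℝ, V) 𝓘(ℝ, E) f y)
    (hy : (f y₀)⁻¹ * f y ∈ (chartAt E (1 : G)).source) :
    (chartMulLeft E G (chartAt E (1 : G) ((f y₀)⁻¹ * f y))).comp (leftLogDeriv E f y) =
      fderiv ℝ (fun y' => chartAt E (1 : G) ((f y₀)⁻¹ * f y')) y := by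
  have hs := (chartAt E (1 : G)).left_inv hy
  rw [← tderiv_chart_mul_left (by rw [hs]; exact hy), hs]
  set h := (f y₀)⁻¹ * f y with hh
  have e : (f y)⁻¹ * f y = 1 := inv_mul_cancel _
  have h1 : MDifferentiableAt 𝓘(ℝ, E) 𝓘(ℝ, E) (fun x : G => chartAt E (1 : G) (h * x))
      ((f y)⁻¹ * f y) := by
    refine MDifferentiableAt.comp (I' := 𝓘(ℝ, E)) _ (contMDiffAt_chartAt (E₁ := E) ?_).mdiff
      (contMDiff_mul_left (I := 𝓘(ℝ, E)) (n := ∞) |>.mdiff _)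
    rwa [e, mul_one]
  have h2 : MDifferentiableAt 𝓘(ℝ, V) 𝓘(ℝ, E) (fun y' => (f y)⁻¹ * f y') y :=
    MDifferentiableAt.comp (I' := 𝓘(ℝ, E)) y (contMDiff_mul_left.mdiff _) hf
  have h3 := tderiv_comp (f := fun y' => (f y)⁻¹ * f y') h1 h2
  rw [e, tderiv_inv_mul hf] at h3
  rw [← tderiv_eq_fderiv]
  unfold leftLogDeriv
  rw [← h3]
  congr 1
  ext y'
  simp [hh, mul_assoc]

variable [CompleteSpace E]

/-- Differentiate L(x) ∘ θ = dx at y₀, where L is the identity. On antisymmetrization the second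
derivative of x drops out, and the derivative of L contributes minus the bracket. -/
theorem contDiffAt_leftLogDeriv {f : V → G} {y₀ : V}
    (hf : ∀ᶠ y in 𝓝 y₀, ContMDiffAt 𝓘(ℝ, V) 𝓘(ℝ, E) ∞ f y) :
    ContDiffAt ℝ ∞ (leftLogDeriv E f) y₀ ∧ ∀ u v,
      fderiv ℝ (leftLogDeriv E f) y₀ u v - fderiv ℝ (leftLogDeriv E f) y₀ v u =
        - lieBr E G (leftLogDeriv E f y₀ u) (leftLogDeriv E f y₀ v) := by
  have hf₀ := hf.self_of_nhds
  set x : V → E := fun y => chartAt E (1 : G) ((f y₀)⁻¹ * f y) with hx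
  have hx₀ : x y₀ = chartOne E G := by simp [hx, chartOne]
  have hxs : ContDiffAt ℝ ∞ x y₀ := by
    rw [← contMDiffAt_iff_contDiffAt]
    refine ContMDiffAt.comp (I' := 𝓘(ℝ, E)) y₀ (contMDiffAt_chartAt (E₁ := E) ?_)
      (ContMDiffAt.comp (I' := 𝓘(ℝ, E)) y₀ contMDiff_mul_left.contMDiffAt hf₀)
    simp
  have hA : ContDiffAt ℝ ∞ (fun y => chartMulLeft E G (x y)) y₀ := by
    have h := contDiffAt_chartMulLeft (E := E) (G := G)
    rw [← hx₀] at h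
    exact h.comp y₀ hxs
  have hx2 : ContDiffAt ℝ ∞ (fderiv ℝ x) y₀ := hxs.fderiv_right (m := ∞) (by simp)
  have hA₀ : chartMulLeft E G (x y₀) = ContinuousLinearMap.id ℝ E := by
    rw [hx₀, chartMulLeft_one]
  have hcont : ContinuousAt (fun y => (f y₀)⁻¹ * f y) y₀ :=
    (ContMDiffAt.comp (I' := 𝓘(ℝ, E)) y₀ contMDiff_mul_left.contMDiffAt hf₀).continuousAt
  have hB : ∀ᶠ y in 𝓝 y₀, (chartMulLeft E G (x y)).comp (leftLogDeriv E f y) = fderiv ℝ x y := by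
    have : ∀ᶠ y in 𝓝 y₀, (f y₀)⁻¹ * f y ∈ (chartAt E (1 : G)).source :=
      hcont.eventually ((chartAt E (1 : G)).open_source.mem_nhds (by simp))
    filter_upwards [this, hf] with y hy hy'
    exact chartMulLeft_comp_leftLogDeriv hy'.mdiff hy
  obtain ⟨h1, h2⟩ := contDiffAt_of_comp_eq hA hA₀ hx2 hB
  refine ⟨h1, fun u v => ?_⟩
  have hθ : leftLogDeriv E f y₀ = fderiv ℝ x y₀ := by
    have := hB.self_of_nhds
    rw [hA₀] at this
    simpa using this
  have hd : fderiv ℝ (fun y => chartMulLeft E G (x y)) y₀ =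
      (fderiv ℝ (chartMulLeft E G) (chartOne E G)).comp (fderiv ℝ x y₀) := by
    rw [← hx₀]
    have h := (contDiffAt_chartMulLeft (E := E) (G := G)).differentiableAt (by simp)
    rw [← hx₀] at h
    exact fderiv_comp y₀ h (hxs.differentiableAt (by simp))
  rw [h2, h2, hd, isSymmSndFDerivAt_of_contDiffAt hxs u v, hθ]
  simp [lieBr]

end LogDerivative

/-! ### Bilinear product rules; Lie group homomorphisms -/

section Homomorphisms

theorem tderiv_clm_comp {V W : Type*} [NormedAddCommGroup V] [NormedSpace ℝ V]
    [NormedAddCommGroup W] [NormedSpace ℝ W] (L : V →L[ℝ] W)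
    {EM : Type*} [NormedAddCommGroup EM] [NormedSpace ℝ EM] {HM : Type*} [TopologicalSpace HM]
    {I : ModelWithCorners ℝ EM HM} {M : Type*} [TopologicalSpace M] [ChartedSpace HM M]
    {f : M → V} {x : M} (hf : MDifferentiableAt I 𝓘(ℝ, V) f x) (v : EM) :
    tderiv I 𝓘(ℝ, W) (fun y => L (f y)) x v = L (tderiv I 𝓘(ℝ, V) f x v) := by
  rw [tderiv_comp_apply (g := L) (L.contDiff.contMDiff.mdiff _) hf, tderiv_eq_fderiv, L.fderiv]

theorem tderiv_bilin {V W X : Type*} [NormedAddCommGroup V] [NormedSpace ℝ V]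
    [NormedAddCommGroup W] [NormedSpace ℝ W] [NormedAddCommGroup X] [NormedSpace ℝ X]
    (B : V →L[ℝ] W →L[ℝ] X)
    {EM : Type*} [NormedAddCommGroup EM] [NormedSpace ℝ EM] {HM : Type*} [TopologicalSpace HM]
    {I : ModelWithCorners ℝ EM HM} {M : Type*} [TopologicalSpace M] [ChartedSpace HM M]
    {f : M → V} {g : M → W} {x : M} (hf : MDifferentiableAt I 𝓘(ℝ, V) f x)
    (hg : MDifferentiableAt I 𝓘(ℝ, W) g x) (v : EM) :
    tderiv I 𝓘(ℝ, X) (fun y => B (f y) (g y)) x v =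
      B (tderiv I 𝓘(ℝ, V) f x v) (g x) + B (f x) (tderiv I 𝓘(ℝ, W) g x v) := by
  have hpair := tderiv_comp_apply (g := fun p : V × W => B p.1 p.2)
    (f := fun k => (f k, g k)) (x := x) (I₂ := 𝓘(ℝ, V × W)) (I₃ := 𝓘(ℝ, X)) (I₁ := I)
    (B.isBoundedBilinearMap.contDiff.contMDiff.mdiff _) (hf.prodMk_space hg) v
  have hp : tderiv I 𝓘(ℝ, V × W) (fun k => (f k, g k)) x v =
      (tderiv I 𝓘(ℝ, V) f x v, tderiv I 𝓘(ℝ, W) g x v) := by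
    have hm := hf.prodMk_space hg
    exact Prod.ext (tderiv_clm_comp (ContinuousLinearMap.fst ℝ V W) hm v).symm
      (tderiv_clm_comp (ContinuousLinearMap.snd ℝ V W) hm v).symm
  refine hpair.trans ?_
  rw [hp, tderiv_eq_fderiv, B.isBoundedBilinearMap.fderiv, add_comm]
  rfl

variable {E : Type*} [NormedAddCommGroup E] [NormedSpace ℝ E] [CompleteSpace E]
  {G : Type*} [TopologicalSpace G] [ChartedSpace E G] [Group G] [LieGroup 𝓘(ℝ, E) ∞ G]
  {E' : Type*} [NormedAddCommGroup E'] [NormedSpace ℝ E'] [CompleteSpace E']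
  {G' : Type*} [TopologicalSpace G'] [ChartedSpace E' G'] [Group G'] [LieGroup 𝓘(ℝ, E') ∞ G']

theorem Ad_map {j : G' →* G} (hj : ContMDiff 𝓘(ℝ, E') 𝓘(ℝ, E) ∞ j) (k : G') (X : E') :
    Ad E (j k) (tderiv 𝓘(ℝ, E') 𝓘(ℝ, E) j 1 X) = tderiv 𝓘(ℝ, E') 𝓘(ℝ, E) j 1 (Ad E' k X) := by
  have h1 : MDifferentiableAt 𝓘(ℝ, E') 𝓘(ℝ, E) j (k * 1 * k⁻¹) := hj.mdiff _
  have e1 := tderiv_comp_apply (f := fun x : G' => k * x * k⁻¹) h1 ((contMDiff_conj k).mdiff 1) X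
  have h2 : MDifferentiableAt 𝓘(ℝ, E) 𝓘(ℝ, E) (fun x : G => j k * x * (j k)⁻¹) (j 1) :=
    (contMDiff_conj _).mdiff _
  have e2 := tderiv_comp_apply h2 (hj.mdiff 1) X
  rw [mul_one, mul_inv_cancel] at e1
  rw [map_one] at e2
  unfold Ad
  rw [← e1, ← e2]
  simp

/-- Since the derivative of Ad at 1 is the bracket, this is `Ad_map` differentiated in the group
variable at the identity. -/
theorem lieBr_map {j : G' →* G} (hj : ContMDiff 𝓘(ℝ, E') 𝓘(ℝ, E) ∞ j) (X Y : E') :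
    tderiv 𝓘(ℝ, E') 𝓘(ℝ, E) j 1 (lieBr E' G' X Y) =
      lieBr E G (tderiv 𝓘(ℝ, E') 𝓘(ℝ, E) j 1 X) (tderiv 𝓘(ℝ, E') 𝓘(ℝ, E) j 1 Y) := by
  set dj := tderiv 𝓘(ℝ, E') 𝓘(ℝ, E) j 1 with hdj
  have h1 := tderiv_clm_comp (dj.comp (ContinuousLinearMap.apply ℝ E' Y))
    ((contMDiff_Ad (E := E') (G := G')).mdiff 1) X
  have h0 : MDifferentiableAt 𝓘(ℝ, E) 𝓘(ℝ, E →L[ℝ] E) (fun g : G => Ad E g) (j 1) :=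
    contMDiff_Ad.mdiff _
  have h2 := tderiv_clm_comp (ContinuousLinearMap.apply ℝ E (dj Y))
    (MDifferentiableAt.comp 1 h0 (hj.mdiff 1)) X
  have h3 := tderiv_comp_apply h0 (hj.mdiff 1) X
  simp only [ContinuousLinearMap.comp_apply, ContinuousLinearMap.apply_apply, Function.comp_def]
    at h1 h2 h3
  rw [tderiv_Ad_one] at h1
  rw [map_one, tderiv_Ad_one] at h3
  rw [← h1, ← h3, ← h2]
  congr 2
  ext k
  exact (Ad_map hj k Y).symm

/-- Conjugation by g is a smooth homomorphism whose derivative at 1 is Ad(g). -/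
theorem Ad_lieBr (g : G) (X Y : E) :
    Ad E g (lieBr E G X Y) = lieBr E G (Ad E g X) (Ad E g Y) := by
  have := lieBr_map (G' := G) (G := G) (j := (MulAut.conj g).toMonoidHom) (contMDiff_conj (E := E) g) X Y
  exact this

end Homomorphisms

/-! ### Injectivity of the derivative of an immersion -/

section Immersions

variable {E : Type*} [NormedAddCommGroup E] [NormedSpace ℝ E]
  {M : Type*} [TopologicalSpace M] [ChartedSpace E M] [IsManifold 𝓘(ℝ, E) ∞ M]
  {E' : Type*} [NormedAddCommGroup E'] [NormedSpace ℝ E']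
  {M' : Type*} [TopologicalSpace M'] [ChartedSpace E' M'] [IsManifold 𝓘(ℝ, E') ∞ M']

theorem tderiv_injective_of_leftInverse {f : M → M'} {r : M' → M} {x : M}
    (hf : MDifferentiableAt 𝓘(ℝ, E) 𝓘(ℝ, E') f x) (hr : MDifferentiableAt 𝓘(ℝ, E') 𝓘(ℝ, E) r (f x))
    (h : ∀ᶠ y in 𝓝 x, r (f y) = y) : Function.Injective (tderiv 𝓘(ℝ, E) 𝓘(ℝ, E') f x) := by
  have h1 := tderiv_comp hr hf
  rw [tderiv_congr (g := fun y => y) h, tderiv_id] at h1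
  intro u v huv
  have := congrArg (tderiv 𝓘(ℝ, E') 𝓘(ℝ, E) r (f x)) huv
  simpa [← ContinuousLinearMap.comp_apply, ← h1] using this

/-- In adapted charts the map is the inclusion of a factor, so projecting to that factor gives a
smooth local left inverse. -/
theorem Manifold.IsImmersionAt.tderiv_injective {f : M → M'} {x : M}
    (h : Manifold.IsImmersionAt 𝓘(ℝ, E) 𝓘(ℝ, E') ∞ f x) :
    Function.Injective (tderiv 𝓘(ℝ, E) 𝓘(ℝ, E') f x) := by
  have hd := h.domChart_mem_maximalAtlas
  have hc := h.codChart_mem_maximalAtlas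
  have hxd := h.mem_domChart_source
  have hxc := h.mem_codChart_source
  have hw := h.writtenInCharts
  have hdx := h.domChart.map_source hxd
  have s1 : ContMDiffAt 𝓘(ℝ, E') 𝓘(ℝ, E') ∞ h.codChart (f x) :=
    (contMDiffOn_of_mem_maximalAtlas hc).contMDiffAt (h.codChart.open_source.mem_nhds hxc)
  have s2 : ContMDiffAt 𝓘(ℝ, E) 𝓘(ℝ, E) ∞ h.domChart.symm (h.domChart x) :=
    (contMDiffOn_symm_of_mem_maximalAtlas hd).contMDiffAt (h.domChart.open_target.mem_nhds hdx)
  have key : ∀ y ∈ h.domChart.source, (h.equiv.symm (h.codChart (f y))).1 = h.domChart y := by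
    intro y hy
    have := hw (show h.domChart y ∈ (h.domChart.extend 𝓘(ℝ, E)).target by
      simpa using h.domChart.map_source hy)
    simp only [mfld_simps, Function.comp_apply, h.domChart.left_inv hy] at this
    rw [this]
    simp
  have s3 : ContMDiffAt 𝓘(ℝ, E') 𝓘(ℝ, E) ∞ (fun z => (h.equiv.symm (h.codChart z)).1) (f x) :=
    ContMDiffAt.comp (I' := 𝓘(ℝ, E')) (f x) (g := fun z => (h.equiv.symm z).1)
      (((ContinuousLinearMap.fst ℝ E _).contDiff.comp h.equiv.symm.contDiff).contMDiff.contMDiffAt) s1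
  refine tderiv_injective_of_leftInverse
    (r := fun z => h.domChart.symm (h.equiv.symm (h.codChart z)).1) h.contMDiffAt.mdiff ?_ ?_
  · refine (ContMDiffAt.comp (I' := 𝓘(ℝ, E)) (f x) (g := h.domChart.symm) ?_ s3).mdiff
    rwa [key x hxd]
  · filter_upwards [h.domChart.open_source.mem_nhds hxd] with y hy
    rw [key y hy, h.domChart.left_inv hy]

end Immersions

/-! ### Lie algebra maps attached to a Lie subgroup -/

section LieSubgroups

variable {E : Type*} [NormedAddCommGroup E] [NormedSpace ℝ E] [CompleteSpace E]
  {G : Type*} [TopologicalSpace G] [ChartedSpace E G] [Group G] [LieGroup 𝓘(ℝ, E) ∞ G]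
  {EK : Type*} [NormedAddCommGroup EK] [NormedSpace ℝ EK] [CompleteSpace EK]
  {K : Subgroup G} [ChartedSpace EK K] [LieGroup 𝓘(ℝ, EK) ∞ K]

variable (E EK K) in
/-- The inclusion of the Lie algebras of a Lie subgroup, between the model spaces. -/
def inclE : EK →L[ℝ] E := tderiv 𝓘(ℝ, EK) 𝓘(ℝ, E) (Subtype.val : K → G) 1

theorem IsLieSubgroup.contMDiff_val (h : IsLieSubgroup E EK K) :
    ContMDiff 𝓘(ℝ, EK) 𝓘(ℝ, E) ∞ (Subtype.val : K → G) := h.embedding.contMDiff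

theorem IsLieSubgroup.inclE_injective (h : IsLieSubgroup E EK K) :
    Function.Injective (inclE E EK K) :=
  (h.embedding.isImmersion.isImmersionAt 1).tderiv_injective

theorem IsLieSubgroup.Ad_inclE (h : IsLieSubgroup E EK K) (k : K) (X : EK) :
    Ad E (k : G) (inclE E EK K X) = inclE E EK K (Ad EK k X) :=
  Ad_map (j := K.subtype) h.contMDiff_val k X

theorem IsLieSubgroup.inclE_lieBr (h : IsLieSubgroup E EK K) (X Y : EK) :
    inclE E EK K (lieBr EK K X Y) = lieBr E G (inclE E EK K X) (inclE E EK K Y) :=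
  lieBr_map (j := K.subtype) h.contMDiff_val X Y

/-- The inclusion of the Lie algebra of a Lie subgroup, as a morphism of Lie algebras. -/
def IsLieSubgroup.lieHom (h : IsLieSubgroup E EK K) : LieAlg EK K →ₗ⁅ℝ⁆ LieAlg E G :=
  { (lieIncl E EK K).toLinearMap with
    map_lie' := by
      intro X Y
      exact ((congrArg (inclE E EK K) (bracket_eq_lieBr X Y)).trans (h.inclE_lieBr X Y)).trans
        (bracket_eq_lieBr (E := E) (G := G) (inclE E EK K X) (inclE E EK K Y)).symm }

/-- The adjoint action as an automorphism of the Lie algebra. -/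
def AdEquiv (E : Type*) [NormedAddCommGroup E] [NormedSpace ℝ E] [CompleteSpace E]
    {G : Type*} [TopologicalSpace G] [ChartedSpace E G] [Group G] [LieGroup 𝓘(ℝ, E) ∞ G]
    (g : G) : LieAlg E G ≃ₗ⁅ℝ⁆ LieAlg E G :=
  { (adjointAction E g).toLinearMap with
    map_lie' := by
      intro X Y
      exact ((congrArg (Ad E g) (bracket_eq_lieBr X Y)).trans (Ad_lieBr (E := E) g X Y)).trans
        (bracket_eq_lieBr (E := E) (G := G) (Ad E g X) (Ad E g Y)).symm
    invFun := adjointAction E g⁻¹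
    left_inv := fun X => Ad_inv_apply_Ad (E := E) g X
    right_inv := fun X => Ad_apply_Ad_inv (E := E) g X }

end LieSubgroups

/-! ### Complexified Lie algebras through real and imaginary parts -/

section Complexification

variable {V : Type*} [AddCommGroup V] [Module ℝ V] {W : Type*} [AddCommGroup W] [Module ℝ W]

/-- The real part of an element of a complexification. -/
def tensorRe : ℂ ⊗[ℝ] V →ₗ[ℝ] V :=
  (TensorProduct.lid ℝ V).toLinearMap ∘ₗ LinearMap.rTensor V Complex.reLm

/-- The imaginary part of an element of a complexification. -/
def tensorIm : ℂ ⊗[ℝ] V →ₗ[ℝ] V :=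
  (TensorProduct.lid ℝ V).toLinearMap ∘ₗ LinearMap.rTensor V Complex.imLm

@[simp] theorem tensorRe_tmul (c : ℂ) (v : V) : tensorRe (c ⊗ₜ[ℝ] v) = c.re • v := by
  simp [tensorRe]

@[simp] theorem tensorIm_tmul (c : ℂ) (v : V) : tensorIm (c ⊗ₜ[ℝ] v) = c.im • v := by
  simp [tensorIm]

theorem tmul_re_add_tmul_im (Z : ℂ ⊗[ℝ] V) :
    (1 : ℂ) ⊗ₜ[ℝ] tensorRe Z + Complex.I ⊗ₜ[ℝ] tensorIm Z = Z := by
  induction Z using TensorProduct.induction_on with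
  | zero => simp
  | tmul c v =>
    simp only [tensorRe_tmul, tensorIm_tmul, TensorProduct.tmul_smul, TensorProduct.smul_tmul',
      ← TensorProduct.add_tmul]
    congr 1
    simpa [mul_comm] using Complex.re_add_im c
  | add x y hx hy =>
    conv_rhs => rw [← hx, ← hy]
    simp only [map_add, TensorProduct.tmul_add]
    abel

theorem tensor_ext {Z Z' : ℂ ⊗[ℝ] V} (h1 : tensorRe Z = tensorRe Z')
    (h2 : tensorIm Z = tensorIm Z') : Z = Z' := by
  rw [← tmul_re_add_tmul_im Z, ← tmul_re_add_tmul_im Z', h1, h2]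

theorem tensorRe_smul (c : ℂ) (Z : ℂ ⊗[ℝ] V) :
    tensorRe (c • Z) = c.re • tensorRe Z - c.im • tensorIm Z := by
  rw [← tmul_re_add_tmul_im Z]
  simp [TensorProduct.smul_tmul', sub_eq_add_neg]

theorem tensorIm_smul (c : ℂ) (Z : ℂ ⊗[ℝ] V) :
    tensorIm (c • Z) = c.im • tensorRe Z + c.re • tensorIm Z := by
  rw [← tmul_re_add_tmul_im Z]
  simp [TensorProduct.smul_tmul']

theorem tensorRe_lTensor (f : V →ₗ[ℝ] W) (Z : ℂ ⊗[ℝ] V) :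
    tensorRe (LinearMap.lTensor ℂ f Z) = f (tensorRe Z) := by
  rw [← tmul_re_add_tmul_im Z]
  simp

theorem tensorIm_lTensor (f : V →ₗ[ℝ] W) (Z : ℂ ⊗[ℝ] V) :
    tensorIm (LinearMap.lTensor ℂ f Z) = f (tensorIm Z) := by
  rw [← tmul_re_add_tmul_im Z]
  simp

/-- The complexification of a subspace. -/
def Submodule.complexify (S : Submodule ℝ V) : Submodule ℂ (ℂ ⊗[ℝ] V) where
  carrier := {Z | tensorRe Z ∈ S ∧ tensorIm Z ∈ S}
  add_mem' ha hb := by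
    simp only [Set.mem_ofPred_eq, map_add]
    exact ⟨S.add_mem ha.1 hb.1, S.add_mem ha.2 hb.2⟩
  zero_mem' := by simp
  smul_mem' c Z hZ := by
    simp only [Set.mem_ofPred_eq, tensorRe_smul, tensorIm_smul]
    exact ⟨S.sub_mem (S.smul_mem _ hZ.1) (S.smul_mem _ hZ.2),
      S.add_mem (S.smul_mem _ hZ.1) (S.smul_mem _ hZ.2)⟩

variable {L : Type*} [LieRing L] [LieAlgebra ℝ L]

theorem tensorRe_lie (Z W : ℂ ⊗[ℝ] L) :
    tensorRe ⁅Z, W⁆ = ⁅tensorRe Z, tensorRe W⁆ - ⁅tensorIm Z, tensorIm W⁆ := by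
  rw [← tmul_re_add_tmul_im Z, ← tmul_re_add_tmul_im W]
  simp [sub_eq_add_neg]

theorem tensorIm_lie (Z W : ℂ ⊗[ℝ] L) :
    tensorIm ⁅Z, W⁆ = ⁅tensorRe Z, tensorIm W⁆ + ⁅tensorIm Z, tensorRe W⁆ := by
  rw [← tmul_re_add_tmul_im Z, ← tmul_re_add_tmul_im W]
  simp [add_comm]

theorem tensorRe_lie_real (x : L) (Z : ℂ ⊗[ℝ] L) :
    tensorRe ⁅(1 : ℂ) ⊗ₜ[ℝ] x, Z⁆ = ⁅x, tensorRe Z⁆ := by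
  simp [tensorRe_lie]

theorem tensorIm_lie_real (x : L) (Z : ℂ ⊗[ℝ] L) :
    tensorIm ⁅(1 : ℂ) ⊗ₜ[ℝ] x, Z⁆ = ⁅x, tensorIm Z⁆ := by
  simp [tensorIm_lie]

/-- The complexification of a Lie subalgebra. -/
def LieSubalgebra.complexify (S : LieSubalgebra ℝ L) : LieSubalgebra ℂ (ℂ ⊗[ℝ] L) :=
  { S.toSubmodule.complexify with
    lie_mem' := by
      intro Z W hZ hW
      refine ⟨?_, ?_⟩
      · rw [tensorRe_lie]
        exact S.sub_mem (S.lie_mem hZ.1 hW.1) (S.lie_mem hZ.2 hW.2)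
      · rw [tensorIm_lie]
        exact S.add_mem (S.lie_mem hZ.1 hW.2) (S.lie_mem hZ.2 hW.1) }

theorem LieSubalgebra.mem_complexify {S : LieSubalgebra ℝ L} {Z : ℂ ⊗[ℝ] L} :
    Z ∈ S.complexify ↔ tensorRe Z ∈ S ∧ tensorIm Z ∈ S := Iff.rfl

theorem LieSubalgebra.tmul_mem_complexify {S : LieSubalgebra ℝ L} {x : L} (hx : x ∈ S) :
    (1 : ℂ) ⊗ₜ[ℝ] x ∈ S.complexify := by
  simp [LieSubalgebra.mem_complexify, hx]

/-- Commutativity passes to the complexification and gives nilpotency. If Z normalizes the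
complexification, bracketing Z with real elements shows that its real and imaginary parts normalize
`S`, hence lie in `S`. -/
theorem LieSubalgebra.isCartanSubalgebra_complexify (S : LieSubalgebra ℝ L)
    [S.IsCartanSubalgebra] [IsLieAbelian S] : S.complexify.IsCartanSubalgebra := by
  have hab : ∀ x ∈ S, ∀ y ∈ S, ⁅x, y⁆ = 0 := fun x hx y hy =>
    congrArg Subtype.val (trivial_lie_zero S S ⟨x, hx⟩ ⟨y, hy⟩)
  have : IsLieAbelian S.complexify := by
    refine ⟨fun Z W => ?_⟩
    apply Subtype.ext
    apply tensor_ext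
    · simp [tensorRe_lie, hab _ Z.2.1 _ W.2.1, hab _ Z.2.2 _ W.2.2]
    · simp [tensorIm_lie, hab _ Z.2.1 _ W.2.2, hab _ Z.2.2 _ W.2.1]
  refine ⟨inferInstance, ?_⟩
  refine le_antisymm (fun Z hZ => ?_) S.complexify.le_normalizer
  rw [LieSubalgebra.mem_normalizer_iff] at hZ
  have h1 : ∀ y ∈ S, ⁅tensorRe Z, y⁆ ∈ S ∧ ⁅tensorIm Z, y⁆ ∈ S := by
    intro y hy
    have := hZ _ (LieSubalgebra.tmul_mem_complexify hy)
    rw [LieSubalgebra.mem_complexify, tensorRe_lie, tensorIm_lie] at this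
    simpa using this
  have h2 := LieSubalgebra.IsCartanSubalgebra.self_normalizing (H := S)
  refine ⟨?_, ?_⟩
  · change tensorRe Z ∈ S
    rw [← h2, LieSubalgebra.mem_normalizer_iff]
    exact fun y hy => (h1 y hy).1
  · change tensorIm Z ∈ S
    rw [← h2, LieSubalgebra.mem_normalizer_iff]
    exact fun y hy => (h1 y hy).2

/-- The Killing form commutes with base change. Pairing an element of the radical with real elements
separates its real and imaginary parts, both of which are then in the radical over ℝ. -/
theorem LieAlgebra.IsKilling.complexification [FiniteDimensional ℝ L] [LieAlgebra.IsKilling ℝ L] :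
    LieAlgebra.IsKilling ℂ (ℂ ⊗[ℝ] L) := by
  refine ⟨?_⟩
  rw [eq_bot_iff]
  intro Z hZ
  rw [LieIdeal.mem_killingCompl] at hZ
  have key : ∀ y : L, killingForm ℝ L y (tensorRe Z) = 0 ∧ killingForm ℝ L y (tensorIm Z) = 0 := by
    intro y
    have h1 := hZ ((1 : ℂ) ⊗ₜ[ℝ] y) trivial
    have hB : killingForm ℂ (ℂ ⊗[ℝ] L) = LinearMap.BilinForm.baseChange ℂ (killingForm ℝ L) :=
      LieModule.traceForm_baseChange ℝ L L ℂ
    rw [← tmul_re_add_tmul_im Z, hB] at h1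
    simp only [map_add, LinearMap.BilinForm.baseChange_tmul, one_mul] at h1
    have h3 := Complex.ext_iff.mp h1
    simpa using h3
  have hn := LieAlgebra.IsKilling.killingForm_nondegenerate ℝ L
  have h1 : tensorRe Z = 0 := hn.2 _ fun y => (key y).1
  have h2 : tensorIm Z = 0 := hn.2 _ fun y => (key y).2
  have : Z = 0 := tensor_ext (by simpa using h1) (by simpa using h2)
  simp [this]

end Complexification

/-! ### Centralizers in 𝔭 and noncompact roots -/

section NoncompactRoots

variable {𝔤 𝔨 V : Type*} [LieRing 𝔤] [LieAlgebra ℝ 𝔤] [LieRing 𝔨] [LieAlgebra ℝ 𝔨]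
  [AddCommGroup V] [Module ℝ V] [FiniteDimensional ℝ 𝔤] [LieAlgebra.IsKilling ℝ 𝔤]

/-- An element of the Cartan subalgebra on which no noncompact root vanishes has no nonzero
centralizing element in the orthogonal complement of the compact subalgebra. -/
theorem eq_zero_of_lie_eq_zero_of_noncompact (j : 𝔨 →ₗ⁅ℝ⁆ 𝔤)
    (hneg : ∀ X, killingForm ℝ 𝔤 (j X) (j X) = 0 → X = 0) (i : V →ₗ[ℝ] 𝔨)
    (𝔥 : LieSubalgebra ℝ 𝔤) (h𝔥 : 𝔥.toSubmodule = LinearMap.range (j.toLinearMap ∘ₗ i))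
    (hC : 𝔥.IsCartanSubalgebra) (H : V)
    (hH : ∀ α : V →ₗ[ℝ] ℂ, IsRootOf (j.toLinearMap ∘ₗ i) α → ¬ IsRootOf i α → α H ≠ 0)
    (X : 𝔤) (hX : ∀ Y, killingForm ℝ 𝔤 (j Y) X = 0) (hHX : ⁅j (i H), X⁆ = 0) : X = 0 := by
  by_contra hX0
  have : IsLieAbelian 𝔥 := inferInstance
  have hK : LieAlgebra.IsKilling ℂ (ℂ ⊗[ℝ] 𝔤) := LieAlgebra.IsKilling.complexification
  have hCC : 𝔥.complexify.IsCartanSubalgebra := 𝔥.isCartanSubalgebra_complexify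
  have hmem : ∀ v, j (i v) ∈ 𝔥 := fun v => by
    rw [← LieSubalgebra.mem_toSubmodule, h𝔥]
    exact ⟨v, rfl⟩
  have hsurj : ∀ h ∈ 𝔥, ∃ v, j (i v) = h := fun h hh => by
    rw [← LieSubalgebra.mem_toSubmodule, h𝔥] at hh
    exact hh
  have hab : ∀ x ∈ 𝔥, ∀ y ∈ 𝔥, ⁅x, y⁆ = 0 := fun x hx y hy =>
    congrArg Subtype.val (trivial_lie_zero 𝔥 𝔥 ⟨x, hx⟩ ⟨y, hy⟩)
  -- `P` is the centralizer of `H` in the complement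
  let P : Submodule ℝ 𝔤 :=
    { carrier := {x | (∀ Y, killingForm ℝ 𝔤 (j Y) x = 0) ∧ ⁅j (i H), x⁆ = 0}
      add_mem' := by
        rintro a b ⟨h1, h2⟩ ⟨h3, h4⟩
        exact ⟨fun Y => by rw [map_add, h1, h3, add_zero], by rw [lie_add, h2, h4, add_zero]⟩
      zero_mem' := by simp
      smul_mem' := by
        rintro c a ⟨h1, h2⟩
        exact ⟨fun Y => by rw [map_smul, h1, smul_zero], by rw [lie_smul, h2, smul_zero]⟩ }
  have hPlie : ∀ h ∈ 𝔥, ∀ x ∈ P, ⁅h, x⁆ ∈ P := by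
    rintro h hh x ⟨h1, h2⟩
    obtain ⟨v, rfl⟩ := hsurj h hh
    refine ⟨fun Y => ?_, ?_⟩
    · rw [← LieModule.traceForm_apply_lie_apply, ← LieHom.map_lie, h1]
    · rw [leibniz_lie, h2, lie_zero, add_zero, hab _ (hmem H) _ hh, zero_lie]
  let PC : LieSubmodule ℂ 𝔥.complexify (ℂ ⊗[ℝ] 𝔤) :=
    { P.complexify with
      lie_mem := by
        rintro ⟨h, hh⟩ Z hZ
        refine ⟨?_, ?_⟩
        · change tensorRe ⁅h, Z⁆ ∈ P
          rw [tensorRe_lie]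
          exact P.sub_mem (hPlie _ hh.1 _ hZ.1) (hPlie _ hh.2 _ hZ.2)
        · change tensorIm ⁅h, Z⁆ ∈ P
          rw [tensorIm_lie]
          exact P.add_mem (hPlie _ hh.1 _ hZ.2) (hPlie _ hh.2 _ hZ.1) }
  have hXP : (1 : ℂ) ⊗ₜ[ℝ] X ∈ PC := by
    refine ⟨?_, ?_⟩
    · rw [tensorRe_tmul, Complex.one_re, one_smul]
      exact ⟨hX, hHX⟩
    · simp
  have : Nontrivial PC := by
    refine ⟨⟨_, hXP⟩, 0, fun h => hX0 ?_⟩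
    have := congrArg tensorRe (congrArg Subtype.val h)
    simpa using this
  -- `PC` is a nonzero finite-dimensional complex module over a nilpotent Lie algebra, so it
  -- contains a simultaneous eigenvector; its weight, restricted to 𝔱, is the root sought.
  obtain ⟨χ, hχ⟩ := LieModule.exists_nontrivial_weightSpace_of_isNilpotent ℂ 𝔥.complexify PC
  obtain ⟨⟨⟨Z, hZP⟩, hZw⟩, hZ0⟩ := exists_ne (0 : LieModule.weightSpace PC χ)
  have hZne : Z ≠ 0 := by
    rintro rfl
    exact hZ0 rfl
  rw [LieModule.mem_weightSpace] at hZw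
  have hZχ : ∀ h : 𝔥.complexify, ⁅(h : ℂ ⊗[ℝ] 𝔤), Z⁆ = χ h • Z := fun h =>
    congrArg Subtype.val (hZw h)
  let α : V →ₗ[ℝ] ℂ :=
    { toFun := fun v => χ ⟨1 ⊗ₜ j (i v), LieSubalgebra.tmul_mem_complexify (hmem v)⟩
      map_add' := fun v w => by
        rw [← map_add]
        congr 1
        apply Subtype.ext
        simp [TensorProduct.tmul_add]
      map_smul' := fun c v => by
        have : (⟨1 ⊗ₜ j (i (c • v)), LieSubalgebra.tmul_mem_complexify (hmem (c • v))⟩ :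
            𝔥.complexify) =
            (c : ℂ) • ⟨1 ⊗ₜ j (i v), LieSubalgebra.tmul_mem_complexify (hmem v)⟩ := by
          apply Subtype.ext
          change (1 : ℂ) ⊗ₜ[ℝ] j (i (c • v)) = (c : ℂ) • ((1 : ℂ) ⊗ₜ[ℝ] j (i v))
          simp [TensorProduct.smul_tmul']
        rw [this, map_smul]
        simp }
  have hαZ : ∀ v, ⁅(1 : ℂ) ⊗ₜ[ℝ] j (i v), Z⁆ = α v • Z := fun v => hZχ ⟨_, _⟩
  have hZre : ∀ Y, killingForm ℝ 𝔤 (j Y) (tensorRe Z) = 0 := hZP.1.1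
  have hZim : ∀ Y, killingForm ℝ 𝔤 (j Y) (tensorIm Z) = 0 := hZP.2.1
  have hdisj : ∀ Y, (∀ Y', killingForm ℝ 𝔤 (j Y') (j Y) = 0) → Y = 0 := fun Y h => hneg _ (h Y)
  -- If the weight were zero, both parts of Z would commute with 𝔱, hence lie in the
  -- self-normalizing 𝔥, which is inside 𝔨; but they also lie in 𝔭.
  have hα0 : α ≠ 0 := by
    intro h0
    have hc : ∀ v, ⁅j (i v), tensorRe Z⁆ = 0 ∧ ⁅j (i v), tensorIm Z⁆ = 0 := by
      intro v
      have := hαZ v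
      rw [h0, LinearMap.zero_apply, zero_smul] at this
      rw [← tensorRe_lie_real, ← tensorIm_lie_real, this]
      simp
    have hmem' : ∀ z : 𝔤, (∀ v, ⁅j (i v), z⁆ = 0) → z ∈ 𝔥 := by
      intro z hz
      rw [← LieSubalgebra.IsCartanSubalgebra.self_normalizing (H := 𝔥),
        LieSubalgebra.mem_normalizer_iff]
      intro y hy
      obtain ⟨v, rfl⟩ := hsurj y hy
      rw [← lie_skew, hz, neg_zero]
      exact 𝔥.zero_mem
    apply hZne
    apply tensor_ext
    · obtain ⟨v, hv⟩ := hsurj _ (hmem' _ fun v => (hc v).1)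
      have : i v = 0 := hdisj _ (by rw [hv]; exact hZre)
      rw [← hv, this, map_zero, map_zero]
    · obtain ⟨v, hv⟩ := hsurj _ (hmem' _ fun v => (hc v).2)
      have : i v = 0 := hdisj _ (by rw [hv]; exact hZim)
      rw [← hv, this, map_zero, map_zero]
  have hαH : α H = 0 := by
    have h1 := hαZ H
    have h2 : ⁅(1 : ℂ) ⊗ₜ[ℝ] j (i H), Z⁆ = 0 := by
      apply tensor_ext
      · rw [tensorRe_lie_real, hZP.1.2, map_zero]
      · rw [tensorIm_lie_real, hZP.2.2, map_zero]
    rw [h2] at h1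
    exact (smul_eq_zero.mp h1.symm).resolve_right hZne
  refine hH α ⟨hα0, Z, hZne, hαZ⟩ ?_ hαH
  -- The weight must still be shown noncompact: a weight vector in the complexification of 𝔨 is
  -- assumed and a contradiction derived.
  rintro ⟨-, Z', hZ'0, hZ'⟩
  -- the image of `Z'` lies in the one-dimensional root space spanned by `Z`
  set Z'' : ℂ ⊗[ℝ] 𝔤 := LinearMap.lTensor ℂ j.toLinearMap Z' with hZ''
  have hre : tensorRe Z'' = j (tensorRe Z') := tensorRe_lTensor _ _
  have him : tensorIm Z'' = j (tensorIm Z') := tensorIm_lTensor _ _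
  have hZ''α : ∀ v, ⁅(1 : ℂ) ⊗ₜ[ℝ] j (i v), Z''⁆ = α v • Z'' := by
    intro v
    have h1 := congrArg tensorRe (hZ' v)
    have h2 := congrArg tensorIm (hZ' v)
    rw [tensorRe_lie_real, tensorRe_smul] at h1
    rw [tensorIm_lie_real, tensorIm_smul] at h2
    apply tensor_ext
    · rw [tensorRe_lie_real, tensorRe_smul, hre, him, ← LieHom.map_lie, h1]
      simp
    · rw [tensorIm_lie_real, tensorIm_smul, hre, him, ← LieHom.map_lie, h2]
      simp
  -- The eigenvector equation is known only for real elements of 𝔱; writing an element of the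
  -- complexified Cartan subalgebra as h₁ + i h₂ extends it by linearity.
  have hw : ∀ W : ℂ ⊗[ℝ] 𝔤, (∀ v, ⁅(1 : ℂ) ⊗ₜ[ℝ] j (i v), W⁆ = α v • W) →
      W ∈ LieAlgebra.rootSpace 𝔥.complexify χ := by
    intro W hW
    apply LieModule.weightSpace_le_genWeightSpace
    rw [LieModule.mem_weightSpace]
    rintro ⟨h, hh⟩
    obtain ⟨v, hv⟩ := hsurj _ hh.1
    obtain ⟨w, hw⟩ := hsurj _ hh.2
    have e : (⟨h, hh⟩ : 𝔥.complexify) =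
        ⟨1 ⊗ₜ j (i v), LieSubalgebra.tmul_mem_complexify (hmem v)⟩ +
        Complex.I • ⟨1 ⊗ₜ j (i w), LieSubalgebra.tmul_mem_complexify (hmem w)⟩ := by
      apply Subtype.ext
      change h = (1 : ℂ) ⊗ₜ[ℝ] j (i v) + Complex.I • ((1 : ℂ) ⊗ₜ[ℝ] j (i w))
      rw [hv, hw, TensorProduct.smul_tmul', smul_eq_mul, mul_one, tmul_re_add_tmul_im]
    rw [e, map_add, map_smul, add_smul, add_lie, smul_lie, smul_assoc]
    exact congrArg₂ (· + ·) (hW v) (congrArg (Complex.I • ·) (hW w))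
  have hZmem := hw Z hαZ
  have hZ''mem := hw Z'' hZ''α
  have hbot : LieAlgebra.rootSpace 𝔥.complexify χ ≠ ⊥ := by
    intro h
    rw [h] at hZmem
    exact hZne ((LieSubmodule.mem_bot _).mp hZmem)
  let wt : LieModule.Weight ℂ 𝔥.complexify (ℂ ⊗[ℝ] 𝔤) := ⟨χ, hbot⟩
  have hnz : wt.IsNonZero := by
    intro h
    apply hα0
    ext v
    exact congrFun h _
  have hfr := LieAlgebra.IsKilling.finrank_rootSpace_eq_one wt hnz
  have hZs : (⟨Z, hZmem⟩ : LieAlgebra.rootSpace 𝔥.complexify χ) ≠ 0 := fun h =>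
    hZne (congrArg Subtype.val h)
  -- Root spaces are one-dimensional, so `Z''` is a multiple of Z. It then lies both in the
  -- complexification of 𝔨 and in that of 𝔭, which meet only in 0.
  obtain ⟨c, hc⟩ := (finrank_eq_one_iff_of_nonzero' _ hZs).mp hfr ⟨Z'', hZ''mem⟩
  have hc' : c • Z = Z'' := congrArg Subtype.val hc
  apply hZ'0
  apply tensor_ext
  · rw [map_zero]
    apply hdisj
    intro Y
    rw [← hre, ← hc', tensorRe_smul, map_sub, map_smul, map_smul, hZre, hZim]
    simp
  · rw [map_zero]
    apply hdisj
    intro Y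
    rw [← him, ← hc', tensorIm_smul, map_add, map_smul, map_smul, hZre, hZim]
    simp

end NoncompactRoots

/-! ### Invariant inner products and skew endomorphisms -/

section Averaging

-- A Euclidean inner product is averaged over Haar measure. The integrand uses k⁻¹ so that
-- invariance of the average is left invariance of the measure; positivity holds because the
-- integrand is continuous, nonnegative, and positive at k = 1.
open MeasureTheory in
theorem exists_invariant_form {K : Type*} [Group K] [TopologicalSpace K] [IsTopologicalGroup K]
    [CompactSpace K] {V : Type*} [NormedAddCommGroup V] [NormedSpace ℝ V] [FiniteDimensional ℝ V]
    (ρ : K → V →L[ℝ] V) (hρ : Continuous ρ) (hmul : ∀ k l, ρ (k * l) = (ρ k).comp (ρ l))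
    (hone : ρ 1 = ContinuousLinearMap.id ℝ V) :
    ∃ Q : LinearMap.BilinForm ℝ V, (∀ x y, Q x y = Q y x) ∧ (∀ x, x ≠ 0 → 0 < Q x x) ∧
      ∀ k x y, Q (ρ k x) (ρ k y) = Q x y := by
  let _ : MeasurableSpace K := borel K
  have : BorelSpace K := ⟨rfl⟩
  let μ : Measure K := Measure.haar
  let e := toEuclidean (E := V)
  let f : V → V → K → ℝ := fun x y k => inner ℝ (e (ρ k⁻¹ x)) (e (ρ k⁻¹ y))
  have hc : ∀ x, Continuous fun k => e (ρ k⁻¹ x) := fun x =>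
    e.continuous.comp ((hρ.comp continuous_inv).clm_apply continuous_const)
  have hf : ∀ x y, Continuous (f x y) := fun x y => (hc x).inner (hc y)
  have hi : ∀ x y, Integrable (f x y) μ := fun x y =>
    (hf x y).integrable_of_hasCompactSupport (HasCompactSupport.of_compactSpace _)
  let Q : LinearMap.BilinForm ℝ V := LinearMap.mk₂ ℝ (fun x y => ∫ k, f x y k ∂μ)
    (fun x x' y => by
      rw [← integral_add (hi _ _) (hi _ _)]
      exact integral_congr_ae (.of_forall fun k => by simp [f, inner_add_left]))
    (fun c x y => by
      rw [smul_eq_mul, ← integral_const_mul]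
      exact integral_congr_ae (.of_forall fun k => by simp [f, inner_smul_left]))
    (fun x y y' => by
      rw [← integral_add (hi _ _) (hi _ _)]
      exact integral_congr_ae (.of_forall fun k => by simp [f, inner_add_right]))
    (fun c x y => by
      rw [smul_eq_mul, ← integral_const_mul]
      exact integral_congr_ae (.of_forall fun k => by simp [f, inner_smul_right]))
  have hQ : ∀ x y, Q x y = ∫ k, f x y k ∂μ := fun x y => rfl
  refine ⟨Q, fun x y => ?_, fun x hx => ?_, fun k x y => ?_⟩
  · rw [hQ, hQ]
    exact integral_congr_ae (.of_forall fun k => real_inner_comm _ _)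
  · rw [hQ]
    refine (hf x x).integral_pos_of_hasCompactSupport_nonneg_nonzero
      (HasCompactSupport.of_compactSpace _) (fun k => real_inner_self_nonneg) (x := 1) ?_
    simp only [f, inv_one, hone, ContinuousLinearMap.id_apply]
    exact inner_self_ne_zero.mpr (by simpa using hx)
  · rw [hQ, hQ, ← integral_mul_left_eq_self (f x y) k⁻¹]
    refine integral_congr_ae (.of_forall fun l => ?_)
    simp only [f, mul_inv_rev, inv_inv, hmul, ContinuousLinearMap.comp_apply]

/-- In a Q-orthogonal basis the trace of A² is minus the sum of Q(A vᵢ, A vᵢ) / Q(vᵢ, vᵢ), a sum of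
nonnegative terms. -/
theorem eq_zero_of_trace_sq_eq_zero {V : Type*} [AddCommGroup V] [Module ℝ V]
    [FiniteDimensional ℝ V] (Q : LinearMap.BilinForm ℝ V) (hs : ∀ x y, Q x y = Q y x)
    (hp : ∀ x, x ≠ 0 → 0 < Q x x) (A : V →ₗ[ℝ] V) (hA : ∀ x y, Q (A x) y = - Q x (A y))
    (ht : LinearMap.trace ℝ V (A ∘ₗ A) = 0) : A = 0 := by
  classical
  obtain ⟨v, hv⟩ := LinearMap.BilinForm.exists_orthogonal_basis (B := Q) ⟨fun x y => hs x y⟩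
  have hvne : ∀ i, 0 < Q (v i) (v i) := fun i => hp _ (v.ne_zero i)
  have hrepr : ∀ x i, v.repr x i = Q x (v i) / Q (v i) (v i) := by
    intro x i
    rw [eq_div_iff (hvne i).ne']
    conv_rhs => rw [← v.sum_repr x]
    rw [map_sum, LinearMap.sum_apply, Finset.sum_eq_single i]
    · simp
    · intro k _ hk
      have : Q (v k) (v i) = 0 := hv hk
      simp [this]
    · simp
  rw [LinearMap.trace_eq_matrix_trace ℝ v, Matrix.trace] at ht
  have hd : ∀ i, (LinearMap.toMatrix v v (A ∘ₗ A)).diag i =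
      - (Q (A (v i)) (A (v i)) / Q (v i) (v i)) := by
    intro i
    rw [Matrix.diag_apply, LinearMap.toMatrix_apply, hrepr, LinearMap.comp_apply, hA, neg_div]
  have hnn : ∀ x, 0 ≤ Q x x := fun x => by
    by_cases h : x = 0
    · simp [h]
    · exact (hp x h).le
  simp only [hd, Finset.sum_neg_distrib, neg_eq_zero] at ht
  rw [Finset.sum_eq_zero_iff_of_nonneg
    (fun i _ => div_nonneg (hnn _) (hvne i).le)] at ht
  refine v.ext fun i => ?_
  by_contra h
  exact (div_pos (hp _ h) (hvne i)).ne' (ht i (Finset.mem_univ i))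

end Averaging

/-! ### The Killing form on the Lie algebra of a compact subgroup -/

section CompactSubgroup

variable {E : Type*} [NormedAddCommGroup E] [NormedSpace ℝ E] [FiniteDimensional ℝ E]
  [CompleteSpace E]
  {G : Type*} [TopologicalSpace G] [ChartedSpace E G] [Group G] [LieGroup 𝓘(ℝ, E) ∞ G]
  {EK : Type*} [NormedAddCommGroup EK] [NormedSpace ℝ EK] [FiniteDimensional ℝ EK]
  [CompleteSpace EK]
  {K : Subgroup G} [ChartedSpace EK K] [LieGroup 𝓘(ℝ, EK) ∞ K]

/-- Finiteness is recorded for the module structure obtained through the Lie algebra, which is the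
one the Killing form refers to. -/
instance instFiniteLieAlg :
    @Module.Finite ℝ (LieAlg E G) _ LieRing.toAddCommGroup.toAddCommMonoid LieAlgebra.toModule :=
  inferInstanceAs (FiniteDimensional ℝ E)

/-- The Lie algebra of a compact subgroup acts by skew endomorphisms for some inner product. -/
theorem exists_form_lieBr_skew (hK : IsCompact (K : Set G)) (hKG : IsLieSubgroup E EK K) :
    ∃ Q : LinearMap.BilinForm ℝ E, (∀ x y, Q x y = Q y x) ∧ (∀ x, x ≠ 0 → 0 < Q x x) ∧
      ∀ X y z, Q (lieBr E G (inclE E EK K X) y) z = - Q y (lieBr E G (inclE E EK K X) z) := by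
  have : IsTopologicalGroup K := topologicalGroup_of_lieGroup 𝓘(ℝ, EK) ∞
  have : CompactSpace K := isCompact_iff_compactSpace.mp hK
  have hval := hKG.contMDiff_val
  have hsm : ContMDiff 𝓘(ℝ, EK) 𝓘(ℝ, E →L[ℝ] E) ∞ (fun k : K => Ad E (k : G)) :=
    contMDiff_Ad.comp hval
  obtain ⟨Q, h1, h2, h3⟩ := exists_invariant_form (fun k : K => Ad E (k : G)) hsm.continuous
    (fun k l => Ad_mul _ _) Ad_one
  refine ⟨Q, h1, h2, fun X y z => ?_⟩
  have hd : ∀ y : E, tderiv 𝓘(ℝ, EK) 𝓘(ℝ, E) (fun k : K => Ad E (k : G) y) 1 X =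
      lieBr E G (inclE E EK K X) y := by
    intro y
    have e1 := tderiv_clm_comp (ContinuousLinearMap.apply ℝ E y) (hsm.mdiff 1) X
    have e2 := tderiv_comp_apply (g := fun g : G => Ad E g) (f := (Subtype.val : K → G))
      (x := (1 : K)) (contMDiff_Ad.mdiff _) (hval.mdiff 1) X
    refine e1.trans ?_
    rw [ContinuousLinearMap.apply_apply]
    exact congrArg (fun A : E →L[ℝ] E => A y) (e2.trans (tderiv_Ad_one _))
  have hdm : ∀ y : E, MDifferentiableAt 𝓘(ℝ, EK) 𝓘(ℝ, E) (fun k : K => Ad E (k : G) y) 1 :=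
    fun y => (hsm.clm_apply contMDiff_const).mdiff 1
  let Qc : E →L[ℝ] E →L[ℝ] ℝ := LinearMap.toContinuousLinearMap
    ((LinearMap.toContinuousLinearMap : (E →ₗ[ℝ] ℝ) ≃ₗ[ℝ] (E →L[ℝ] ℝ)).toLinearMap ∘ₗ Q)
  have hQc : ∀ x y, Qc x y = Q x y := fun x y => rfl
  have hpair := tderiv_bilin Qc (hdm y) (hdm z) X
  -- By invariance this function of k is constant; its derivative at 1, computed by the product
  -- rule, is the skewness identity.
  have hconst : (fun k : K => Qc (Ad E (k : G) y) (Ad E (k : G) z)) = fun _ => Q y z := by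
    ext k
    rw [hQc, h3]
  rw [hd, hd] at hpair
  rw [hconst, tderiv_const] at hpair
  simp only [OneMemClass.coe_one, Ad_one, ContinuousLinearMap.id_apply, hQc] at hpair
  exact eq_neg_of_add_eq_zero_left hpair.symm

/-- The Killing form at (X, X) is the trace of (ad X)², and ad X is skew for an invariant inner
product, so ad X = 0. As 𝔤 is semisimple this gives X = 0 in 𝔤. Only this anisotropy on 𝔨 is needed
later, not the sign of the form. -/
theorem killingForm_self_eq_zero (hG : LieAlgebra.IsSemisimple ℝ (LieAlg E G))
    (hK : IsCompact (K : Set G)) (hKG : IsLieSubgroup E EK K) (X : LieAlg EK K)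
    (h : killingForm ℝ (LieAlg E G) (hKG.lieHom X) (hKG.lieHom X) = 0) : X = 0 := by
  obtain ⟨Q, h1, h2, h3⟩ := exists_form_lieBr_skew hK hKG
  have hA : LieAlgebra.ad ℝ (LieAlg E G) (hKG.lieHom X) = 0 := by
    refine @eq_zero_of_trace_sq_eq_zero E _ _ _ Q h1 h2
      (LieAlgebra.ad ℝ (LieAlg E G) (hKG.lieHom X)) (fun y z => ?_) h
    have := h3 X y z
    exact ((congrArg (fun w => Q w z) (bracket_eq_lieBr (E := E) (G := G) (inclE E EK K X) y)).trans
      this).trans (congrArg (fun w => - Q y w)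
        (bracket_eq_lieBr (E := E) (G := G) (inclE E EK K X) z)).symm
  have h0 : hKG.lieHom X = 0 := by
    refine (LieAlgebra.IsKilling.killingForm_nondegenerate ℝ (LieAlg E G)).1 _ fun y => ?_
    rw [killingForm_apply_apply, hA]
    simp
  exact hKG.inclE_injective (h0.trans (map_zero hKG.lieHom).symm)

end CompactSubgroup

/-! ### The splitting 𝔤 = 𝔨 ⊕ 𝔭 and representing vectors of functionals -/

section KillingProjection

variable {𝔤 𝔨 V : Type*} [LieRing 𝔤] [LieAlgebra ℝ 𝔤] [FiniteDimensional ℝ 𝔤]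
  [LieRing 𝔨] [LieAlgebra ℝ 𝔨] [FiniteDimensional ℝ 𝔨] [AddCommGroup V] [Module ℝ V]

theorem killingForm_lie_left (X Y Z : 𝔤) :
    killingForm ℝ 𝔤 ⁅X, Y⁆ Z = killingForm ℝ 𝔤 X ⁅Y, Z⁆ :=
  LieModule.traceForm_apply_lie_apply ℝ 𝔤 𝔤 X Y Z

theorem killingForm_comm (X Y : 𝔤) : killingForm ℝ 𝔤 X Y = killingForm ℝ 𝔤 Y X :=
  LieModule.traceForm_comm ℝ 𝔤 𝔤 X Y

theorem injective_of_anisotropic {j : 𝔨 →ₗ⁅ℝ⁆ 𝔤}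
    (hneg : ∀ X, killingForm ℝ 𝔤 (j X) (j X) = 0 → X = 0) : Function.Injective j :=
  (injective_iff_map_eq_zero j).mpr fun X hX => hneg X (by simp [hX])

theorem isCompl_orthogonal_killingForm {j : 𝔨 →ₗ⁅ℝ⁆ 𝔤}
    (hneg : ∀ X, killingForm ℝ 𝔤 (j X) (j X) = 0 → X = 0) :
    IsCompl (LinearMap.range (j : 𝔨 →ₗ[ℝ] 𝔤))
      ((killingForm ℝ 𝔤).orthogonal (LinearMap.range (j : 𝔨 →ₗ[ℝ] 𝔤))) := by
  refine LinearMap.BilinForm.isCompl_orthogonal_of_restrict_nondegenerate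
    (fun x y h => by rwa [killingForm_comm]) ?_
  have hrefl : LinearMap.IsRefl
      ((killingForm ℝ 𝔤).restrict (LinearMap.range (j : 𝔨 →ₗ[ℝ] 𝔤))) := fun x y h => by
    simpa [killingForm_comm] using h
  refine hrefl.nondegenerate_iff_separatingLeft.mpr ?_
  rintro ⟨_, X, rfl⟩ h
  have := hneg X (h ⟨_, X, rfl⟩)
  simp [this]

theorem exists_killingProjection {j : 𝔨 →ₗ⁅ℝ⁆ 𝔤}
    (hneg : ∀ X, killingForm ℝ 𝔤 (j X) (j X) = 0 → X = 0) :
    ∃ π : 𝔤 →ₗ[ℝ] 𝔨, (∀ X, π (j X) = X) ∧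
      (∀ Y, π Y = 0 ↔ ∀ X, killingForm ℝ 𝔤 (j X) Y = 0) ∧
      ∀ Z, ∀ X, killingForm ℝ 𝔤 (j X) (Z - j (π Z)) = 0 := by
  have hc := isCompl_orthogonal_killingForm hneg
  let e := LinearEquiv.ofInjective (j : 𝔨 →ₗ[ℝ] 𝔤) (injective_of_anisotropic hneg)
  let π : 𝔤 →ₗ[ℝ] 𝔨 := e.symm.toLinearMap ∘ₗ Submodule.projectionOnto _ _ hc
  have h1 : ∀ X, π (j X) = X := fun X => by
    have := Submodule.projectionOnto_apply_left hc ⟨j X, X, rfl⟩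
    simp only [π, LinearMap.comp_apply]
    rw [show j X = ((⟨j X, X, rfl⟩ : LinearMap.range (j : 𝔨 →ₗ[ℝ] 𝔤)) : 𝔤) from rfl, this]
    exact e.symm_apply_apply X
  have h2 : ∀ Y, π Y = 0 ↔ ∀ X, killingForm ℝ 𝔤 (j X) Y = 0 := fun Y => by
    simp only [π, LinearMap.comp_apply, LinearEquiv.coe_coe, LinearEquiv.map_eq_zero_iff,
      Submodule.projectionOnto_apply_eq_zero_iff]
    exact ⟨fun h X => h _ ⟨X, rfl⟩, by rintro h _ ⟨X, rfl⟩; exact h X⟩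
  exact ⟨π, h1, h2, fun Z => (h2 _).mp (by rw [map_sub, h1, sub_self])⟩

theorem exists_killingForm_represents {j : 𝔨 →ₗ⁅ℝ⁆ 𝔤}
    (hneg : ∀ X, killingForm ℝ 𝔤 (j X) (j X) = 0 → X = 0) (ξ : Module.Dual ℝ 𝔨) :
    ∃ A, ∀ Y, killingForm ℝ 𝔤 (j A) (j Y) = ξ Y := by
  let L : 𝔨 →ₗ[ℝ] Module.Dual ℝ 𝔨 :=
    (killingForm ℝ 𝔤).compl₁₂ (j : 𝔨 →ₗ[ℝ] 𝔤) (j : 𝔨 →ₗ[ℝ] 𝔤)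
  have hL : Function.Injective L := (injective_iff_map_eq_zero L).mpr fun X hX =>
    hneg X (LinearMap.congr_fun hX X)
  have hs : Function.Surjective L :=
    (LinearMap.injective_iff_surjective_of_finrank_eq_finrank
      Subspace.dual_finrank_eq.symm).mp hL
  obtain ⟨A, hA⟩ := hs ξ
  exact ⟨A, fun Y => LinearMap.congr_fun hA Y⟩

/-- Let A in 𝔨 represent ξ. Then B([A, t], [A, t]) = B(A, [t, [A, t]]) = ξ([t, [A, t]]) = 0, so
anisotropy gives [A, t] = 0 for all t. Thus A normalizes the Cartan subalgebra and belongs to it. -/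
theorem exists_torus_represents {j : 𝔨 →ₗ⁅ℝ⁆ 𝔤}
    (hneg : ∀ X, killingForm ℝ 𝔤 (j X) (j X) = 0 → X = 0) (i : V →ₗ[ℝ] 𝔨)
    (𝔥 : LieSubalgebra ℝ 𝔤) (h𝔥 : 𝔥.toSubmodule = LinearMap.range (j.toLinearMap ∘ₗ i))
    (hC : 𝔥.IsCartanSubalgebra) (ξ : Module.Dual ℝ 𝔨) (hT : ∀ t Y, ξ ⁅i t, Y⁆ = 0) :
    ∃ H : V, ∀ Y, killingForm ℝ 𝔤 (j (i H)) (j Y) = ξ Y := by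
  obtain ⟨A, hA⟩ := exists_killingForm_represents hneg ξ
  have h1 : ∀ t, ⁅A, i t⁆ = 0 := fun t => by
    refine hneg _ ?_
    rw [LieHom.map_lie j A (i t), killingForm_lie_left, ← LieHom.map_lie j A (i t),
      ← LieHom.map_lie j (i t), hA, hT]
  have hmem : ∀ x, x ∈ 𝔥 ↔ ∃ t, j (i t) = x := fun x => by
    rw [← LieSubalgebra.mem_toSubmodule, h𝔥]; rfl
  have h2 : j A ∈ 𝔥 := by
    rw [← hC.self_normalizing, LieSubalgebra.mem_normalizer_iff]
    intro x hx
    obtain ⟨t, rfl⟩ := (hmem x).mp hx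
    rw [← LieHom.map_lie, h1, map_zero]
    exact 𝔥.zero_mem
  obtain ⟨H, hH⟩ := (hmem _).mp h2
  exact ⟨H, fun Y => by rw [hH, hA]⟩

/-- The functional η is B(H, ·), so the hypothesis on X says that [H, X] is orthogonal to 𝔭. It is
also orthogonal to 𝔨, because X is and H lies in 𝔨. Hence [H, X] = 0, and the absence of noncompact
roots vanishing at H finishes. -/
theorem eq_zero_of_pairing_eq_zero [LieAlgebra.IsKilling ℝ 𝔤] {j : 𝔨 →ₗ⁅ℝ⁆ 𝔤}
    (hneg : ∀ X, killingForm ℝ 𝔤 (j X) (j X) = 0 → X = 0) (i : V →ₗ[ℝ] 𝔨)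
    (𝔥 : LieSubalgebra ℝ 𝔤) (h𝔥 : 𝔥.toSubmodule = LinearMap.range (j.toLinearMap ∘ₗ i))
    (hC : 𝔥.IsCartanSubalgebra) (ξ : Module.Dual ℝ 𝔨) (hT : ∀ t Y, ξ ⁅i t, Y⁆ = 0)
    (η : Module.Dual ℝ 𝔤) (hη : ∀ X, η (j X) = ξ X)
    (hη' : ∀ Y, (∀ X, killingForm ℝ 𝔤 (j X) Y = 0) → η Y = 0)
    (H : V) (hHξ : ∀ t, killingForm ℝ 𝔤 (j (i H)) (j (i t)) = ξ (i t))
    (hH : ∀ α : V →ₗ[ℝ] ℂ, IsRootOf (j.toLinearMap ∘ₗ i) α → ¬ IsRootOf i α → α H ≠ 0)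
    (X : 𝔤) (hX : ∀ Y, killingForm ℝ 𝔤 (j Y) X = 0)
    (h : ∀ Y, (∀ Z, killingForm ℝ 𝔤 (j Z) Y = 0) → η ⁅X, Y⁆ = 0) : X = 0 := by
  obtain ⟨H', hH'⟩ := exists_torus_represents hneg i 𝔥 h𝔥 hC ξ hT
  -- H is known to represent ξ only on 𝔱, whereas H' does so on all of 𝔨. Their difference comes
  -- from 𝔱 and is isotropic, so they agree in 𝔨.
  have hi : i H = i H' := by
    refine sub_eq_zero.mp (hneg _ ?_)
    have := hHξ (H - H')
    rw [← hH' (i (H - H'))] at this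
    simpa [sub_eq_zero] using this
  obtain ⟨π, hπ1, hπ2, hπ3⟩ := exists_killingProjection hneg
  have hrep : ∀ Z, killingForm ℝ 𝔤 (j (i H)) Z = η Z := fun Z => by
    have e1 := hπ3 Z (i H)
    have e2 := hη' _ (hπ3 Z)
    rw [map_sub, sub_eq_zero] at e1 e2
    rw [e1, e2, hη, hi, hH']
  refine eq_zero_of_lie_eq_zero_of_noncompact j hneg i 𝔥 h𝔥 hC H hH X hX ?_
  refine (LieAlgebra.IsKilling.killingForm_nondegenerate ℝ 𝔤).1 _ fun Z => ?_
  have e1 : killingForm ℝ 𝔤 ⁅j (i H), X⁆ (j (π Z)) = 0 := by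
    rw [← lie_skew, map_neg, LinearMap.neg_apply, killingForm_lie_left, ← LieHom.map_lie,
      killingForm_comm, hX, neg_zero]
  have e2 : killingForm ℝ 𝔤 ⁅j (i H), X⁆ (Z - j (π Z)) = 0 := by
    rw [killingForm_lie_left, hrep, h _ (hπ3 Z)]
  rw [map_sub, e1, sub_zero] at e2
  exact e2

end KillingProjection

/-! ### The equivariant projection and strongly elliptic functionals -/

section StronglyElliptic

variable {E : Type*} [NormedAddCommGroup E] [NormedSpace ℝ E] [FiniteDimensional ℝ E]
  [CompleteSpace E]
  {G : Type*} [TopologicalSpace G] [ChartedSpace E G] [Group G] [LieGroup 𝓘(ℝ, E) ∞ G]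
  {EK : Type*} [NormedAddCommGroup EK] [NormedSpace ℝ EK] [FiniteDimensional ℝ EK]
  [CompleteSpace EK]
  {K : Subgroup G} [ChartedSpace EK K] [LieGroup 𝓘(ℝ, EK) ∞ K]
  {ET : Type*} [NormedAddCommGroup ET] [NormedSpace ℝ ET] [FiniteDimensional ℝ ET]
  {T : Subgroup K} [ChartedSpace ET T]

/-- Differentiate ξ(Ad(t)Y) = ξ(Y) in t at the identity of T. -/
theorem apply_lie_eq_zero_of_mem_torusDual (hTK : IsLieSubgroup EK ET T)
    {ξ : Module.Dual ℝ (LieAlg EK K)} (hξ : ξ ∈ torusDual EK T) (t : ET) (Y : EK) :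
    ξ (lieBr EK K (inclE EK ET T t) Y) = 0 := by
  have : LieGroup 𝓘(ℝ, ET) ∞ T := hTK.lieGroup
  have hval := hTK.contMDiff_val
  have hsm : ContMDiff 𝓘(ℝ, ET) 𝓘(ℝ, EK →L[ℝ] EK) ∞ (fun k : T => Ad EK (k : K)) :=
    contMDiff_Ad.comp hval
  let ξc : EK →L[ℝ] ℝ := LinearMap.toContinuousLinearMap (E := EK) ξ
  have e1 := tderiv_clm_comp (ξc.comp (ContinuousLinearMap.apply ℝ EK Y)) (hsm.mdiff 1) t
  have e2 := tderiv_comp_apply (g := fun g : K => Ad EK g) (f := (Subtype.val : T → K))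
    (x := (1 : T)) (contMDiff_Ad.mdiff _) (hval.mdiff 1) t
  have hc : (fun k : T => (ξc.comp (ContinuousLinearMap.apply ℝ EK Y)) (Ad EK (k : K))) =
      fun _ => ξc Y := by
    ext k
    have := LinearMap.congr_fun (hξ ((k : K)⁻¹) (inv_mem k.2)) Y
    rw [coadjointAction, inv_inv] at this
    exact this
  rw [hc, tderiv_const] at e1
  have e3 : tderiv 𝓘(ℝ, ET) 𝓘(ℝ, EK →L[ℝ] EK) (fun k : T => Ad EK (k : K)) 1 t =
      lieBr EK K (inclE EK ET T t) := e2.trans (tderiv_Ad_one _)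
  rw [e3] at e1
  exact e1.symm

/-- The projection of `𝔤` onto `𝔨` along `𝔭`, and the positivity property of strongly elliptic
elements that makes the induced form nondegenerate. -/
theorem exists_equivariant_projection (hG : LieAlgebra.IsSemisimple ℝ (LieAlg E G))
    (hK : IsCompact (K : Set G)) (hKG : IsLieSubgroup E EK K) (hTK : IsLieSubgroup EK ET T)
    (hTG : IsCartanIn E EK ET T) {C : Set (Module.Dual ℝ (LieAlg EK K))}
    (hC : IsWeylChamber E EK ET T C) :
    ∃ π : E →L[ℝ] EK, (∀ X, π (inclE E EK K X) = X) ∧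
      (∀ Y : E, Y ∈ killingComplement E EK K ↔ π Y = 0) ∧
      (∀ (k : K) (Z : E), π (Ad E (k : G) Z) = Ad EK k (π Z)) ∧
      (∀ (ξ : Module.Dual ℝ (LieAlg EK K)) (Z : E), extendDual E EK K ξ Z = ξ (π Z)) ∧
      ∀ ξ ∈ stronglyEllipticSet E EK ET T C, ∀ X : E, π X = 0 →
        (∀ Y : E, π Y = 0 → ξ (π (lieBr E G X Y)) = 0) → X = 0 := by
  have : LieAlgebra.IsSemisimple ℝ (LieAlg E G) := hG
  have hneg := killingForm_self_eq_zero hG hK hKG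
  obtain ⟨π₀, h1, h2, h3⟩ := exists_killingProjection hneg
  let π : E →L[ℝ] EK := LinearMap.toContinuousLinearMap (E := E) (F' := EK) π₀
  have hmem : ∀ Y : E, Y ∈ killingComplement E EK K ↔ π Y = 0 := fun Y => by
    refine Iff.trans ?_ (h2 Y).symm
    exact ⟨fun h X => h _ ⟨X, rfl⟩, by rintro h _ ⟨X, rfl⟩; exact h X⟩
  have hsub : ∀ Z : E, π (Z - inclE E EK K (π Z)) = 0 := fun Z => by
    rw [map_sub]
    exact sub_eq_zero.mpr (h1 _).symm
  -- Ad(k) is an automorphism of 𝔤, so it preserves the Killing form; it also preserves 𝔨, hence the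
  -- orthogonal complement.
  have hAdp : ∀ (k : K) (Y : E), π Y = 0 → π (Ad E (k : G) Y) = 0 := fun k Y hY => by
    refine (h2 _).mpr fun X => ?_
    have := (h2 Y).mp hY (Ad EK k⁻¹ X)
    have e := LieAlgebra.killingForm_of_equiv_apply (AdEquiv E (k : G)) (hKG.lieHom (Ad EK k⁻¹ X)) Y
    refine Eq.trans ?_ (e.trans this)
    refine congrArg (fun A => killingForm ℝ (LieAlg E G) A (Ad E (k : G) Y)) ?_
    have := hKG.Ad_inclE k (Ad EK k⁻¹ X)
    exact (congrArg (inclE E EK K) (Ad_apply_Ad_inv (E := EK) k X)).symm.trans this.symm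
  have hAd : ∀ (k : K) (Z : E), π (Ad E (k : G) Z) = Ad EK k (π Z) := fun k Z => by
    have e := hAdp k _ (hsub Z)
    rw [map_sub, map_sub, hKG.Ad_inclE, sub_eq_zero] at e
    exact e.trans (h1 _)
  have hext : ∀ (ξ : Module.Dual ℝ (LieAlg EK K)) (Z : E), extendDual E EK K ξ Z = ξ (π Z) := by
    intro ξ Z
    -- The extension exists, since ξ ∘ π is one. Any two extensions agree because Z - π Z always
    -- lies in 𝔭.
    have hs := Classical.epsilon_spec (p := fun η : Module.Dual ℝ (LieAlg E G) =>
      (∀ X : LieAlg EK K, η (lieIncl E EK K X) = ξ X) ∧ ∀ Y ∈ killingComplement E EK K, η Y = 0)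
      ⟨ξ ∘ₗ π₀, fun X => congrArg ξ (h1 X), fun Y hY => (congrArg ξ ((hmem Y).mp hY)).trans
        (map_zero ξ)⟩
    have e := hs.2 _ ((hmem _).mpr (hsub Z))
    have e' := (map_sub (extendDual E EK K ξ) Z (inclE E EK K (π Z))).symm.trans e
    exact (sub_eq_zero.mp e').trans (hs.1 _)
  refine ⟨π, h1, hmem, hAd, hext, ?_⟩
  rintro _ ⟨k, ξ, ⟨hξC, hξw⟩, rfl⟩ X hX h
  obtain ⟨lam, -, -, rfl⟩ := hC
  have hξT : ξ ∈ torusDual EK T := hξC.1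
  obtain ⟨𝔥, h𝔥, h𝔥C⟩ := hTG
  -- The functional in question is Ad*(k)ξ with ξ in the chamber, so moving X by Ad(k⁻¹) reduces the
  -- claim to ξ itself.
  suffices hs : Ad E ((k⁻¹ : K) : G) X = 0 by
    have := congrArg (Ad E (k : G)) hs
    rw [map_zero] at this
    exact (Ad_apply_Ad_inv (k : G) X).symm.trans this
  have hT' : ∀ (t : LieAlg ET T) (Y : LieAlg EK K), ξ ⁅lieIncl EK ET T t, Y⁆ = 0 := fun t Y =>
    (congrArg ξ (bracket_eq_lieBr (E := EK) (G := K) (inclE EK ET T t) Y)).trans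
      (apply_lie_eq_zero_of_mem_torusDual hTK hξT t Y)
  have hkv := Classical.epsilon_spec (p := fun X : LieAlg ET T => ∀ Y : LieAlg ET T,
    killingForm ℝ (LieAlg E G) (torusIncl E EK ET T X) (torusIncl E EK ET T Y) =
      ξ (lieIncl EK ET T Y)) (by
    obtain ⟨H, hH⟩ := exists_torus_represents hneg (lieIncl EK ET T).toLinearMap 𝔥 h𝔥 h𝔥C ξ hT'
    exact ⟨H, fun Y => hH _⟩)
  refine eq_zero_of_pairing_eq_zero hneg (lieIncl EK ET T).toLinearMap 𝔥 h𝔥 h𝔥C ξ hT'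
    (ξ ∘ₗ π₀) (fun X => congrArg ξ (h1 X)) (fun Y hY => (congrArg ξ ((h2 Y).mpr hY)).trans
        (map_zero ξ)) (killingVector E EK ET T ξ) hkv ?_ _ ?_ ?_
  · intro α hα hα' h0
    exact hξw ⟨hξT, α, ⟨hα, hα'⟩, h0⟩
  · exact (h2 _).mp (hAdp k⁻¹ X hX)
  · intro Y hY
    have hY' : π Y = 0 := (h2 Y).mpr hY
    have e := h (Ad E (k : G) Y) (hAdp k Y hY')
    have e2 : Ad E ((k⁻¹ : K) : G) (lieBr E G X (Ad E (k : G) Y)) =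
        lieBr E G (Ad E ((k⁻¹ : K) : G) X) Y := by
      rw [Ad_lieBr]
      exact congrArg (lieBr E G (Ad E ((k⁻¹ : K) : G) X)) (Ad_inv_apply_Ad (E := E) (k : G) Y)
    refine Eq.trans ?_ e
    refine Eq.trans (congrArg (fun Z => ξ (π Z)) (bracket_eq_lieBr (E := E) (G := G) _ Y)) ?_
    exact (congrArg (fun Z => ξ (π Z)) e2).symm.trans (congrArg ξ (hAd _ _))

end StronglyElliptic

/-! ### Consequences of the inverse function theorem -/

section InverseFunction

/-- The inverse function theorem, with smoothness on the whole domain of the local inverse. -/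
theorem exists_openPartialHomeomorph_contDiffOn {X Y : Type*} [NormedAddCommGroup X]
    [NormedSpace ℝ X] [CompleteSpace X] [NormedAddCommGroup Y] [NormedSpace ℝ Y] {f : X → Y}
    {O : Set X} (hO : IsOpen O) (hf : ContDiffOn ℝ ∞ f O) {a : X} (ha : a ∈ O) (D : X ≃L[ℝ] Y)
    (hD : fderiv ℝ f a = D) :
    ∃ e : OpenPartialHomeomorph X Y, (∀ x, e x = f x) ∧ a ∈ e.source ∧ e.source ⊆ O ∧
      ContDiffOn ℝ ∞ e.symm e.target := by
  have hfa := hf.contDiffAt (hO.mem_nhds ha)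
  have hD' : HasFDerivAt f (D : X →L[ℝ] Y) a :=
    hD ▸ (hfa.differentiableAt (by simp)).hasFDerivAt
  let e₀ := hfa.toOpenPartialHomeomorph f hD' (by simp)
  -- The source is cut down to the open set where the derivative stays invertible; there the local
  -- inverse is smooth at every point and not only at the image of a.
  have hS : IsOpen (O ∩ fderiv ℝ f ⁻¹' Set.range ((↑) : (X ≃L[ℝ] Y) → X →L[ℝ] Y)) :=
    (hf.continuousOn_fderiv_of_isOpen hO (by simp)).isOpen_inter_preimage hO
      ContinuousLinearEquiv.isOpen
  refine ⟨e₀.restrOpen _ hS, fun x => rfl, ⟨hfa.mem_toOpenPartialHomeomorph_source hD' (by simp),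
    ha, D, hD.symm⟩, fun x hx => hx.2.1, fun y hy => ?_⟩
  have hx := (e₀.restrOpen _ hS).map_target hy
  obtain ⟨D₁, hD₁⟩ := hx.2.2
  have hfx := hf.contDiffAt (hO.mem_nhds hx.2.1)
  refine ContDiffAt.contDiffWithinAt ?_
  exact (e₀.restrOpen _ hS).contDiffAt_symm hy (f₀' := D₁)
    (hD₁ ▸ (hfx.differentiableAt (by simp)).hasFDerivAt) hfx

/-- Complete D by a projection onto its kernel, which has the dimension of C by rank–nullity. -/
theorem ContinuousLinearMap.exists_equiv_prod_of_surjective {V X C : Type*} [NormedAddCommGroup V]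
    [NormedSpace ℝ V] [FiniteDimensional ℝ V] [NormedAddCommGroup X] [NormedSpace ℝ X]
    [FiniteDimensional ℝ X] [NormedAddCommGroup C] [NormedSpace ℝ C] [FiniteDimensional ℝ C]
    (D : V →L[ℝ] X) (hD : Function.Surjective D)
    (hdim : Module.finrank ℝ V = Module.finrank ℝ X + Module.finrank ℝ C) :
    ∃ e : V ≃L[ℝ] X × C, ∀ v, (e v).1 = D v := by
  have hr := LinearMap.finrank_range_add_finrank_ker (D : V →ₗ[ℝ] X)
  rw [LinearMap.range_eq_top.mpr hD, finrank_top] at hr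
  let k : LinearMap.ker (D : V →ₗ[ℝ] X) ≃ₗ[ℝ] C := LinearEquiv.ofFinrankEq _ _ (by omega)
  obtain ⟨q, hq⟩ := Submodule.exists_isCompl (LinearMap.ker (D : V →ₗ[ℝ] X))
  let L : V →ₗ[ℝ] C := k.toLinearMap ∘ₗ Submodule.projectionOnto _ _ hq
  have hL : LinearMap.ker L = q := by
    ext v
    simp [L]
  let e := LinearMap.equivProdOfSurjectiveOfIsCompl (D : V →ₗ[ℝ] X) L
    (LinearMap.range_eq_top.mpr hD)
    (LinearMap.range_eq_top.mpr (k.surjective.comp (Submodule.projectionOnto_surjective hq))) (by rwa [hL])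
  exact ⟨e.toContinuousLinearEquiv, fun v => rfl⟩

end InverseFunction

/-! ### From surjective derivative to the normal form of a submersion -/

section Submersions

variable {EP : Type*} [NormedAddCommGroup EP] [NormedSpace ℝ EP] [FiniteDimensional ℝ EP]
  {HP : Type*} [TopologicalSpace HP] {I : ModelWithCorners ℝ EP HP} [I.Boundaryless]
  {P : Type*} [TopologicalSpace P] [ChartedSpace HP P] [IsManifold I ∞ P]
  {X : Type*} [NormedAddCommGroup X] [NormedSpace ℝ X] [FiniteDimensional ℝ X]
  {M : Type*} [TopologicalSpace M] [ChartedSpace X M] [IsManifold 𝓘(ℝ, X) ∞ M]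
  {C : Type*} [NormedAddCommGroup C] [NormedSpace ℝ C] [FiniteDimensional ℝ C]

theorem tderiv_surjective_of_section {p : P → M} {s : M → P} {a : P}
    (hp : MDifferentiableAt I 𝓘(ℝ, X) p a) (hs : MDifferentiableAt 𝓘(ℝ, X) I s (p a))
    (hsa : s (p a) = a) (h : ∀ᶠ x in 𝓝 (p a), p (s x) = x) :
    Function.Surjective (tderiv I 𝓘(ℝ, X) p a) := by
  have h1 := tderiv_comp (g := p) (f := s) (x := p a) (I₁ := 𝓘(ℝ, X)) (I₂ := I) (I₃ := 𝓘(ℝ, X))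
    (by rwa [hsa]) hs
  rw [tderiv_congr (g := fun y => y) h, tderiv_id, hsa] at h1
  intro v
  exact ⟨_, (DFunLike.congr_fun h1 v).symm⟩

/-- A smooth map whose derivative at `a` is surjective is a submersion at `a`. -/
theorem isSubmersionAtOfComplement_of_surjective {p : P → M} (hp : ContMDiff I 𝓘(ℝ, X) ∞ p)
    {a : P} (hsurj : Function.Surjective (tderiv I 𝓘(ℝ, X) p a))
    (hdim : Module.finrank ℝ EP = Module.finrank ℝ X + Module.finrank ℝ C) :
    Manifold.IsSubmersionAtOfComplement C I 𝓘(ℝ, X) ∞ p a := by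
  have : CompleteSpace EP := FiniteDimensional.complete ℝ EP
  let c : OpenPartialHomeomorph P EP := chartAt HP a ≫ₕ I.toHomeomorph.toOpenPartialHomeomorph
  have hcs : c.source = (chartAt HP a).source := by simp [c]
  have hac : a ∈ c.source := by rw [hcs]; exact mem_chart_source HP a
  have hc1 : ContMDiffOn I 𝓘(ℝ, EP) ∞ c c.source := by
    rw [hcs]; exact contMDiffOn_extChartAt (I := I) (x := a)
  have hct : c.target = (extChartAt I a).target := by
    rw [extChartAt_target, I.range_eq_univ, Set.inter_univ]
    simp only [c, OpenPartialHomeomorph.trans_target, Homeomorph.toOpenPartialHomeomorph_target,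
      Set.univ_inter]
    rfl
  have hc2 : ContMDiffOn 𝓘(ℝ, EP) I ∞ c.symm c.target := by
    rw [hct]; exact contMDiffOn_extChartAt_symm a
  let κ := chartAt X (p a)
  let h : EP → X := fun z => κ (p (c.symm z))
  have hO : IsOpen (c.target ∩ c.symm ⁻¹' (p ⁻¹' κ.source)) :=
    c.symm.isOpen_inter_preimage (κ.open_source.preimage hp.continuous)
  have haO : c a ∈ c.target ∩ c.symm ⁻¹' (p ⁻¹' κ.source) := by
    refine ⟨c.map_source hac, ?_⟩
    rw [Set.mem_preimage, c.left_inv hac]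
    exact mem_chart_source X (p a)
  have hh : ContDiffOn ℝ ∞ h (c.target ∩ c.symm ⁻¹' (p ⁻¹' κ.source)) := by
    rw [← contMDiffOn_iff_contDiffOn]
    intro z hz
    refine ContMDiffAt.contMDiffWithinAt ?_
    exact ContMDiffAt.comp z (contMDiffAt_chartAt hz.2)
      (ContMDiffAt.comp z (hp _) (hc2.contMDiffAt (c.open_target.mem_nhds hz.1)))
  have hcsymm : MDifferentiableAt 𝓘(ℝ, EP) I c.symm (c a) :=
    (hc2.contMDiffAt (c.open_target.mem_nhds haO.1)).mdiff
  have hD : Function.Surjective (fderiv ℝ h (c a)) := by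
    have e1 := tderiv_comp (g := p) (f := c.symm) (x := c a) (hp.mdiff _) hcsymm
    have e2 := tderiv_comp (g := κ) (f := fun z => p (c.symm z)) (x := c a) (I₁ := 𝓘(ℝ, EP))
      (I₃ := 𝓘(ℝ, X)) (contMDiffAt_chartAt haO.2).mdiff ((hp.mdiff _).comp _ hcsymm)
    have e3 := tderiv_comp (g := c.symm) (f := c) (x := a) (I₁ := I) (I₂ := 𝓘(ℝ, EP)) (I₃ := I)
      hcsymm ((hc1.contMDiffAt (c.open_source.mem_nhds hac)).mdiff)
    rw [tderiv_congr (g := fun y => y) (Filter.eventually_of_mem (c.open_source.mem_nhds hac)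
      fun y hy => c.left_inv hy), tderiv_id] at e3
    rw [← tderiv_eq_fderiv]
    refine (congrArg (fun A : EP →L[ℝ] X => Function.Surjective A) e2).mpr ?_
    rw [e1, c.left_inv hac, tderiv_chartAt_self]
    intro v
    obtain ⟨w, rfl⟩ := hsurj v
    refine ⟨tderiv I 𝓘(ℝ, EP) c a w, ?_⟩
    have := DFunLike.congr_fun e3.symm w
    simp only [ContinuousLinearMap.comp_apply, ContinuousLinearMap.id_apply] at this ⊢
    rw [this]
  obtain ⟨eq, heq⟩ := (fderiv ℝ h (c a)).exists_equiv_prod_of_surjective (C := C) hD hdim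
  -- Straightening map: the first component of the linear splitting is replaced by the nonlinear map
  -- h and the second is kept. Its derivative at the base point is the identity, so it corrects the
  -- chart upstairs until p becomes a projection.
  let f : EP → EP := fun z => eq.symm (h z, (eq z).2)
  have hf : ContDiffOn ℝ ∞ f (c.target ∩ c.symm ⁻¹' (p ⁻¹' κ.source)) :=
    eq.symm.contDiff.comp_contDiffOn (hh.prodMk (contDiff_snd.comp eq.contDiff).contDiffOn)
  have hfd : fderiv ℝ f (c a) = ContinuousLinearEquiv.refl ℝ EP := by
    have h1 := (hh.contDiffAt (hO.mem_nhds haO)).differentiableAt (by simp) |>.hasFDerivAt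
    have h2 : HasFDerivAt (fun z => (eq z).2)
      ((ContinuousLinearMap.snd ℝ X C).comp (eq : EP →L[ℝ] X × C)) (c a) :=
      ((ContinuousLinearMap.snd ℝ X C).comp (eq : EP →L[ℝ] X × C)).hasFDerivAt
    have h3 := eq.symm.hasFDerivAt.comp (c a) (h1.prodMk h2)
    refine h3.fderiv.trans ?_
    ext v
    simp only [ContinuousLinearMap.comp_apply, ContinuousLinearMap.prod_apply, ← heq]
    exact eq.symm_apply_apply v
  obtain ⟨e, he, hae, hes, hsm⟩ := exists_openPartialHomeomorph_contDiffOn hO hf haO _ hfd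
  let H := I.toHomeomorph.symm.toOpenPartialHomeomorph
  refine Manifold.IsSubmersionAtOfComplement.mk_of_continuousAt hp.continuous.continuousAt eq
    (c ≫ₕ e ≫ₕ H) κ ?_ (mem_chart_source X (p a)) ?_
    (IsManifold.chart_mem_maximalAtlas _) ?_
  · simpa [H] using ⟨hac, hae⟩
  · refine OpenPartialHomeomorph.mem_maximalAtlas_of_contMDiffOn _ ?_ ?_
    · intro b hb
      have hb' : b ∈ c.source ∧ c b ∈ e.source := by simpa [H] using hb
      refine ContMDiffAt.contMDiffWithinAt ?_
      refine ContMDiffAt.comp b (I' := 𝓘(ℝ, EP)) (g := I.symm) (f := fun b => e (c b)) ?_ ?_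
      · exact (ModelWithCorners.contMDiffOn_symm (I := I)).contMDiffAt
          (by rw [I.range_eq_univ]; exact Filter.univ_mem)
      · refine ContMDiffAt.comp b (I' := 𝓘(ℝ, EP)) (g := e) (f := c) ?_
          (hc1.contMDiffAt (c.open_source.mem_nhds hb'.1))
        rw [show (e : EP → EP) = f from funext he]
        exact (hf.contDiffAt (hO.mem_nhds (hes hb'.2))).contMDiffAt
    · intro y hy
      have hy' : I y ∈ e.target ∧ e.symm (I y) ∈ c.target := by
        simpa [H] using hy
      refine ContMDiffAt.contMDiffWithinAt ?_
      refine ContMDiffAt.comp y (I' := 𝓘(ℝ, EP)) (g := c.symm) (f := fun y => e.symm (I y))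
        (hc2.contMDiffAt (c.open_target.mem_nhds hy'.2)) ?_
      exact ContMDiffAt.comp y (I' := 𝓘(ℝ, EP)) (g := e.symm)
        (hsm.contDiffAt (e.open_target.mem_nhds hy'.1)).contMDiffAt (ModelWithCorners.contMDiff (I := I)).contMDiffAt
  · intro y hy
    have hIy : I (I.symm y) = y := I.toHomeomorph.apply_symm_apply y
    have hy' : y ∈ e.target ∧ e.symm y ∈ c.target := by
      have : (∃ y_1, I y_1 = y) ∧ I (I.symm y) ∈ e.target ∧ e.symm (I (I.symm y)) ∈ c.target := by
        simpa [H] using hy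
      simpa only [hIy] using this.2
    have := congrArg eq (he (e.symm y))
    rw [e.right_inv hy'.1] at this
    rw [Function.comp_apply (f := Prod.fst), this]
    simp [f, h, H, hIy]

end Submersions

/-! ### Manifold structure on a quotient with slices -/

section Slices

variable {EP : Type*} [NormedAddCommGroup EP] [NormedSpace ℝ EP]
  {HP : Type*} [TopologicalSpace HP] {I : ModelWithCorners ℝ EP HP}
  {P : Type*} [TopologicalSpace P] [ChartedSpace HP P]
  {X : Type*} [NormedAddCommGroup X] [NormedSpace ℝ X]
  {M : Type*} [TopologicalSpace M]

variable (I) in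
/-- `s`, restricted to the open set `O`, is a smooth slice for the map `p`: `p ∘ s` is injective on
`O`, and near every point of the fibres through `s(O)` the map `p` lifts smoothly along `p ∘ s`. -/
structure IsSlice (p : P → M) (s : X → P) (O : Set X) : Prop where
  isOpen : IsOpen O
  smooth : ContMDiffOn 𝓘(ℝ, X) I ∞ s O
  inj : Set.InjOn (fun x => p (s x)) O
  retract : ∀ x ∈ O, ∀ b, p b = p (s x) → ∃ q : P → X, ContMDiffAt I 𝓘(ℝ, X) ∞ q b ∧ q b = x ∧
    ∀ᶠ b' in 𝓝 b, q b' ∈ O ∧ p (s (q b')) = p b'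

namespace IsSlice

variable {p : P → M} {s : X → P} {O : Set X}

/-- Near s(x) one has p = p ∘ s ∘ q with q continuous, so the image under p of a small
neighbourhood, which is a neighbourhood since p is open, lies in the image of the slice. -/
theorem isOpenMap_domRestrict (h : IsSlice I p s O) (hpo : IsOpenMap p) :
    IsOpenMap (O.domRestrict fun x => p (s x)) := by
  rw [isOpenMap_iff_nhds_le]
  rintro ⟨x, hx⟩ V hV
  obtain ⟨q, hq, hqx, hev⟩ := h.retract x hx (s x) rfl
  rw [Filter.mem_map, mem_nhds_subtype] at hV
  obtain ⟨W, hW, hWV⟩ := hV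
  have hW' : ∀ᶠ b in 𝓝 (s x), q b ∈ W := hq.continuousAt (by rwa [hqx])
  refine Filter.mem_of_superset (hpo.image_mem_nhds (hW'.and hev)) ?_
  rintro _ ⟨b, ⟨hb, hbO, hbp⟩, rfl⟩
  rw [← hbp]
  exact hWV (show (⟨q b, hbO⟩ : O) ∈ Subtype.val ⁻¹' W from hb)

/-- The chart of the quotient defined by a slice. -/
def chart (h : IsSlice I p s O) (hp : Continuous p) (hpo : IsOpenMap p) :
    OpenPartialHomeomorph M X :=
  (OpenPartialHomeomorph.ofContinuousOpenRestrict (h.inj.toPartialEquiv _ _)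
    (hp.comp_continuousOn h.smooth.continuousOn) (h.isOpenMap_domRestrict hpo) h.isOpen).symm

variable (h : IsSlice I p s O) (hp : Continuous p) (hpo : IsOpenMap p)

theorem mem_chart_source {x : X} (hx : x ∈ O) : p (s x) ∈ (h.chart hp hpo).source :=
  (h.chart hp hpo).map_target hx

theorem chart_apply {x : X} (hx : x ∈ O) : h.chart hp hpo (p (s x)) = x :=
  (h.chart hp hpo).right_inv hx

theorem exists_of_mem_source {y : M} (hy : y ∈ (h.chart hp hpo).source) :
    ∃ x ∈ O, p (s x) = y :=
  ⟨_, (h.chart hp hpo).map_source hy, (h.chart hp hpo).left_inv hy⟩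

/-- On the slice the chart inverts p ∘ s, so near any point of the fibre its composition with p is
the local retraction q. This is the only place where the charts and the smooth structure upstairs
meet. -/
theorem contMDiffAt_chart_comp {b : P} (hb : p b ∈ (h.chart hp hpo).source) :
    ContMDiffAt I 𝓘(ℝ, X) ∞ (fun b => h.chart hp hpo (p b)) b := by
  obtain ⟨x, hx, hxb⟩ := h.exists_of_mem_source hp hpo hb
  obtain ⟨q, hq, -, hev⟩ := h.retract x hx b hxb.symm
  refine hq.congr_of_eventuallyEq ?_
  filter_upwards [hev] with b' hb'
  rw [← hb'.2, h.chart_apply hp hpo hb'.1]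

end IsSlice

/-- A quotient by an open map that has a slice through every point is a manifold. -/
theorem exists_manifold_of_slices {p : P → M} (hp : Continuous p) (hpo : IsOpenMap p)
    (hps : Function.Surjective p)
    (h : ∀ a : P, ∃ (s : X → P) (O : Set X) (x : X), IsSlice I p s O ∧ x ∈ O ∧ s x = a) :
    ∃ _ : ChartedSpace X M, IsManifold 𝓘(ℝ, X) ∞ M ∧ ContMDiff I 𝓘(ℝ, X) ∞ p ∧
      ∀ a, ∃ s : M → P, ContMDiffAt 𝓘(ℝ, X) I ∞ s (p a) ∧ s (p a) = a ∧
        ∀ᶠ y in 𝓝 (p a), p (s y) = y := by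
  choose s O x hs hx hsx using h
  let c : P → OpenPartialHomeomorph M X := fun a => (hs a).chart hp hpo
  have hc : ∀ a, p a ∈ (c a).source := fun a => by
    have := (hs a).mem_chart_source hp hpo (hx a)
    rwa [hsx] at this
  let r := Function.surjInv hps
  let _ : ChartedSpace X M :=
    { atlas := Set.range c
      chartAt := fun y => c (r y)
      mem_chart_source := fun y => by
        have := hc (r y)
        rwa [Function.surjInv_eq hps] at this
      chart_mem_atlas := fun y => ⟨_, rfl⟩ }
  have hman : IsManifold 𝓘(ℝ, X) ∞ M := by
    refine isManifold_of_contDiffOn _ _ _ ?_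
    rintro _ _ ⟨a, rfl⟩ ⟨b, rfl⟩
    simp only [modelWithCornersSelf_coe, modelWithCornersSelf_coe_symm, Function.id_comp,
      Function.comp_id, Set.range_id, Set.inter_univ, Set.preimage_id]
    intro y hy
    refine ContDiffAt.contDiffWithinAt ?_
    rw [← contMDiffAt_iff_contDiffAt]
    rw [OpenPartialHomeomorph.trans_source] at hy
    -- A transition map is the second chart composed with p and with the first slice, so the
    -- previous smoothness statement applies.
    exact ContMDiffAt.comp y (f := s a) (g := fun b' => c b (p b'))
      ((hs b).contMDiffAt_chart_comp hp hpo hy.2)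
      ((hs a).smooth.contMDiffAt ((hs a).isOpen.mem_nhds hy.1))
  have hatlas : ∀ a, c a ∈ IsManifold.maximalAtlas 𝓘(ℝ, X) ∞ M := fun a =>
    IsManifold.subset_maximalAtlas ⟨a, rfl⟩
  refine ⟨inferInstance, hman, fun b => ?_, fun a => ⟨fun y => s a (c a y), ?_, ?_, ?_⟩⟩
  · rw [contMDiffAt_iff_target]
    refine ⟨hp.continuousAt, ?_⟩
    refine (hs (r (p b))).contMDiffAt_chart_comp hp hpo (b := b) ?_
    exact _root_.mem_chart_source X (p b)
  · refine ContMDiffAt.comp (p a) (I' := 𝓘(ℝ, X)) (g := s a) (f := c a)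
      ((hs a).smooth.contMDiffAt ((hs a).isOpen.mem_nhds ((c a).map_source (hc a)))) ?_
    exact contMDiffAt_of_mem_maximalAtlas (hatlas a) (hc a)
  · have := (hs a).chart_apply hp hpo (hx a)
    rw [hsx] at this
    simp only [c, this, hsx]
  · filter_upwards [(c a).open_source.mem_nhds (hc a)] with y hy
    exact (c a).left_inv hy

end Slices

/-! ### Topology of the fibred product -/

section QuotientTopology

variable {G : Type*} [Group G] [TopologicalSpace G] [IsTopologicalGroup G] {K : Subgroup G}
  {N : Type*} [TopologicalSpace N] [MulAction K N]

namespace FibredProduct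

theorem mk_eq_mk {a b : G × N} : mk K a = mk K b ↔ ∃ k : K, b = (a.1 * (k : G)⁻¹, k • a.2) :=
  Quotient.eq (r := fibredSetoid K N)

theorem mk_smul (k : K) (a : G × N) : mk K (a.1 * (k : G)⁻¹, k • a.2) = mk K a :=
  (mk_eq_mk.mpr ⟨k, rfl⟩).symm

theorem mk_surjective : Function.Surjective (mk K : G × N → FibredProduct K N) :=
  Quotient.mk_surjective

theorem continuous_mk : Continuous (mk K : G × N → FibredProduct K N) :=
  continuous_quotient_mk'

variable [ContinuousSMul K N]

theorem isOpenMap_mk : IsOpenMap (mk K : G × N → FibredProduct K N) := by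
  intro U hU
  have : mk K ⁻¹' (mk K '' U) = ⋃ k : K, (fun a : G × N => (a.1 * (k : G)⁻¹, k • a.2)) ⁻¹' U := by
    ext a
    simp only [Set.mem_preimage, Set.mem_image, Set.mem_iUnion]
    constructor
    · rintro ⟨b, hb, hba⟩
      obtain ⟨k, rfl⟩ := mk_eq_mk.mp hba.symm
      exact ⟨k, hb⟩
    · rintro ⟨k, hk⟩
      exact ⟨_, hk, mk_smul k a⟩
  refine isOpen_coinduced.mpr ?_
  refine (congrArg IsOpen this).mpr (isOpen_iUnion fun k => hU.preimage ?_)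
  fun_prop

theorem isOpenQuotientMap_mk : IsOpenQuotientMap (mk K : G × N → FibredProduct K N) :=
  ⟨mk_surjective, continuous_mk, isOpenMap_mk⟩

theorem secondCountableTopology [SecondCountableTopology G] [SecondCountableTopology N] :
    SecondCountableTopology (FibredProduct K N) :=
  isOpenQuotientMap_mk.isQuotientMap.secondCountableTopology isOpenMap_mk

/-- The quotient map is open, so it suffices that the orbit relation is closed. It is the projection
of a closed set along the compact factor K. -/
theorem t2Space [T2Space G] [T2Space N] (hK : IsCompact (K : Set G)) :
    T2Space (FibredProduct K N) := by
  have : CompactSpace K := isCompact_iff_compactSpace.mp hK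
  rw [t2Space_iff_of_isOpenQuotientMap isOpenQuotientMap_mk]
  have hS : IsClosed {z : ((G × N) × (G × N)) × K |
      z.1.2 = (z.1.1.1 * (z.2 : G)⁻¹, z.2 • z.1.1.2)} :=
    isClosed_eq (by fun_prop) (by fun_prop)
  convert isClosedMap_fst_of_compactSpace _ hS
  ext z
  simp only [Set.mem_ofPred_eq, mk_eq_mk, Set.mem_image, Prod.exists, exists_and_right,
    exists_eq_right]

end FibredProduct

end QuotientTopology

/-! ### A slice of a Lie subgroup at the identity -/

section SubgroupSlice

variable {E : Type*} [NormedAddCommGroup E] [NormedSpace ℝ E] [FiniteDimensional ℝ E]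
  [CompleteSpace E]
  {G : Type*} [TopologicalSpace G] [ChartedSpace E G] [Group G] [LieGroup 𝓘(ℝ, E) ∞ G]
  {EK : Type*} [NormedAddCommGroup EK] [NormedSpace ℝ EK] [FiniteDimensional ℝ EK]
  [CompleteSpace EK]
  {K : Subgroup G} [ChartedSpace EK K] [LieGroup 𝓘(ℝ, EK) ∞ K]

/-- The decomposition of a vector space defined by a retraction onto a subspace. -/
theorem exists_equiv_ker_prod (i : EK →L[ℝ] E) (π : E →L[ℝ] EK) (hπ : ∀ X, π (i X) = X) :
    ∃ D : (LinearMap.ker (π : E →ₗ[ℝ] EK) × EK) ≃L[ℝ] E, ∀ u y, D (u, y) = u + i y := by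
  let D₀ : (LinearMap.ker (π : E →ₗ[ℝ] EK) × EK) →ₗ[ℝ] E :=
    (LinearMap.ker (π : E →ₗ[ℝ] EK)).subtype.coprod (i : EK →ₗ[ℝ] E)
  have hD₀ : ∀ u y, D₀ (u, y) = u + i y := fun u y => rfl
  have hπu : ∀ u : LinearMap.ker (π : E →ₗ[ℝ] EK), π (u : E) = 0 := fun u => u.2
  have hb : Function.Bijective D₀ := by
    constructor
    · refine (injective_iff_map_eq_zero D₀).mpr ?_
      rintro ⟨u, y⟩ h
      rw [hD₀] at h
      have hy := congrArg π h
      rw [map_add, hπu, hπ, zero_add, map_zero] at hy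
      rw [hy, map_zero, add_zero] at h
      exact Prod.ext (Subtype.ext h) hy
    · intro z
      refine ⟨(⟨z - i (π z), ?_⟩, π z), ?_⟩
      · rw [LinearMap.mem_ker, ContinuousLinearMap.coe_coe, map_sub, hπ, sub_self]
      · rw [hD₀, sub_add_cancel]
  exact ⟨(LinearEquiv.ofBijective D₀ hb).toContinuousLinearEquiv, hD₀⟩

theorem contMDiffAt_chartAt_symm_add {V : Type*} [NormedAddCommGroup V] [NormedSpace ℝ V]
    {M : Type*} [TopologicalSpace M] [ChartedSpace E M] [IsManifold 𝓘(ℝ, E) ∞ M] (x : M)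
    (i : V →L[ℝ] E) {u : V} (hu : chartAt E x x + i u ∈ (chartAt E x).target) :
    ContMDiffAt 𝓘(ℝ, V) 𝓘(ℝ, E) ∞ (fun u => (chartAt E x).symm (chartAt E x x + i u)) u :=
  ContMDiffAt.comp u (g := (chartAt E x).symm) (f := fun u => chartAt E x x + i u)
    (contMDiffAt_chartAt_symm hu) (contDiff_const.add i.contDiff).contMDiff.contMDiffAt

theorem tderiv_chartAt_symm_add {V : Type*} [NormedAddCommGroup V] [NormedSpace ℝ V]
    {M : Type*} [TopologicalSpace M] [ChartedSpace E M] [IsManifold 𝓘(ℝ, E) ∞ M] (x : M)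
    (i : V →L[ℝ] E) (v : V) :
    tderiv 𝓘(ℝ, V) 𝓘(ℝ, E) (fun u => (chartAt E x).symm (chartAt E x x + i u)) 0 v = i v := by
  have h0 : chartAt E x x + i 0 = chartAt E x x := by rw [map_zero, add_zero]
  have h1 : MDifferentiableAt 𝓘(ℝ, E) 𝓘(ℝ, E) (chartAt E x).symm (chartAt E x x + i 0) := by
    rw [h0]
    exact (contMDiffAt_chartAt_symm (mem_chart_target E x)).mdiff
  have h2 := tderiv_comp_apply (I₁ := 𝓘(ℝ, V)) (f := fun u => chartAt E x x + i u) h1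
    ((contDiff_const.add i.contDiff).contMDiff.mdiff 0) v
  rw [h0, tderiv_chartAt_symm_self, tderiv_eq_fderiv, fderiv_const_add, i.fderiv] at h2
  exact h2

/-- Every embedded Lie subgroup has a slice through the identity. -/
theorem IsLieSubgroup.exists_slice (hKG : IsLieSubgroup E EK K) (π : E →L[ℝ] EK)
    (hπ : ∀ X, π (inclE E EK K X) = X) :
    ∃ (σ : LinearMap.ker (π : E →ₗ[ℝ] EK) → G) (U : Set (LinearMap.ker (π : E →ₗ[ℝ] EK)))
      (τ : G → LinearMap.ker (π : E →ₗ[ℝ] EK)) (κ : G → K) (W : Set G),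
      IsOpen U ∧ 0 ∈ U ∧ σ 0 = 1 ∧
      ContMDiffOn 𝓘(ℝ, LinearMap.ker (π : E →ₗ[ℝ] EK)) 𝓘(ℝ, E) ∞ σ U ∧ IsOpen W ∧
      ContMDiffOn 𝓘(ℝ, E) 𝓘(ℝ, LinearMap.ker (π : E →ₗ[ℝ] EK)) ∞ τ W ∧
      ContMDiffOn 𝓘(ℝ, E) 𝓘(ℝ, EK) ∞ κ W ∧
      (∀ u ∈ U, σ u ∈ W ∧ τ (σ u) = u ∧ κ (σ u) = 1) ∧
      (∀ g ∈ W, σ (τ g) * (κ g : G) = g) ∧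
      ∀ u ∈ U, ∀ u' ∈ U, ∀ k : K, σ u = σ u' * (k : G) → u = u' ∧ k = 1 := by
  have : IsTopologicalGroup G := topologicalGroup_of_lieGroup 𝓘(ℝ, E) ∞
  have hval := hKG.contMDiff_val
  set V := LinearMap.ker (π : E →ₗ[ℝ] EK) with hV
  let φ := chartAt E (1 : G)
  let ψ := chartAt EK (1 : K)
  let σ : V → G := fun u => φ.symm (φ 1 + V.subtypeL u)
  let θ : EK → K := fun y => ψ.symm (ψ 1 + ContinuousLinearMap.id ℝ EK y)
  have hσ0 : σ 0 = 1 := by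
    simp only [σ, map_zero, add_zero]
    exact φ.left_inv (mem_chart_source E _)
  have hθ0 : θ 0 = 1 := by
    simp only [θ, map_zero, add_zero]
    exact ψ.left_inv (mem_chart_source EK _)
  let A : Set (V × EK) := {w | φ 1 + V.subtypeL w.1 ∈ φ.target} ∩
    {w | ψ 1 + ContinuousLinearMap.id ℝ EK w.2 ∈ ψ.target}
  have hA : IsOpen A := (φ.open_target.preimage (by fun_prop)).inter
    (ψ.open_target.preimage (by fun_prop))
  have hσA : ∀ w ∈ A, ContMDiffAt 𝓘(ℝ, V) 𝓘(ℝ, E) ∞ σ w.1 := fun w hw =>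
    contMDiffAt_chartAt_symm_add _ _ hw.1
  have hθA : ∀ w ∈ A, ContMDiffAt 𝓘(ℝ, EK) 𝓘(ℝ, EK) ∞ θ w.2 := fun w hw =>
    contMDiffAt_chartAt_symm_add _ _ hw.2
  -- The product of a chart of ker π and a chart of K. Its derivative at 0 is (u, y) ↦ u + y, an
  -- isomorphism since 𝔤 = ker π ⊕ 𝔨, so it is invertible near 0.
  let Ψ : V × EK → G := fun w => σ w.1 * (θ w.2 : G)
  have hΨ : ∀ w ∈ A, ContMDiffAt 𝓘(ℝ, V × EK) 𝓘(ℝ, E) ∞ Ψ w := fun w hw => by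
    refine ContMDiffAt.mul ?_ ?_
    · exact ContMDiffAt.comp w (g := σ) (f := Prod.fst) (hσA w hw) contDiff_fst.contMDiff.contMDiffAt
    · exact ContMDiffAt.comp w (g := Subtype.val) (f := fun w : V × EK => θ w.2) (hval _)
        (ContMDiffAt.comp w (g := θ) (f := Prod.snd) (hθA w hw) contDiff_snd.contMDiff.contMDiffAt)
  have hΨ0 : Ψ 0 = 1 := by simp [Ψ, hσ0, hθ0]
  have h0A : (0 : V × EK) ∈ A := by
    constructor
    · rw [Set.mem_ofPred_eq, Prod.fst_zero, map_zero, add_zero]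
      exact mem_chart_target E (1 : G)
    · rw [Set.mem_ofPred_eq, Prod.snd_zero, map_zero, add_zero]
      exact mem_chart_target EK (1 : K)
  have hO : IsOpen (A ∩ Ψ ⁻¹' φ.source) :=
    ContinuousOn.isOpen_inter_preimage (fun w hw => (hΨ w hw).continuousAt.continuousWithinAt) hA
      φ.open_source
  have h0O : (0 : V × EK) ∈ A ∩ Ψ ⁻¹' φ.source := by
    refine ⟨h0A, ?_⟩
    rw [Set.mem_preimage, hΨ0]
    exact mem_chart_source E _
  have hf : ContDiffOn ℝ ∞ (fun w => φ (Ψ w)) (A ∩ Ψ ⁻¹' φ.source) := by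
    rw [← contMDiffOn_iff_contDiffOn]
    intro w hw
    exact (ContMDiffAt.comp w (contMDiffAt_chartAt hw.2) (hΨ w hw.1)).contMDiffWithinAt
  obtain ⟨D, hD⟩ := exists_equiv_ker_prod (inclE E EK K) π hπ
  have hfd : fderiv ℝ (fun w => φ (Ψ w)) 0 = D := by
    have e1 := tderiv_eq_fderiv_chart_right (hΨ 0 h0A).mdiff
    rw [hΨ0] at e1
    rw [← e1]
    have eu : ∀ u, tderiv 𝓘(ℝ, V × EK) 𝓘(ℝ, E) Ψ 0 (u, 0) = u := fun u => by
      have e2 := tderiv_comp_apply (g := Ψ) (f := fun u : V => ((u, 0) : V × EK)) (x := 0)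
        (I₁ := 𝓘(ℝ, V)) (hΨ 0 h0A).mdiff ((ContinuousLinearMap.inl ℝ V EK).contDiff.contMDiff.mdiff 0) u
      rw [tderiv_eq_fderiv (f := fun u : V => ((u, 0) : V × EK)),
        show fderiv ℝ (fun u : V => ((u, 0) : V × EK)) 0 = ContinuousLinearMap.inl ℝ V EK from
          (ContinuousLinearMap.inl ℝ V EK).fderiv] at e2
      refine e2.symm.trans ?_
      have : (fun u : V => Ψ (u, 0)) = σ := by
        ext u
        simp [Ψ, hθ0]
      rw [this]
      exact tderiv_chartAt_symm_add _ _ _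
    have ey : ∀ y, tderiv 𝓘(ℝ, V × EK) 𝓘(ℝ, E) Ψ 0 (0, y) = inclE E EK K y := fun y => by
      have e2 := tderiv_comp_apply (g := Ψ) (f := fun y : EK => ((0, y) : V × EK)) (x := 0)
        (I₁ := 𝓘(ℝ, EK)) (hΨ 0 h0A).mdiff
        ((ContinuousLinearMap.inr ℝ V EK).contDiff.contMDiff.mdiff 0) y
      rw [tderiv_eq_fderiv (f := fun y : EK => ((0, y) : V × EK)),
        show fderiv ℝ (fun y : EK => ((0, y) : V × EK)) 0 = ContinuousLinearMap.inr ℝ V EK from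
          (ContinuousLinearMap.inr ℝ V EK).fderiv] at e2
      refine e2.symm.trans ?_
      have : (fun y : EK => Ψ (0, y)) = fun y => (θ y : G) := by
        ext y
        simp [Ψ, hσ0]
      rw [this]
      have e3 := tderiv_comp_apply (g := (Subtype.val : K → G)) (f := θ) (x := 0)
        (hval.mdiff _) (hθA 0 h0A).mdiff y
      refine e3.trans ?_
      rw [hθ0]
      exact congrArg (inclE E EK K) (tderiv_chartAt_symm_add _ _ _)
    refine ContinuousLinearMap.ext fun w => ?_
    obtain ⟨u, y⟩ := w
    have : ((u, y) : V × EK) = (u, 0) + (0, y) := by simp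
    rw [this, map_add, eu, ey]
    simp [hD]
  obtain ⟨e, he, h0e, heO, hsm⟩ := exists_openPartialHomeomorph_contDiffOn hO hf h0O D hfd
  obtain ⟨U₁, Y₁, hU₁, h0U₁, hY₁, h0Y₁, hUY⟩ := mem_nhds_prod_iff'.mp
    (e.open_source.mem_nhds (show ((0 : V), (0 : EK)) ∈ e.source from h0e))
  have hQ : {k : K | k ∈ ψ.source ∧ ψ k - ψ 1 ∈ Y₁} ∈ 𝓝 (1 : K) := by
    refine Filter.inter_mem (ψ.open_source.mem_nhds (mem_chart_source EK _)) ?_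
    refine ContinuousAt.preimage_mem_nhds (f := fun k => ψ k - ψ 1) ?_ ?_
    · exact (ψ.continuousAt (mem_chart_source EK _)).sub continuousAt_const
    · rw [sub_self]; exact hY₁.mem_nhds h0Y₁
  -- K carries the subspace topology, so elements of K that are close to 1 in G have small
  -- coordinates in K. Without this, K could return to the slice through far-away elements.
  rw [nhds_subtype_eq_comap, Filter.mem_comap] at hQ
  obtain ⟨Q, hQ, hQK⟩ := hQ
  have hσ0' : ContinuousAt σ 0 := (hσA 0 h0A).continuousAt
  have hQ' : ∀ᶠ z in 𝓝 ((0 : V), (0 : V)), (σ z.2)⁻¹ * σ z.1 ∈ Q := by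
    have : ContinuousAt (fun z : V × V => (σ z.2)⁻¹ * σ z.1) ((0 : V), (0 : V)) :=
      ((ContinuousAt.comp (g := σ) (f := Prod.snd) hσ0' continuousAt_snd).inv).mul
        (ContinuousAt.comp (g := σ) (f := Prod.fst) hσ0' continuousAt_fst)
    refine this ?_
    simpa [hσ0] using hQ
  obtain ⟨U₂, U₃, hU₂, h0U₂, hU₃, h0U₃, hU23⟩ := mem_nhds_prod_iff'.mp hQ'
  have hUe : ∀ u ∈ U₁, (u, (0 : EK)) ∈ e.source := fun u hu => hUY ⟨hu, h0Y₁⟩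
  have hσe : ∀ u ∈ U₁, σ u ∈ φ.source ∧ φ (σ u) = e (u, 0) := fun u hu => by
    have h1 : Ψ (u, 0) = σ u := by simp [Ψ, hθ0]
    have h2 := (heO (hUe u hu)).2
    rw [Set.mem_preimage, h1] at h2
    exact ⟨h2, by rw [he, h1]⟩
  have hW : IsOpen (φ.source ∩ φ ⁻¹' e.target) := φ.isOpen_inter_preimage e.open_target
  have hsymm : ContMDiffOn 𝓘(ℝ, E) 𝓘(ℝ, V × EK) ∞ (fun g => e.symm (φ g))
      (φ.source ∩ φ ⁻¹' e.target) := fun g hg =>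
    (ContMDiffAt.comp g (hsm.contDiffAt (e.open_target.mem_nhds hg.2)).contMDiffAt
      (contMDiffAt_chartAt hg.1)).contMDiffWithinAt
  refine ⟨σ, U₁ ∩ (U₂ ∩ U₃), fun g => (e.symm (φ g)).1, fun g => θ (e.symm (φ g)).2,
    φ.source ∩ φ ⁻¹' e.target, hU₁.inter (hU₂.inter hU₃), ⟨h0U₁, h0U₂, h0U₃⟩, hσ0, ?_, hW, ?_, ?_,
    ?_, ?_, ?_⟩
  · intro u hu
    exact (hσA (u, 0) (heO (hUe u hu.1)).1).contMDiffWithinAt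
  · exact contDiff_fst.contMDiff.comp_contMDiffOn hsymm
  · intro g hg
    refine ContMDiffAt.contMDiffWithinAt ?_
    refine ContMDiffAt.comp g (g := θ) (f := fun g => (e.symm (φ g)).2) (I' := 𝓘(ℝ, EK)) ?_
      ((contDiff_snd.contMDiff.comp_contMDiffOn hsymm).contMDiffAt (hW.mem_nhds hg))
    exact hθA _ (heO (e.map_target hg.2)).1
  · intro u hu
    obtain ⟨h1, h2⟩ := hσe u hu.1
    refine ⟨⟨h1, ?_⟩, ?_, ?_⟩
    · rw [Set.mem_preimage, h2]
      exact e.map_source (hUe u hu.1)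
    · simp only [h2, e.left_inv (hUe u hu.1)]
    · simp only [h2, e.left_inv (hUe u hu.1), hθ0]
  · intro g hg
    have h1 := (heO (e.map_target hg.2)).2
    have h2 : φ (Ψ (e.symm (φ g))) = φ g := by rw [← he, e.right_inv hg.2]
    exact φ.injOn h1 hg.1 h2
  -- Here k = σ(u')⁻¹ σ(u) lies in `Q` by the choice of `U₂` and `U₃`. So k has coordinates in `Y₁`,
  -- and the local injectivity of `Ψ` applies.
  · intro u hu u' hu' k hk
    have hkQ : (k : G) ∈ Q := by
      have := @hU23 (u, u') ⟨hu.2.1, hu'.2.2⟩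
      simp only [Set.mem_ofPred_eq, hk, inv_mul_cancel_left] at this
      exact this
    obtain ⟨hk1, hk2⟩ := hQK hkQ
    have hθk : θ (ψ k - ψ 1) = k := by
      simp only [θ, ContinuousLinearMap.id_apply, add_sub_cancel]
      exact ψ.left_inv hk1
    have hinj := e.injOn (hUe u hu.1) (show (u', ψ k - ψ 1) ∈ e.source from hUY ⟨hu'.1, hk2⟩) (by
      rw [he, he]
      simp only [Ψ, hθ0, hθk]
      rw [← hk, OneMemClass.coe_one, mul_one])
    rw [Prod.mk.injEq] at hinj
    exact ⟨hinj.1, by rw [← hθk, ← hinj.2, hθ0]⟩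

end SubgroupSlice

/-! ### The smooth structure of G ×_K N -/

section FibredProductManifold

variable {E : Type*} [NormedAddCommGroup E] [NormedSpace ℝ E] [FiniteDimensional ℝ E]
  [CompleteSpace E]
  {G : Type*} [TopologicalSpace G] [ChartedSpace E G] [Group G] [LieGroup 𝓘(ℝ, E) ∞ G]
  {EK : Type*} [NormedAddCommGroup EK] [NormedSpace ℝ EK] [FiniteDimensional ℝ EK]
  [CompleteSpace EK]
  {K : Subgroup G} [ChartedSpace EK K] [LieGroup 𝓘(ℝ, EK) ∞ K]
  {F : Type*} [NormedAddCommGroup F] [NormedSpace ℝ F] [FiniteDimensional ℝ F]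
  {N : Type*} [TopologicalSpace N] [ChartedSpace F N] [IsManifold 𝓘(ℝ, F) ∞ N] [MulAction K N]
  [ContMDiffSMul 𝓘(ℝ, EK) 𝓘(ℝ, F) ∞ K N]
  {X : Type*} [NormedAddCommGroup X] [NormedSpace ℝ X]

/-- The slice through (g₀, n₀) is the product of the translated slice g₀ σ(u) with a chart of N. A
nearby point (g, n) is brought back to it by decomposing g₀⁻¹ g, up to the fixed k, as a slice
element times an element of K, and moving the latter factor onto n. -/
theorem IsLieSubgroup.exists_isSlice (hKG : IsLieSubgroup E EK K) (π : E →L[ℝ] EK)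
    (hπ : ∀ Y, π (inclE E EK K Y) = Y) (L : X ≃L[ℝ] LinearMap.ker (π : E →ₗ[ℝ] EK) × F)
    (a : G × N) :
    ∃ (s : X → G × N) (O : Set X) (x : X),
      IsSlice (𝓘(ℝ, E).prod 𝓘(ℝ, F)) (FibredProduct.mk K) s O ∧ x ∈ O ∧ s x = a := by
  have : IsTopologicalGroup G := topologicalGroup_of_lieGroup 𝓘(ℝ, E) ∞
  obtain ⟨σ, U, τ, κ, W, hU, h0U, hσ0, hσ, hW, hτ, hκ, hUW, hWσ, hinj⟩ := hKG.exists_slice π hπ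
  obtain ⟨g₀, n₀⟩ := a
  let ψ := chartAt F n₀
  refine ⟨fun x => (g₀ * σ (L x).1, ψ.symm (L x).2), L ⁻¹' (U ×ˢ ψ.target), L.symm (0, ψ n₀),
    ⟨?_, ?_, ?_, ?_⟩, ?_, ?_⟩
  · exact (hU.prod ψ.open_target).preimage L.continuous
  · intro x hx
    refine ContMDiffAt.contMDiffWithinAt (ContMDiffAt.prodMk (contMDiffAt_const.mul ?_) ?_)
    · exact ContMDiffAt.comp x (g := σ) (f := fun x => (L x).1) (hσ.contMDiffAt (hU.mem_nhds hx.1))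
        (contDiff_fst.comp L.contDiff).contMDiff.contMDiffAt
    · exact ContMDiffAt.comp x (g := ψ.symm) (f := fun x => (L x).2)
        (contMDiffAt_chartAt_symm hx.2) (contDiff_snd.comp L.contDiff).contMDiff.contMDiffAt
  · intro x hx x' hx' h
    obtain ⟨k, hk⟩ := FibredProduct.mk_eq_mk.mp h
    rw [Prod.mk.injEq, mul_assoc, mul_right_inj] at hk
    obtain ⟨h1, h2⟩ := hinj _ hx'.1 _ hx.1 k⁻¹ (by simpa using hk.1)
    rw [inv_eq_one] at h2
    have h3 := hk.2
    rw [h2, one_smul] at h3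
    exact L.injective (Prod.ext h1.symm (ψ.symm.injOn hx'.2 hx.2 h3).symm)
  · intro x hx ⟨g, n⟩ hb
    obtain ⟨k, hk⟩ := FibredProduct.mk_eq_mk.mp hb
    simp only [Prod.mk.injEq] at hk
    let η : G × N → G := fun b => g₀⁻¹ * (b.1 * (k : G)⁻¹)
    let ζ : G × N → N := fun b => κ (η b) • k • b.2
    have hη : ContMDiff (𝓘(ℝ, E).prod 𝓘(ℝ, F)) 𝓘(ℝ, E) ∞ η :=
      contMDiff_const.mul (contMDiff_fst.mul contMDiff_const)
    have hηb : η (g, n) = σ (L x).1 := by simp only [η, ← hk.1, inv_mul_cancel_left]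
    obtain ⟨hW1, hτ1, hκ1⟩ := hUW _ hx.1
    have hηW : ∀ᶠ b in 𝓝 (g, n), η b ∈ W :=
      hη.continuous.continuousAt.eventually (by rw [hηb]; exact hW.mem_nhds hW1)
    have hκη : ContMDiffAt (𝓘(ℝ, E).prod 𝓘(ℝ, F)) 𝓘(ℝ, EK) ∞ (fun b => κ (η b)) (g, n) :=
      ContMDiffAt.comp (g, n) (g := κ) (f := η)
        (hκ.contMDiffAt (by rw [hηb]; exact hW.mem_nhds hW1)) hη.contMDiffAt
    have hζ : ContMDiffAt (𝓘(ℝ, E).prod 𝓘(ℝ, F)) 𝓘(ℝ, F) ∞ ζ (g, n) :=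
      ContMDiffAt.comp (g, n) (I' := 𝓘(ℝ, EK).prod 𝓘(ℝ, F)) (g := fun q : K × N => q.1 • q.2)
        (f := fun b : G × N => (κ (η b), k • b.2)) (contMDiff_smul _)
        (hκη.prodMk (ContMDiff.smul (I := 𝓘(ℝ, EK)) contMDiff_const contMDiff_snd).contMDiffAt)
    have hζb : ζ (g, n) = ψ.symm (L x).2 := by simp only [ζ, hηb, hκ1, one_smul, hk.2]
    have hζψ : ζ (g, n) ∈ ψ.source := by rw [hζb]; exact ψ.map_target hx.2
    have hζev : ∀ᶠ b in 𝓝 (g, n), ζ b ∈ ψ.source :=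
      hζ.continuousAt.eventually (ψ.open_source.mem_nhds hζψ)
    have hq : ContMDiffAt (𝓘(ℝ, E).prod 𝓘(ℝ, F)) 𝓘(ℝ, X) ∞
        (fun b => L.symm (τ (η b), ψ (ζ b))) (g, n) := by
      refine ContMDiffAt.comp (g, n) (g := L.symm) (f := fun b => (τ (η b), ψ (ζ b)))
        L.symm.contDiff.contMDiff.contMDiffAt (ContMDiffAt.prodMk_space ?_ ?_)
      · exact ContMDiffAt.comp (g, n) (g := τ) (f := η)
          (hτ.contMDiffAt (by rw [hηb]; exact hW.mem_nhds hW1)) hη.contMDiffAt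
      · exact ContMDiffAt.comp (g, n) (g := ψ) (f := ζ) (contMDiffAt_chartAt hζψ) hζ
    have hqb : L.symm (τ (η (g, n)), ψ (ζ (g, n))) = x := by
      rw [hηb, hζb, hτ1, ψ.right_inv hx.2, Prod.mk.eta, L.symm_apply_apply]
    refine ⟨_, hq, hqb, ?_⟩
    have hO : ∀ᶠ b in 𝓝 (g, n), L.symm (τ (η b), ψ (ζ b)) ∈ L ⁻¹' (U ×ˢ ψ.target) :=
      hq.continuousAt.eventually (by
        beta_reduce
        rw [hqb]
        exact ((hU.prod ψ.open_target).preimage L.continuous).mem_nhds hx)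
    filter_upwards [hηW, hζev, hO] with b hbW hbψ hbO
    refine ⟨hbO, ?_⟩
    rw [L.apply_symm_apply]
    refine Eq.trans ?_ (FibredProduct.mk_smul (κ (η b) * k) b)
    refine congrArg (FibredProduct.mk K) (Prod.ext ?_ ?_)
    · have h1 := hWσ _ hbW
      rw [← eq_mul_inv_iff_mul_eq] at h1
      simp only [h1, η]
      simp [mul_assoc]
    · simp only [ψ.left_inv hbψ, ζ, mul_smul]
  · simp [h0U, ψ]
  · simp [hσ0, ψ]

theorem IsLieSubgroup.exists_isQuotientManifold (hKG : IsLieSubgroup E EK K) (π : E →L[ℝ] EK)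
    (hπ : ∀ Y, π (inclE E EK K Y) = Y) :
    ∃ _ : ChartedSpace (FibredModel E EK F) (FibredProduct K N),
      IsQuotientManifold E K F N (FibredModel E EK F) := by
  have : IsTopologicalGroup G := topologicalGroup_of_lieGroup 𝓘(ℝ, E) ∞
  have : ContinuousSMul K N := ContMDiffSMul.continuousSMul (I := 𝓘(ℝ, EK)) (I' := 𝓘(ℝ, F)) ∞
  have hr := LinearMap.finrank_range_add_finrank_ker (π : E →ₗ[ℝ] EK)
  rw [LinearMap.range_eq_top.mpr (fun Y => ⟨_, hπ Y⟩), finrank_top] at hr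
  have hdim : Module.finrank ℝ (FibredModel E EK F) =
      Module.finrank ℝ (LinearMap.ker (π : E →ₗ[ℝ] EK) × F) := by
    rw [finrank_euclideanSpace_fin, Module.finrank_prod]
    omega
  let L : FibredModel E EK F ≃L[ℝ] LinearMap.ker (π : E →ₗ[ℝ] EK) × F :=
    ContinuousLinearEquiv.ofFinrankEq hdim
  obtain ⟨_, h1, h2, h3⟩ := exists_manifold_of_slices FibredProduct.continuous_mk
    FibredProduct.isOpenMap_mk FibredProduct.mk_surjective
    (hKG.exists_isSlice (N := N) π hπ L)
  -- The complement is `EK`, since the fibres are copies of K; surjectivity of the derivative comes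
  -- from the local sections.
  refine ⟨inferInstance, h1, Manifold.IsSubmersionOfComplement.isSubmersion (F := EK) fun a => ?_⟩
  obtain ⟨s, hs, hsa, hps⟩ := h3 a
  refine isSubmersionAtOfComplement_of_surjective h2
    (tderiv_surjective_of_section (h2.mdiff a) hs.mdiff hsa hps) ?_
  rw [hdim, Module.finrank_prod, Module.finrank_prod]
  omega

end FibredProductManifold

/-! ### Alternating 2-forms evaluated on pairs -/

section AlternatingPairs

variable {V W : Type*} [NormedAddCommGroup V] [NormedSpace ℝ V] [NormedAddCommGroup W]
  [NormedSpace ℝ W]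

variable (V) in
/-- Covectors are alternating forms of degree one. -/
def covectorEquiv : (V →L[ℝ] ℝ) ≃L[ℝ] (V [⋀^Fin 1]→L[ℝ] ℝ) :=
  (ContinuousAlternatingMap.ofSubsingletonLIE (0 : Fin 1)).toContinuousLinearEquiv

theorem covectorEquiv_apply (f : V →L[ℝ] ℝ) (v : Fin 1 → V) : covectorEquiv V f v = f (v 0) := rfl

/-- The alternating form `B(v, w) - B(w, v)`. -/
def wedge : (V →L[ℝ] V →L[ℝ] ℝ) →L[ℝ] (V [⋀^Fin 2]→L[ℝ] ℝ) :=
  (ContinuousAlternatingMap.alternatizeUncurryFinCLM ℝ V ℝ).comp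
    (ContinuousLinearMap.compL ℝ V (V →L[ℝ] ℝ) (V [⋀^Fin 1]→L[ℝ] ℝ)
      (covectorEquiv V : (V →L[ℝ] ℝ) →L[ℝ] (V [⋀^Fin 1]→L[ℝ] ℝ)))

theorem wedge_apply (B : V →L[ℝ] V →L[ℝ] ℝ) (v w : V) : wedge B ![v, w] = B v w - B w v := by
  simp [wedge, ContinuousAlternatingMap.alternatizeUncurryFinCLM_apply,
    ContinuousAlternatingMap.alternatizeUncurryFin_apply, Fin.sum_univ_two, Fin.removeNth,
    covectorEquiv_apply, sub_eq_add_neg]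

theorem alt_swap (Ω : V [⋀^Fin 2]→L[ℝ] ℝ) (v w : V) : Ω ![w, v] = - Ω ![v, w] := by
  have := Ω.map_swap ![v, w] (i := 0) (j := 1) (by simp)
  refine Eq.trans (congrArg Ω ?_) this
  ext i
  fin_cases i <;> rfl

theorem alt_add_left (Ω : V [⋀^Fin 2]→L[ℝ] ℝ) (v v' w : V) :
    Ω ![v + v', w] = Ω ![v, w] + Ω ![v', w] := Ω.vecCons_add _ _ _

theorem alt_add_right (Ω : V [⋀^Fin 2]→L[ℝ] ℝ) (v w w' : V) :
    Ω ![v, w + w'] = Ω ![v, w] + Ω ![v, w'] := by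
  rw [alt_swap, alt_add_left, alt_swap Ω v w, alt_swap Ω v w', neg_add, neg_neg, neg_neg]

theorem alt_zero_right (Ω : V [⋀^Fin 2]→L[ℝ] ℝ) (v : V) : Ω ![v, 0] = 0 :=
  Ω.map_coord_zero (1 : Fin 2) rfl

theorem alt_ext {Ω Ω' : V [⋀^Fin 2]→L[ℝ] ℝ} (h : ∀ v w, Ω ![v, w] = Ω' ![v, w]) : Ω = Ω' := by
  ext v
  have : v = ![v 0, v 1] := by
    ext i
    fin_cases i <;> rfl
  rw [this, h]

theorem alt_comp_apply (Ω : W [⋀^Fin 2]→L[ℝ] ℝ) (L : V →L[ℝ] W) (v w : V) :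
    Ω.compContinuousLinearMap L ![v, w] = Ω ![L v, L w] := by
  rw [ContinuousAlternatingMap.compContinuousLinearMap_apply]
  congr 1
  ext i
  fin_cases i <;> rfl

theorem contDiffAt_clm_of_apply [FiniteDimensional ℝ V] {X : Type*} [NormedAddCommGroup X]
    [NormedSpace ℝ X] {f : X → V →L[ℝ] W} {x : X}
    (h : ∀ v, ContDiffAt ℝ ∞ (fun y => f y v) x) : ContDiffAt ℝ ∞ f x := by
  let b := Module.finBasis ℝ V
  have : f = fun y => ∑ i, (b.coord i).toContinuousLinearMap.smulRight (f y (b i)) := by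
    ext y v
    conv_lhs => rw [← b.sum_repr v]
    simp only [map_sum, map_smul, _root_.sum_apply]
    rfl
  rw [this]
  refine ContDiffAt.sum fun i _ => ?_
  exact ((ContinuousLinearMap.smulRightL ℝ V W (b.coord i).toContinuousLinearMap).contDiff.contDiffAt).comp
    x (h (b i))

theorem contDiffAt_alt_of_apply [FiniteDimensional ℝ V] {X : Type*} [NormedAddCommGroup X]
    [NormedSpace ℝ X] {f : X → V [⋀^Fin 2]→L[ℝ] ℝ} {x : X}
    (h : ∀ v w, ContDiffAt ℝ ∞ (fun y => f y ![v, w]) x) : ContDiffAt ℝ ∞ f x := by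
  let B : X → V →L[ℝ] V →L[ℝ] ℝ := fun y =>
    ((covectorEquiv V).symm : (V [⋀^Fin 1]→L[ℝ] ℝ) →L[ℝ] (V →L[ℝ] ℝ)).comp (f y).curryLeft
  have hB : ∀ y v w, B y v w = f y ![v, w] := fun y v w => by
    refine congrArg (f y) ?_
    ext i
    fin_cases i <;> rfl
  -- The factor 1/2 appears because `wedge` of an already alternating bilinear form doubles it.
  have : f = fun y => wedge ((1 / 2 : ℝ) • B y) := by
    ext1 y
    refine alt_ext fun v w => ?_
    rw [wedge_apply]
    simp only [smul_apply, hB, alt_swap (f y) v w, smul_eq_mul]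
    ring
  rw [this]
  have hw : ContDiff ℝ ∞ (fun B : V →L[ℝ] V →L[ℝ] ℝ => wedge B) :=
    ContinuousLinearMap.contDiff (𝕜 := ℝ) (E := V →L[ℝ] V →L[ℝ] ℝ) (F := V [⋀^Fin 2]→L[ℝ] ℝ) wedge
  refine hw.contDiffAt.comp x (ContDiffAt.const_smul _ ?_)
  refine contDiffAt_clm_of_apply fun v => contDiffAt_clm_of_apply fun w => ?_
  simpa only [hB] using h v w

end AlternatingPairs

/-! ### The product rule for a map of two variables -/

section ProductCalculus

variable {E₁ : Type*} [NormedAddCommGroup E₁] [NormedSpace ℝ E₁] {H₁ : Type*} [TopologicalSpace H₁]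
  {I₁ : ModelWithCorners ℝ E₁ H₁} {M₁ : Type*} [TopologicalSpace M₁] [ChartedSpace H₁ M₁]
  {E₂ : Type*} [NormedAddCommGroup E₂] [NormedSpace ℝ E₂] {H₂ : Type*} [TopologicalSpace H₂]
  {I₂ : ModelWithCorners ℝ E₂ H₂} {M₂ : Type*} [TopologicalSpace M₂] [ChartedSpace H₂ M₂]
  {E₃ : Type*} [NormedAddCommGroup E₃] [NormedSpace ℝ E₃] {H₃ : Type*} [TopologicalSpace H₃]
  {I₃ : ModelWithCorners ℝ E₃ H₃} {M₃ : Type*} [TopologicalSpace M₃] [ChartedSpace H₃ M₃]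
  {E₄ : Type*} [NormedAddCommGroup E₄] [NormedSpace ℝ E₄] {H₄ : Type*} [TopologicalSpace H₄]
  {I₄ : ModelWithCorners ℝ E₄ H₄} {M₄ : Type*} [TopologicalSpace M₄] [ChartedSpace H₄ M₄]

theorem tderiv_op₂ {op : M₂ × M₃ → M₄} {a : M₁ → M₂} {b : M₁ → M₃} {y : M₁}
    (hop : MDifferentiableAt (I₂.prod I₃) I₄ op (a y, b y)) (ha : MDifferentiableAt I₁ I₂ a y)
    (hb : MDifferentiableAt I₁ I₃ b y) (u : E₁) :
    tderiv I₁ I₄ (fun z => op (a z, b z)) y u =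
      tderiv I₁ I₄ (fun z => op (a z, b y)) y u + tderiv I₁ I₄ (fun z => op (a y, b z)) y u := by
  have h1 := tderiv_comp_apply (f := fun z => (a z, b z)) hop (ha.prodMk hb) u
  have h2 := tderiv_comp_apply (f := fun z => (a z, b y)) hop
    (ha.prodMk (mdifferentiableAt_const (c := b y))) u
  have h3 := tderiv_comp_apply (f := fun z => (a y, b z)) hop
    ((mdifferentiableAt_const (c := a y)).prodMk hb) u
  rw [tderiv_prodMk ha hb] at h1
  rw [tderiv_prodMk ha mdifferentiableAt_const, tderiv_const] at h2
  rw [tderiv_prodMk mdifferentiableAt_const hb, tderiv_const] at h3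
  rw [h1, h2, h3, ← map_add]
  simp

end ProductCalculus

/-! ### Left trivialization of products and inverses -/

section LieGroupProducts

variable {E : Type*} [NormedAddCommGroup E] [NormedSpace ℝ E]
  {G : Type*} [TopologicalSpace G] [ChartedSpace E G] [Group G] [LieGroup 𝓘(ℝ, E) ∞ G]
  {EM : Type*} [NormedAddCommGroup EM] [NormedSpace ℝ EM] {HM : Type*} [TopologicalSpace HM]
  {I : ModelWithCorners ℝ EM HM} {M : Type*} [TopologicalSpace M] [ChartedSpace HM M]

theorem mdiff_lmul (g x : G) : MDifferentiableAt 𝓘(ℝ, E) 𝓘(ℝ, E) (fun x : G => g * x) x :=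
  ((contMDiff_const.mul contMDiff_id : ContMDiff 𝓘(ℝ, E) 𝓘(ℝ, E) ∞ fun x : G => g * x)).mdiff x

theorem mdiff_rmul (g x : G) : MDifferentiableAt 𝓘(ℝ, E) 𝓘(ℝ, E) (fun x : G => x * g) x :=
  ((contMDiff_id.mul contMDiff_const : ContMDiff 𝓘(ℝ, E) 𝓘(ℝ, E) ∞ fun x : G => x * g)).mdiff x

variable (E) in
/-- The derivative at the identity of left translation by `g`. -/
def leftTrans (g : G) : E →L[ℝ] E := tderiv 𝓘(ℝ, E) 𝓘(ℝ, E) (fun x : G => g * x) 1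

theorem leftTriv_tderiv_mul_left (h g : G) (A : E) :
    leftTriv E (h * g) (tderiv 𝓘(ℝ, E) 𝓘(ℝ, E) (fun x : G => h * x) g A) = leftTriv E g A := by
  have := tderiv_comp_apply (g := fun x : G => (h * g)⁻¹ * x) (f := fun x : G => h * x) (x := g)
    (mdiff_lmul (E := E) _ _) (mdiff_lmul (E := E) _ _) A
  refine this.symm.trans ?_
  unfold leftTriv
  congr 2
  ext x
  group

theorem leftTriv_leftTrans (g : G) (X : E) : leftTriv E g (leftTrans E g X) = X := by
  have := leftTriv_tderiv_mul_left g 1 X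
  rwa [mul_one, leftTriv_one] at this

theorem leftTrans_leftTriv (g : G) (A : E) : leftTrans E g (leftTriv E g A) = A := by
  have h0 : MDifferentiableAt 𝓘(ℝ, E) 𝓘(ℝ, E) (fun x : G => g * x) (g⁻¹ * g) := mdiff_lmul _ _
  have := tderiv_comp_apply h0 (mdiff_lmul (E := E) g⁻¹ g) A
  rw [inv_mul_cancel] at this
  refine this.symm.trans ?_
  simp only [mul_inv_cancel_left]
  rw [tderiv_id]
  rfl

theorem leftTriv_tderiv_mul_right (g : G) (Z : E) :
    leftTriv E g (tderiv 𝓘(ℝ, E) 𝓘(ℝ, E) (fun x : G => x * g) 1 Z) = Ad E g⁻¹ Z := by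
  have h0 : MDifferentiableAt 𝓘(ℝ, E) 𝓘(ℝ, E) (fun x : G => g⁻¹ * x) (1 * g) := mdiff_lmul _ _
  have := tderiv_comp_apply (f := fun x : G => x * g) h0 (mdiff_rmul (E := E) g 1) Z
  rw [one_mul] at this
  refine this.symm.trans ?_
  unfold Ad
  simp only [inv_inv, mul_assoc]

theorem tderiv_mul_of_eq_one {a b : M → G} {y : M} (ha : MDifferentiableAt I 𝓘(ℝ, E) a y)
    (hb : MDifferentiableAt I 𝓘(ℝ, E) b y) (ha1 : a y = 1) (hb1 : b y = 1) (u : EM) :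
    tderiv I 𝓘(ℝ, E) (fun z => a z * b z) y u =
      tderiv I 𝓘(ℝ, E) a y u + tderiv I 𝓘(ℝ, E) b y u := by
  have := tderiv_op₂ (op := fun p : G × G => p.1 * p.2) (I₄ := 𝓘(ℝ, E))
    ((contMDiff_mul 𝓘(ℝ, E) ∞).mdiff _) ha hb u
  simpa only [ha1, hb1, one_mul, mul_one] using this

/-- Put f = f(y) a and k = k(y) b, with a and b equal to 1 at y. The left translate of f k⁻¹ to the
identity is then k(y) a b⁻¹ k(y)⁻¹, and the derivative of a b⁻¹ at y is the difference of those of a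
and b. -/
theorem leftTriv_tderiv_mul_inv {f k : M → G} {y : M} (hf : ContMDiffAt I 𝓘(ℝ, E) ∞ f y)
    (hk : ContMDiffAt I 𝓘(ℝ, E) ∞ k y) (u : EM) :
    leftTriv E (f y * (k y)⁻¹) (tderiv I 𝓘(ℝ, E) (fun z => f z * (k z)⁻¹) y u) =
      Ad E (k y) (leftTriv E (f y) (tderiv I 𝓘(ℝ, E) f y u) -
        leftTriv E (k y) (tderiv I 𝓘(ℝ, E) k y u)) := by
  have hfk : ContMDiffAt I 𝓘(ℝ, E) ∞ (fun z => f z * (k z)⁻¹) y := hf.mul hk.inv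
  have e1 := DFunLike.congr_fun (tderiv_inv_mul hfk.mdiff) u
  have e2 := DFunLike.congr_fun (tderiv_inv_mul hf.mdiff) u
  have e3 := DFunLike.congr_fun (tderiv_inv_mul hk.mdiff) u
  simp only [ContinuousLinearMap.comp_apply] at e1 e2 e3
  rw [← e1, ← e2, ← e3]
  let a : M → G := fun z => (f y)⁻¹ * f z
  let b : M → G := fun z => (k y)⁻¹ * k z
  have ha : ContMDiffAt I 𝓘(ℝ, E) ∞ a y := contMDiffAt_const.mul hf
  have hb : ContMDiffAt I 𝓘(ℝ, E) ∞ b y := contMDiffAt_const.mul hk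
  have hab : ContMDiffAt I 𝓘(ℝ, E) ∞ (fun z => a z * (b z)⁻¹) y := ha.mul hb.inv
  have hy1 : a y * (b y)⁻¹ = 1 := by simp [a, b]
  have e4 := tderiv_mul_of_eq_one hab.mdiff hb.mdiff hy1 (by simp [b]) u
  simp only [inv_mul_cancel_right] at e4
  have e5 : MDifferentiableAt 𝓘(ℝ, E) 𝓘(ℝ, E) (fun x : G => k y * x * (k y)⁻¹) (a y * (b y)⁻¹) :=
    (contMDiff_conj _).mdiff _
  have e6 := tderiv_comp_apply (f := fun z => a z * (b z)⁻¹) e5 hab.mdiff u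
  rw [hy1] at e6
  rw [show tderiv I 𝓘(ℝ, E) a y u - tderiv I 𝓘(ℝ, E) b y u =
    tderiv I 𝓘(ℝ, E) (fun z => a z * (b z)⁻¹) y u from sub_eq_of_eq_add e4]
  refine Eq.trans ?_ e6
  congr 2
  ext z
  simp only [a, b]
  group

-- At the identity this follows by differentiating Ad(g) Ad(g⁻¹) Y = Y. A general point g reduces to
-- it through Ad(x⁻¹) = Ad((g⁻¹ x)⁻¹) Ad(g⁻¹).
variable [CompleteSpace E] in
theorem tderiv_Ad_inv_apply (g : G) (Z A : E) :
    tderiv 𝓘(ℝ, E) 𝓘(ℝ, E) (fun g : G => Ad E g⁻¹ Z) g A =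
      - lieBr E G (leftTriv E g A) (Ad E g⁻¹ Z) := by
  have hinv : ContMDiff 𝓘(ℝ, E) 𝓘(ℝ, E →L[ℝ] E) ∞ (fun g : G => Ad E g⁻¹) :=
    contMDiff_Ad.comp (contMDiff_inv 𝓘(ℝ, E) ∞)
  have hY : ∀ Y : E, ∀ B : E, tderiv 𝓘(ℝ, E) 𝓘(ℝ, E) (fun g : G => Ad E g⁻¹ Y) 1 B =
      - lieBr E G B Y := by
    intro Y B
    have e1 := tderiv_bilin (ContinuousLinearMap.id ℝ (E →L[ℝ] E)) (f := fun g : G => Ad E g)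
      (g := fun g : G => Ad E g⁻¹ Y) (x := 1) (contMDiff_Ad.mdiff 1)
      ((hinv.clm_apply contMDiff_const).mdiff 1) B
    simp only [ContinuousLinearMap.id_apply, Ad_apply_Ad_inv, tderiv_const, inv_one, Ad_one,
      tderiv_Ad_one] at e1
    exact eq_neg_of_add_eq_zero_right e1.symm
  have h0 : MDifferentiableAt 𝓘(ℝ, E) 𝓘(ℝ, E) (fun h : G => Ad E h⁻¹ (Ad E g⁻¹ Z)) (g⁻¹ * g) :=
    (hinv.clm_apply contMDiff_const).mdiff _
  have e2 := tderiv_comp_apply (f := fun x : G => g⁻¹ * x) h0 (mdiff_lmul (E := E) g⁻¹ g) A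
  rw [inv_mul_cancel, hY] at e2
  refine Eq.trans ?_ e2
  congr 2
  ext x
  rw [← Ad_mul_apply, mul_inv_rev, inv_inv, mul_assoc, mul_inv_cancel, mul_one]

end LieGroupProducts

/-! ### Differentiating a smooth group action -/

section Actions

variable {E : Type*} [NormedAddCommGroup E] [NormedSpace ℝ E]
  {G : Type*} [TopologicalSpace G] [ChartedSpace E G] [Group G] [LieGroup 𝓘(ℝ, E) ∞ G]
  {F : Type*} [NormedAddCommGroup F] [NormedSpace ℝ F]
  {N : Type*} [TopologicalSpace N] [ChartedSpace F N] [MulAction G N]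
  [ContMDiffSMul 𝓘(ℝ, E) 𝓘(ℝ, F) ∞ G N]
  {EM : Type*} [NormedAddCommGroup EM] [NormedSpace ℝ EM] {HM : Type*} [TopologicalSpace HM]
  {I : ModelWithCorners ℝ EM HM} {M : Type*} [TopologicalSpace M] [ChartedSpace HM M]

variable (E G F) in
/-- The vector fields generated by a Lie group action, on the model spaces. -/
def orbitDeriv (n : N) : E →L[ℝ] F := tderiv 𝓘(ℝ, E) 𝓘(ℝ, F) (fun h : G => h • n) 1

theorem contMDiff_smul_const (_ : ContMDiffSMul 𝓘(ℝ, E) 𝓘(ℝ, F) ∞ G N) (k : G) :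
    ContMDiff 𝓘(ℝ, F) 𝓘(ℝ, F) ∞ (fun n : N => k • n) :=
  ContMDiff.smul (I := 𝓘(ℝ, E)) contMDiff_const contMDiff_id

theorem contMDiff_orbit (n : N) : ContMDiff 𝓘(ℝ, E) 𝓘(ℝ, F) ∞ (fun k : G => k • n) :=
  ContMDiff.smul (I := 𝓘(ℝ, E)) contMDiff_id contMDiff_const

/-- Product rule, with k(z) written as k(y) times a map through 1 so that the variation of the group
element becomes a generating vector field of the action at f(y). -/
theorem tderiv_smul {k : M → G} {f : M → N} {y : M} (hk : ContMDiffAt I 𝓘(ℝ, E) ∞ k y)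
    (hf : ContMDiffAt I 𝓘(ℝ, F) ∞ f y) (u : EM) :
    tderiv I 𝓘(ℝ, F) (fun z => k z • f z) y u =
      tderiv 𝓘(ℝ, F) 𝓘(ℝ, F) (fun n : N => k y • n) (f y) (tderiv I 𝓘(ℝ, F) f y u +
        orbitDeriv E G F (f y) (leftTriv E (k y) (tderiv I 𝓘(ℝ, E) k y u))) := by
  have e1 := tderiv_op₂ (op := fun p : G × N => p.1 • p.2) (I₄ := 𝓘(ℝ, F))
    ((contMDiff_smul (I := 𝓘(ℝ, E)) (I' := 𝓘(ℝ, F)) (n := ∞)).mdiff _) hk.mdiff hf.mdiff u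
  have e2 := tderiv_comp_apply (g := fun n : N => k y • n) (f := f)
    ((contMDiff_smul_const (E := E) (F := F) inferInstance (k y)).mdiff _) hf.mdiff u
  have e3 : tderiv I 𝓘(ℝ, F) (fun z => k z • f y) y u =
      tderiv 𝓘(ℝ, F) 𝓘(ℝ, F) (fun n : N => k y • n) (f y)
        (orbitDeriv E G F (f y) (leftTriv E (k y) (tderiv I 𝓘(ℝ, E) k y u))) := by
    have h1 : ContMDiffAt I 𝓘(ℝ, E) ∞ (fun z => (k y)⁻¹ * k z) y := contMDiffAt_const.mul hk
    have e4 := DFunLike.congr_fun (tderiv_inv_mul hk.mdiff) u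
    rw [ContinuousLinearMap.comp_apply] at e4
    rw [← e4]
    have h2 : MDifferentiableAt 𝓘(ℝ, E) 𝓘(ℝ, F) (fun h : G => h • f y) ((k y)⁻¹ * k y) :=
      (contMDiff_orbit (F := F) (f y)).mdiff _
    have e5 := tderiv_comp_apply (f := fun z => (k y)⁻¹ * k z) h2 h1.mdiff u
    rw [inv_mul_cancel] at e5
    have h3 : ContMDiffAt I 𝓘(ℝ, F) ∞ (fun z => ((k y)⁻¹ * k z) • f y) y :=
      ContMDiffAt.comp y ((contMDiff_orbit (E := E) (F := F) (f y)) _) h1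
    have e6 := tderiv_comp_apply (g := fun n : N => k y • n) (f := fun z => ((k y)⁻¹ * k z) • f y)
      ((contMDiff_smul_const (E := E) (F := F) inferInstance (k y)).mdiff _) h3.mdiff u
    simp only [mul_smul, smul_inv_smul, inv_smul_smul] at e5 e6
    exact e6.trans (congrArg (tderiv 𝓘(ℝ, F) 𝓘(ℝ, F) (fun n : N => k y • n) (f y)) e5)
  rw [e1, e2, e3, add_comm, map_add]

end Actions

/-! ### Smooth maps into a Lie subgroup -/

section SubgroupMaps

variable {E : Type*} [NormedAddCommGroup E] [NormedSpace ℝ E] [FiniteDimensional ℝ E]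
  [CompleteSpace E]
  {G : Type*} [TopologicalSpace G] [ChartedSpace E G] [Group G] [LieGroup 𝓘(ℝ, E) ∞ G]
  {EK : Type*} [NormedAddCommGroup EK] [NormedSpace ℝ EK] [FiniteDimensional ℝ EK]
  [CompleteSpace EK]
  {K : Subgroup G} [ChartedSpace EK K] [LieGroup 𝓘(ℝ, EK) ∞ K]
  {EM : Type*} [NormedAddCommGroup EM] [NormedSpace ℝ EM] {HM : Type*} [TopologicalSpace HM]
  {I : ModelWithCorners ℝ EM HM} {M : Type*} [TopologicalSpace M] [ChartedSpace HM M]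

/-- A map into an embedded Lie subgroup is smooth if it is smooth as a map into the group. -/
theorem IsLieSubgroup.contMDiffAt_of_val (hKG : IsLieSubgroup E EK K) (π : E →L[ℝ] EK)
    (hπ : ∀ X, π (inclE E EK K X) = X) {f : M → K} {y : M}
    (hf : ContMDiffAt I 𝓘(ℝ, E) ∞ (fun z => (f z : G)) y) : ContMDiffAt I 𝓘(ℝ, EK) ∞ f y := by
  obtain ⟨σ, U, τ, κ, W, hU, h0U, hσ0, -, hW, hτ, hκ, hUW, hWσ, hinj⟩ := hKG.exists_slice π hπ
  obtain ⟨hW1, hτ1, -⟩ := hUW 0 h0U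
  rw [hσ0] at hW1 hτ1
  have hg : ContMDiffAt I 𝓘(ℝ, E) ∞ (fun z => (f y : G)⁻¹ * (f z : G)) y := contMDiffAt_const.mul hf
  have hgy : (f y : G)⁻¹ * (f y : G) = 1 := inv_mul_cancel _
  have hκg : ContMDiffAt I 𝓘(ℝ, EK) ∞ (fun z => κ ((f y : G)⁻¹ * (f z : G))) y :=
    ContMDiffAt.comp y (g := κ) (f := fun z => (f y : G)⁻¹ * (f z : G))
      (hκ.contMDiffAt (by rw [hgy]; exact hW.mem_nhds hW1)) hg
  have hmul : ContMDiffAt I 𝓘(ℝ, EK) ∞ (fun z => f y * κ ((f y : G)⁻¹ * (f z : G))) y :=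
    contMDiffAt_const.mul hκg
  refine hmul.congr_of_eventuallyEq ?_
  have h1 : ∀ᶠ z in 𝓝 y, (f y : G)⁻¹ * (f z : G) ∈ W :=
    hg.continuousAt.eventually (by beta_reduce; rw [hgy]; exact hW.mem_nhds hW1)
  have h2 : ∀ᶠ z in 𝓝 y, τ ((f y : G)⁻¹ * (f z : G)) ∈ U := by
    have : ContinuousAt (fun z => τ ((f y : G)⁻¹ * (f z : G))) y :=
      ContinuousAt.comp (g := τ) (f := fun z => (f y : G)⁻¹ * (f z : G))
        (hτ.contMDiffAt (by rw [hgy]; exact hW.mem_nhds hW1)).continuousAt hg.continuousAt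
    exact this.eventually (by beta_reduce; rw [hgy, hτ1]; exact hU.mem_nhds h0U)
  filter_upwards [h1, h2] with z hz1 hz2
  have h3 := hWσ _ hz1
  -- The slice decomposition of f(y)⁻¹ f(z), an element of K, must have trivial slice part by
  -- uniqueness. Hence f(z) = f(y) κ', and κ' is smooth in z.
  set κ' := κ ((f y : G)⁻¹ * (f z : G))
  have h4 := (hinj _ hz2 0 h0U ((f y)⁻¹ * f z * κ'⁻¹) (by
    rw [hσ0, one_mul]
    push_cast
    rw [eq_mul_inv_iff_mul_eq, h3])).2
  rw [mul_inv_eq_one] at h4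
  rw [← h4, mul_inv_cancel_left]

theorem leftTriv_val (hKG : IsLieSubgroup E EK K) {k : M → K} {y : M}
    (hk : ContMDiffAt I 𝓘(ℝ, EK) ∞ k y) (u : EM) :
    leftTriv E (k y : G) (tderiv I 𝓘(ℝ, E) (fun z => (k z : G)) y u) =
      inclE E EK K (leftTriv EK (k y) (tderiv I 𝓘(ℝ, EK) k y u)) := by
  have hval := hKG.contMDiff_val
  have hkv : ContMDiffAt I 𝓘(ℝ, E) ∞ (fun z => (k z : G)) y := ContMDiffAt.comp y (hval _) hk
  have e1 := DFunLike.congr_fun (tderiv_inv_mul hkv.mdiff) u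
  have e2 := DFunLike.congr_fun (tderiv_inv_mul hk.mdiff) u
  simp only [ContinuousLinearMap.comp_apply] at e1 e2
  rw [← e1, ← e2]
  have h1 : ContMDiffAt I 𝓘(ℝ, EK) ∞ (fun z => (k y)⁻¹ * k z) y := contMDiffAt_const.mul hk
  have h0 : MDifferentiableAt 𝓘(ℝ, EK) 𝓘(ℝ, E) (Subtype.val : K → G) ((k y)⁻¹ * k y) := hval.mdiff _
  have e3 := tderiv_comp_apply (f := fun z => (k y)⁻¹ * k z) h0 h1.mdiff u
  rw [inv_mul_cancel] at e3
  exact e3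

end SubgroupMaps

/-! ### The form in left trivialization: invariance and vertical directions -/

section BaseForm

variable {E : Type*} [NormedAddCommGroup E] [NormedSpace ℝ E] [FiniteDimensional ℝ E]
  [CompleteSpace E]
  {G : Type*} [TopologicalSpace G] [ChartedSpace E G] [Group G] [LieGroup 𝓘(ℝ, E) ∞ G]
  {EK : Type*} [NormedAddCommGroup EK] [NormedSpace ℝ EK] [FiniteDimensional ℝ EK]
  [CompleteSpace EK]
  {K : Subgroup G} [ChartedSpace EK K] [LieGroup 𝓘(ℝ, EK) ∞ K]
  {F : Type*} [NormedAddCommGroup F] [NormedSpace ℝ F]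
  {N : Type*} [TopologicalSpace N] [ChartedSpace F N] [MulAction K N]

/-- An `Ad`-equivariant projection of the Lie algebra of `G` onto that of `K`. -/
structure IsEquivariantProjection (K : Subgroup G) [ChartedSpace EK K] (π : E →L[ℝ] EK) :
    Prop where
  retract : ∀ X, π (inclE E EK K X) = X
  map_Ad : ∀ (k : K) (Z : E), π (Ad E (k : G) Z) = Ad EK k (π Z)

/-- The values of a 2-form, on the model space. -/
def TwoForm.onModel (ν : TwoForm F N) (n : N) : F [⋀^Fin 2]→L[ℝ] ℝ := ν n

/-- The extension of the momentum map to `𝔤` by means of the projection `π`. -/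
def comoment (π : E →L[ℝ] EK) (Φ : N → Module.Dual ℝ (LieAlg EK K)) (n : N) : E →L[ℝ] ℝ :=
  (LinearMap.toContinuousLinearMap (E := EK) (Φ n) : EK →L[ℝ] ℝ).comp π

variable {ν : TwoForm F N} {Φ : N → Module.Dual ℝ (LieAlg EK K)} {π : E →L[ℝ] EK}

theorem comoment_apply (n : N) (Z : E) : comoment π Φ n Z = Φ n (π Z) := rfl

theorem contMDiff_comoment (hN : IsHamiltonianAction ν Φ) :
    ContMDiff 𝓘(ℝ, F) 𝓘(ℝ, E →L[ℝ] ℝ) ∞ (comoment π Φ) := by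
  let b := Module.finBasis ℝ EK
  let L : (Fin (Module.finrank ℝ EK) → ℝ) →L[ℝ] (E →L[ℝ] ℝ) := LinearMap.toContinuousLinearMap
    (Fintype.linearCombination ℝ (fun i => ((b.coord i).toContinuousLinearMap.comp π)))
  have h1 : ContMDiff 𝓘(ℝ, F) 𝓘(ℝ, Fin (Module.finrank ℝ EK) → ℝ) ∞ (fun n i => Φ n (b i)) :=
    contMDiff_pi_space.mpr fun i => hN.momentum.smooth (b i)
  have h2 : comoment π Φ = fun n => L (fun i => Φ n (b i)) := by
    ext n Z
    rw [comoment_apply]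
    refine (congrArg (Φ n) (b.sum_repr (π Z)).symm).trans ?_
    simp only [L, LinearMap.coe_toContinuousLinearMap', Fintype.linearCombination_apply,
      _root_.sum_apply, smul_apply, ContinuousLinearMap.comp_apply]
    refine (map_sum (Φ n) (fun i => (b.repr (π Z) i • b i : EK)) Finset.univ).trans ?_
    refine Finset.sum_congr rfl fun i _ => ?_
    refine ((Φ n).map_smul (b.repr (π Z) i) (b i)).trans ?_
    rw [smul_eq_mul, smul_eq_mul, mul_comm]
    rfl
  rw [h2]
  exact L.contDiff.contMDiff.comp h1

theorem comoment_smul (hN : IsHamiltonianAction ν Φ) (hπ : IsEquivariantProjection K π) (k : K)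
    (n : N) (Z : E) : comoment π Φ (k • n) (Ad E (k : G) Z) = comoment π Φ n Z := by
  rw [comoment_apply, comoment_apply, hπ.map_Ad, hN.momentum.equivariant]
  exact congrArg (Φ n) (Ad_inv_apply_Ad (E := EK) k (π Z))

variable (π Φ) in
/-- The derivative of the extended momentum map. -/
def comomentDeriv (n : N) : F →L[ℝ] E →L[ℝ] ℝ :=
  tderiv 𝓘(ℝ, F) 𝓘(ℝ, E →L[ℝ] ℝ) (comoment π Φ) n

theorem tderiv_comoment_apply (hN : IsHamiltonianAction ν Φ) (n : N) (v : F) (Z : E) :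
    tderiv 𝓘(ℝ, F) 𝓘(ℝ, ℝ) (fun m => comoment π Φ m Z) n v = comomentDeriv Φ π n v Z :=
  tderiv_clm_comp (ContinuousLinearMap.apply ℝ ℝ Z) ((contMDiff_comoment hN).mdiff n) v

theorem comomentDeriv_smul (hN : IsHamiltonianAction ν Φ) (hπ : IsEquivariantProjection K π)
    (k : K) (n : N) (v : F) (Z : E) :
    comomentDeriv Φ π (k • n) (tderiv 𝓘(ℝ, F) 𝓘(ℝ, F) (fun m : N => k • m) n v) (Ad E (k : G) Z) =
      comomentDeriv Φ π n v Z := by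
  have := hN.smooth_action
  have h1 : MDifferentiableAt 𝓘(ℝ, F) 𝓘(ℝ, ℝ) (fun m => comoment π Φ m (Ad E (k : G) Z)) (k • n) :=
    ((contMDiff_comoment hN).clm_apply contMDiff_const).mdiff _
  have e := tderiv_comp_apply (f := fun m : N => k • m) h1
    ((contMDiff_smul_const hN.smooth_action k).mdiff n) v
  rw [tderiv_comoment_apply hN] at e
  rw [← e, ← tderiv_comoment_apply hN]
  simp only [comoment_smul hN hπ]

/-- The momentum equation for the K-action, with z viewed in 𝔤 and recovered by π. -/
theorem onModel_orbitDeriv (hN : IsHamiltonianAction ν Φ) (hπ : IsEquivariantProjection K π)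
    (n : N) (v : F) (z : EK) :
    ν.onModel n ![v, orbitDeriv EK K F n z] = comomentDeriv Φ π n v (inclE E EK K z) := by
  refine (hN.momentum.hamilton z n v).trans ?_
  rw [← tderiv_comoment_apply hN]
  simp only [comoment_apply, hπ.retract]
  rfl

/-- Infinitesimal form of the equivariance of Φ: differentiate ⟨Φ(k n), πZ⟩ = ⟨Φ(n), π Ad(k⁻¹)Z⟩ at
k = 1. -/
theorem comomentDeriv_orbitDeriv (hN : IsHamiltonianAction ν Φ) (hπ : IsEquivariantProjection K π)
    (hKG : IsLieSubgroup E EK K) (n : N) (z : EK) (Z : E) :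
    comomentDeriv Φ π n (orbitDeriv EK K F n z) Z =
      - comoment π Φ n (lieBr E G (inclE E EK K z) Z) := by
  have := hN.smooth_action
  have h1 : MDifferentiableAt 𝓘(ℝ, F) 𝓘(ℝ, ℝ) (fun m => comoment π Φ m Z) ((1 : K) • n) :=
    ((contMDiff_comoment hN).clm_apply contMDiff_const).mdiff _
  have e1 := tderiv_comp_apply (f := fun k : K => k • n) h1
    ((contMDiff_orbit (E := EK) (F := F) n).mdiff 1) z
  rw [one_smul, tderiv_comoment_apply hN] at e1
  refine e1.symm.trans ?_
  have e2 : (fun k : K => comoment π Φ (k • n) Z) =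
      fun k : K => comoment π Φ n (Ad E (k : G)⁻¹ Z) := by
    ext k
    rw [← comoment_smul hN hπ k n, Ad_apply_Ad_inv]
  rw [e2]
  have hinv : ContMDiff 𝓘(ℝ, E) 𝓘(ℝ, E →L[ℝ] E) ∞ (fun g : G => Ad E g⁻¹) :=
    contMDiff_Ad.comp (contMDiff_inv 𝓘(ℝ, E) ∞)
  have h3 : ContMDiff 𝓘(ℝ, E) 𝓘(ℝ, E) ∞ (fun g : G => Ad E g⁻¹ Z) := hinv.clm_apply contMDiff_const
  have h4 : ContMDiff 𝓘(ℝ, EK) 𝓘(ℝ, E) ∞ (fun k : K => Ad E (k : G)⁻¹ Z) :=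
    h3.comp hKG.contMDiff_val
  rw [tderiv_clm_comp (comoment π Φ n) (h4.mdiff 1), ← map_neg]
  refine congrArg _ ?_
  have e3 := tderiv_comp_apply (g := fun g : G => Ad E g⁻¹ Z) (f := (Subtype.val : K → G)) (x := 1)
    (h3.mdiff _) (hKG.contMDiff_val.mdiff 1) z
  refine e3.trans ?_
  rw [OneMemClass.coe_one, tderiv_Ad_inv_apply, leftTriv_one, inv_one, Ad_one]
  rfl

variable (ν Φ π) in
/-- The induced form on `G × N`, in a left trivialization. -/
def baseForm (n : N) : (E × F) [⋀^Fin 2]→L[ℝ] ℝ :=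
  (ν.onModel n).compContinuousLinearMap (ContinuousLinearMap.snd ℝ E F) +
    wedge (((ContinuousLinearMap.compL ℝ (E × F) E ℝ).flip (ContinuousLinearMap.fst ℝ E F)).comp
      ((comomentDeriv Φ π n).comp (ContinuousLinearMap.snd ℝ E F) -
        -- The bracket is already skew, so `wedge` would count this term twice; the terms with dΦ
        -- are not, and need no factor.
        (1 / 2 : ℝ) • (((ContinuousLinearMap.compL ℝ E E ℝ (comoment π Φ n)).comp
          (lieBr E G)).comp (ContinuousLinearMap.fst ℝ E F))))

theorem lieBr_skew (X Y : E) : lieBr E G Y X = - lieBr E G X Y := by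
  simp [lieBr]

theorem baseForm_apply (n : N) (X Y : E) (v w : F) :
    baseForm ν Φ π n ![(X, v), (Y, w)] =
      ν.onModel n ![v, w] + comomentDeriv Φ π n v Y - comomentDeriv Φ π n w X -
        comoment π Φ n (lieBr E G X Y) := by
  have h : ∀ (A B : (E × F) [⋀^Fin 2]→L[ℝ] ℝ) (m : Fin 2 → E × F), (A + B) m = A m + B m :=
    fun _ _ _ => rfl
  rw [baseForm, h, wedge_apply, alt_comp_apply]
  simp only [ContinuousLinearMap.comp_apply, ContinuousLinearMap.flip_apply,
    ContinuousLinearMap.compL_apply, sub_apply, smul_apply, ContinuousLinearMap.coe_fst',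
    ContinuousLinearMap.coe_snd', smul_eq_mul, lieBr_skew X Y, map_neg]
  ring

theorem baseForm_smul (hN : IsHamiltonianAction ν Φ) (hπ : IsEquivariantProjection K π)
    (k : K) (n : N) (X Y : E) (v w : F) :
    baseForm ν Φ π (k • n)
      ![(Ad E (k : G) X, tderiv 𝓘(ℝ, F) 𝓘(ℝ, F) (fun m : N => k • m) n v),
        (Ad E (k : G) Y, tderiv 𝓘(ℝ, F) 𝓘(ℝ, F) (fun m : N => k • m) n w)] =
      baseForm ν Φ π n ![(X, v), (Y, w)] := by
  rw [baseForm_apply, baseForm_apply, comomentDeriv_smul hN hπ, comomentDeriv_smul hN hπ,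
    ← Ad_lieBr, comoment_smul hN hπ]
  congr 3
  exact hN.invariant k n v w

/-- The four terms cancel in pairs: ν(z_N, w) against the dΦ(w) term by the momentum equation, and
dΦ(z_N) against the bracket term by infinitesimal equivariance. -/
theorem baseForm_vertical (hN : IsHamiltonianAction ν Φ) (hπ : IsEquivariantProjection K π)
    (hKG : IsLieSubgroup E EK K) (n : N) (z : EK) (Y : E) (w : F) :
    baseForm ν Φ π n ![(- inclE E EK K z, orbitDeriv EK K F n z), (Y, w)] = 0 := by
  rw [baseForm_apply, alt_swap, onModel_orbitDeriv hN hπ, comomentDeriv_orbitDeriv hN hπ hKG]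
  simp

theorem baseForm_add_vertical (hN : IsHamiltonianAction ν Φ) (hπ : IsEquivariantProjection K π)
    (hKG : IsLieSubgroup E EK K) (n : N) (z y : EK) (X Y : E) (v w : F) :
    baseForm ν Φ π n ![(X - inclE E EK K z, v + orbitDeriv EK K F n z),
      (Y - inclE E EK K y, w + orbitDeriv EK K F n y)] = baseForm ν Φ π n ![(X, v), (Y, w)] := by
  have h : ∀ (X : E) (v : F) (z : EK), (X - inclE E EK K z, v + orbitDeriv EK K F n z) =
      (X, v) + (- inclE E EK K z, orbitDeriv EK K F n z) := fun X v z => by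
    rw [Prod.mk_add_mk, sub_eq_add_neg]
  rw [h, alt_add_left, baseForm_vertical hN hπ hKG, add_zero, h, alt_add_right,
    alt_swap _ (- inclE E EK K y, orbitDeriv EK K F n y), baseForm_vertical hN hπ hKG, neg_zero,
    add_zero]

end BaseForm

/-! ### The form on G × N and its independence of lifts -/

section LiftForm

variable {E : Type*} [NormedAddCommGroup E] [NormedSpace ℝ E] [FiniteDimensional ℝ E]
  [CompleteSpace E]
  {G : Type*} [TopologicalSpace G] [ChartedSpace E G] [Group G] [LieGroup 𝓘(ℝ, E) ∞ G]
  {EK : Type*} [NormedAddCommGroup EK] [NormedSpace ℝ EK] [FiniteDimensional ℝ EK]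
  [CompleteSpace EK]
  {K : Subgroup G} [ChartedSpace EK K] [LieGroup 𝓘(ℝ, EK) ∞ K]
  {F : Type*} [NormedAddCommGroup F] [NormedSpace ℝ F]
  {N : Type*} [TopologicalSpace N] [ChartedSpace F N] [MulAction K N]
  {EM : Type*} [NormedAddCommGroup EM] [NormedSpace ℝ EM] {HM : Type*} [TopologicalSpace HM]
  {I : ModelWithCorners ℝ EM HM} {M : Type*} [TopologicalSpace M] [ChartedSpace HM M]

variable {ν : TwoForm F N} {Φ : N → Module.Dual ℝ (LieAlg EK K)} {π : E →L[ℝ] EK}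

variable (ν Φ π) in
/-- The induced form on `G × N`. -/
def liftForm (a : G × N) : (E × F) [⋀^Fin 2]→L[ℝ] ℝ :=
  (baseForm ν Φ π a.2).compContinuousLinearMap
    ((leftTriv E a.1).prodMap (ContinuousLinearMap.id ℝ F))

theorem liftForm_apply (a : G × N) (A B : E) (v w : F) :
    liftForm ν Φ π a ![(A, v), (B, w)] =
      baseForm ν Φ π a.2 ![(leftTriv E a.1 A, v), (leftTriv E a.1 B, w)] :=
  alt_comp_apply _ _ _ _

theorem tderiv_prod_apply {f : M → G × N} {y : M}
    (hf : ContMDiffAt I (𝓘(ℝ, E).prod 𝓘(ℝ, F)) ∞ f y) (u : EM) :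
    tderiv I (𝓘(ℝ, E).prod 𝓘(ℝ, F)) f y u =
      (tderiv I 𝓘(ℝ, E) (fun z => (f z).1) y u, tderiv I 𝓘(ℝ, F) (fun z => (f z).2) y u) :=
  DFunLike.congr_fun (tderiv_prodMk (f := fun z => (f z).1) (g := fun z => (f z).2) hf.fst.mdiff
    hf.snd.mdiff) u

/-- Two lifts of the same map to `G × N` give the same pullback of the form. -/
theorem liftForm_tderiv_eq (hN : IsHamiltonianAction ν Φ) (hπ : IsEquivariantProjection K π)
    (hKG : IsLieSubgroup E EK K) {f f' : M → G × N} {y : M}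
    (hf : ContMDiffAt I (𝓘(ℝ, E).prod 𝓘(ℝ, F)) ∞ f y)
    (hf' : ContMDiffAt I (𝓘(ℝ, E).prod 𝓘(ℝ, F)) ∞ f' y)
    (h : ∀ᶠ z in 𝓝 y, FibredProduct.mk K (f z) = FibredProduct.mk K (f' z)) (u u' : EM) :
    liftForm ν Φ π (f' y) ![tderiv I (𝓘(ℝ, E).prod 𝓘(ℝ, F)) f' y u,
      tderiv I (𝓘(ℝ, E).prod 𝓘(ℝ, F)) f' y u'] =
    liftForm ν Φ π (f y) ![tderiv I (𝓘(ℝ, E).prod 𝓘(ℝ, F)) f y u,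
      tderiv I (𝓘(ℝ, E).prod 𝓘(ℝ, F)) f y u'] := by
  have : IsTopologicalGroup G := topologicalGroup_of_lieGroup 𝓘(ℝ, E) ∞
  have := hN.smooth_action
  have h1 : ∀ z, ∃ k : K, FibredProduct.mk K (f z) = FibredProduct.mk K (f' z) →
      f' z = ((f z).1 * (k : G)⁻¹, k • (f z).2) := fun z => by
    by_cases hz : FibredProduct.mk K (f z) = FibredProduct.mk K (f' z)
    · obtain ⟨k, hk⟩ := FibredProduct.mk_eq_mk.mp hz
      exact ⟨k, fun _ => hk⟩
    · exact ⟨1, fun h => absurd h hz⟩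
  choose κ hκ using h1
  have h2 : ∀ᶠ z in 𝓝 y, f' z = ((f z).1 * (κ z : G)⁻¹, κ z • (f z).2) := h.mono fun z hz => hκ z hz
  -- κ = (f')⁻¹ f in the group component, so it is smooth into G and therefore, K being embedded,
  -- smooth into K.
  have hκG : ContMDiffAt I 𝓘(ℝ, E) ∞ (fun z => (κ z : G)) y := by
    have h3 : ContMDiffAt I 𝓘(ℝ, E) ∞ (fun z => (f' z).1⁻¹ * (f z).1) y := hf'.fst.inv.mul hf.fst
    refine h3.congr_of_eventuallyEq ?_
    filter_upwards [h2] with z hz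
    rw [hz]
    simp
  have hκs := hKG.contMDiffAt_of_val π hπ.retract hκG
  have e1 : ∀ u, tderiv I (𝓘(ℝ, E).prod 𝓘(ℝ, F)) f' y u =
      (tderiv I 𝓘(ℝ, E) (fun z => (f z).1 * (κ z : G)⁻¹) y u,
        tderiv I 𝓘(ℝ, F) (fun z => κ z • (f z).2) y u) := fun u => by
    rw [tderiv_prod_apply hf', tderiv_congr (h2.mono fun z hz => congrArg Prod.fst hz),
      tderiv_congr (h2.mono fun z hz => congrArg Prod.snd hz)]
  rw [e1, e1, tderiv_prod_apply hf, tderiv_prod_apply hf, liftForm_apply, liftForm_apply,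
    h2.self_of_nhds]
  simp only
  -- With z the logarithmic derivative of κ, the derivative of the second lift is the image under κ
  -- of (X - z, v + z_N). Invariance removes κ, and then the vertical part (-z, z_N) contributes
  -- nothing.
  rw [leftTriv_tderiv_mul_inv hf.fst hκG, leftTriv_tderiv_mul_inv hf.fst hκG,
    leftTriv_val hKG hκs, leftTriv_val hKG hκs, tderiv_smul hκs hf.snd, tderiv_smul hκs hf.snd,
    baseForm_smul hN hπ, baseForm_add_vertical hN hπ hKG]

/-- The tangent vectors of the orbits of `K` are killed by the quotient map. -/
theorem tderiv_mk_vertical (hKG : IsLieSubgroup E EK K)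
    [ContMDiffSMul 𝓘(ℝ, EK) 𝓘(ℝ, F) ∞ K N]
    {X : Type*} [NormedAddCommGroup X] [NormedSpace ℝ X] [ChartedSpace X (FibredProduct K N)]
    (a : G × N)
    (hp : MDifferentiableAt (𝓘(ℝ, E).prod 𝓘(ℝ, F)) 𝓘(ℝ, X) (FibredProduct.mk K) a) (z : EK) :
    tderiv (𝓘(ℝ, E).prod 𝓘(ℝ, F)) 𝓘(ℝ, X) (FibredProduct.mk K) a
      (leftTrans E a.1 (- inclE E EK K z), orbitDeriv EK K F a.2 z) = 0 := by
  have : IsTopologicalGroup G := topologicalGroup_of_lieGroup 𝓘(ℝ, E) ∞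
  let c : K → G × N := fun k => (a.1 * (k : G)⁻¹, k • a.2)
  have hval := hKG.contMDiff_val
  have hc1 : c 1 = a := by simp [c]
  have hc : ContMDiff 𝓘(ℝ, EK) (𝓘(ℝ, E).prod 𝓘(ℝ, F)) ∞ c :=
    (contMDiff_const.mul (ContMDiff.inv hval)).prodMk (contMDiff_orbit (E := EK) (F := F) a.2)
  have e1 := tderiv_comp_apply (f := c) (x := 1) (by rwa [hc1]) (hc.mdiff 1) z
  have e2 : (fun k => FibredProduct.mk K (c k)) = fun _ => FibredProduct.mk K a := by
    ext k
    exact FibredProduct.mk_smul k a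
  rw [e2, tderiv_const, hc1, tderiv_prod_apply hc.contMDiffAt] at e1
  refine Eq.trans ?_ e1.symm
  refine congrArg _ (Prod.ext ?_ rfl)
  have e3 := leftTriv_tderiv_mul_inv (f := fun _ : K => a.1) (k := fun k : K => (k : G)) (y := 1)
    (I := 𝓘(ℝ, EK)) (E := E) contMDiffAt_const (hval 1) z
  rw [tderiv_const, OneMemClass.coe_one, inv_one, mul_one, Ad_one, leftTriv_one] at e3
  have e4 : leftTriv E a.1 (tderiv 𝓘(ℝ, EK) 𝓘(ℝ, E) (fun k : K => a.1 * (k : G)⁻¹) 1 z) =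
      - inclE E EK K z := by
    rw [e3]
    simp [inclE]
  rw [← e4, leftTrans_leftTriv]

end LiftForm

/-! ### Local sections of submersions -/

section Sections

variable {EP : Type*} [NormedAddCommGroup EP] [NormedSpace ℝ EP]
  {HP : Type*} [TopologicalSpace HP] {I : ModelWithCorners ℝ EP HP} [I.Boundaryless]
  {P : Type*} [TopologicalSpace P] [ChartedSpace HP P] [IsManifold I ∞ P]
  {X : Type*} [NormedAddCommGroup X] [NormedSpace ℝ X]
  {M : Type*} [TopologicalSpace M] [ChartedSpace X M] [IsManifold 𝓘(ℝ, X) ∞ M]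

/-- A submersion has a smooth local section through every point. -/
theorem Manifold.IsSubmersionAt.exists_section {f : P → M} {a : P}
    (h : Manifold.IsSubmersionAt I 𝓘(ℝ, X) ∞ f a) :
    ∃ s : M → P, s (f a) = a ∧
      ∀ᶠ x in 𝓝 (f a), ContMDiffAt 𝓘(ℝ, X) I ∞ s x ∧ f (s x) = x := by
  let z := h.domChart.extend I a
  -- In the normal form the map is a projection; the section freezes the complementary coordinate at
  -- its value at a.
  let σ : M → EP := fun x => h.equiv.symm (h.codChart x, (h.equiv z).2)
  have hext : IsOpen (h.domChart.extend I).target := h.domChart.isOpen_extend_target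
  have hza : (h.domChart.extend I).symm z = a :=
    h.domChart.extend_left_inv h.mem_domChart_source
  have hz : z ∈ (h.domChart.extend I).target :=
    (h.domChart.extend I).map_source (by
      rw [h.domChart.extend_source]; exact h.mem_domChart_source)
  have hw : ∀ y ∈ (h.domChart.extend I).target,
      h.codChart (f ((h.domChart.extend I).symm y)) = (h.equiv y).1 := fun y hy => by
    have := h.writtenInCharts hy
    simpa using this
  have hσ : σ (f a) = z := by
    have h1 := hw z hz
    rw [hza] at h1
    simp only [σ, h1]
    exact h.equiv.symm_apply_apply z
  have hσs : ∀ x ∈ h.codChart.source, ContMDiffAt 𝓘(ℝ, X) 𝓘(ℝ, EP) ∞ σ x := fun x hx => by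
    have h1 : ContMDiffAt 𝓘(ℝ, X) 𝓘(ℝ, X) ∞ h.codChart x :=
      (contMDiffOn_of_mem_maximalAtlas h.codChart_mem_maximalAtlas).contMDiffAt
        (h.codChart.open_source.mem_nhds hx)
    have h2 : ContDiff ℝ ∞ (fun y : X => h.equiv.symm (y, (h.equiv z).2)) :=
      h.equiv.symm.contDiff.comp (contDiff_id.prodMk contDiff_const)
    exact ContMDiffAt.comp x (g := fun y : X => h.equiv.symm (y, (h.equiv z).2)) (f := h.codChart)
      h2.contMDiff.contMDiffAt h1
  refine ⟨fun x => (h.domChart.extend I).symm (σ x), by beta_reduce; rw [hσ, hza], ?_⟩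
  have h1 := h.codChart.open_source.mem_nhds h.mem_codChart_source
  have h2 : ∀ᶠ x in 𝓝 (f a), σ x ∈ (h.domChart.extend I).target :=
    (hσs _ h.mem_codChart_source).continuousAt.eventually (by rw [hσ]; exact hext.mem_nhds hz)
  filter_upwards [h1, h2] with x hx1 hx2
  refine ⟨ContMDiffAt.comp x (g := (h.domChart.extend I).symm) (f := σ) ?_ (hσs x hx1), ?_⟩
  · have h3 := contMDiffOn_extend_symm (I := I) (n := ∞) h.domChart_mem_maximalAtlas
    have h4 : I '' h.domChart.target = (h.domChart.extend I).target := by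
      rw [h.domChart.extend_target, I.image_eq]
    rw [h4] at h3
    exact h3.contMDiffAt (hext.mem_nhds hx2)
  · refine h.codChart.injOn (h.source_subset_preimage_source ?_) hx1 ?_
    · have := (h.domChart.extend I).map_target hx2
      rwa [h.domChart.extend_source] at this
    · rw [hw _ hx2]
      simp [σ]

end Sections

/-! ### Smooth maps and the G-action on the quotient -/

section QuotientManifold

variable {E : Type*} [NormedAddCommGroup E] [NormedSpace ℝ E] [FiniteDimensional ℝ E]
  [CompleteSpace E]
  {G : Type*} [TopologicalSpace G] [ChartedSpace E G] [Group G] [LieGroup 𝓘(ℝ, E) ∞ G]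
  {EK : Type*} [NormedAddCommGroup EK] [NormedSpace ℝ EK]
  {K : Subgroup G} [ChartedSpace EK K]
  {F : Type*} [NormedAddCommGroup F] [NormedSpace ℝ F] [FiniteDimensional ℝ F]
  {N : Type*} [TopologicalSpace N] [ChartedSpace F N] [IsManifold 𝓘(ℝ, F) ∞ N] [MulAction K N]
  {X : Type*} [NormedAddCommGroup X] [NormedSpace ℝ X] [FiniteDimensional ℝ X]
  [ChartedSpace X (FibredProduct K N)]

namespace IsQuotientManifold

theorem contMDiff_mk (hQ : IsQuotientManifold E K F N X) :
    ContMDiff (𝓘(ℝ, E).prod 𝓘(ℝ, F)) 𝓘(ℝ, X) ∞ (FibredProduct.mk K : G × N → _) :=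
  hQ.submersion.contMDiff

theorem exists_section (hQ : IsQuotientManifold E K F N X) (a : G × N) :
    ∃ s : FibredProduct K N → G × N, s (FibredProduct.mk K a) = a ∧
      ∀ᶠ x in 𝓝 (FibredProduct.mk K a),
        ContMDiffAt 𝓘(ℝ, X) (𝓘(ℝ, E).prod 𝓘(ℝ, F)) ∞ s x ∧ FibredProduct.mk K (s x) = x := by
  have := hQ.isManifold
  have : IsManifold 𝓘(ℝ, E) ∞ G := (ContMDiffMul.toIsManifold : IsManifold 𝓘(ℝ, E) ∞ G)
  exact (hQ.submersion.isSubmersionAt a).exists_section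

theorem tderiv_mk_surjective (hQ : IsQuotientManifold E K F N X) (a : G × N) :
    Function.Surjective (tderiv (𝓘(ℝ, E).prod 𝓘(ℝ, F)) 𝓘(ℝ, X) (FibredProduct.mk K) a) := by
  have := hQ.isManifold
  obtain ⟨s, hsa, hs⟩ := hQ.exists_section a
  exact tderiv_surjective_of_section (hQ.contMDiff_mk.mdiff a) hs.self_of_nhds.1.mdiff hsa
    (hs.mono fun x hx => hx.2)

/-- A map on the quotient is smooth if it lifts to a smooth map. -/
theorem contMDiff_of_comp_mk (hQ : IsQuotientManifold E K F N X) {W : Type*}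
    [NormedAddCommGroup W] [NormedSpace ℝ W] {H : Type*} [TopologicalSpace H]
    {J : ModelWithCorners ℝ W H} {Q : Type*} [TopologicalSpace Q] [ChartedSpace H Q]
    {f : FibredProduct K N → Q}
    (hf : ContMDiff (𝓘(ℝ, E).prod 𝓘(ℝ, F)) J ∞ (fun a => f (FibredProduct.mk K a))) :
    ContMDiff 𝓘(ℝ, X) J ∞ f := by
  intro x
  have : IsTopologicalGroup G := topologicalGroup_of_lieGroup 𝓘(ℝ, E) ∞
  obtain ⟨a, rfl⟩ := FibredProduct.mk_surjective x
  obtain ⟨s, hsa, hs⟩ := hQ.exists_section a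
  refine (ContMDiffAt.comp (g := fun a => f (FibredProduct.mk K a)) (f := s) _ (hf _)
    hs.self_of_nhds.1).congr_of_eventuallyEq ?_
  exact hs.mono fun x hx => (congrArg f hx.2).symm

/-- Locally g · x is the class of g · s(x), for a smooth local section s. -/
theorem contMDiffSMul (hQ : IsQuotientManifold E K F N X) :
    ContMDiffSMul 𝓘(ℝ, E) 𝓘(ℝ, X) ∞ G (FibredProduct K N) := by
  refine ⟨fun q => ?_⟩
  obtain ⟨h, x⟩ := q
  have : IsTopologicalGroup G := topologicalGroup_of_lieGroup 𝓘(ℝ, E) ∞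
  obtain ⟨a, rfl⟩ := FibredProduct.mk_surjective x
  obtain ⟨s, hsa, hs⟩ := hQ.exists_section a
  have h1 : ContMDiffAt (𝓘(ℝ, E).prod 𝓘(ℝ, X)) (𝓘(ℝ, E).prod 𝓘(ℝ, F)) ∞
      (fun q : G × FibredProduct K N => s q.2) (h, FibredProduct.mk K a) :=
    ContMDiffAt.comp (g := s) (f := Prod.snd) _ hs.self_of_nhds.1 contMDiffAt_snd
  have h2 : ContMDiffAt (𝓘(ℝ, E).prod 𝓘(ℝ, X)) (𝓘(ℝ, E).prod 𝓘(ℝ, F)) ∞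
      (fun q : G × FibredProduct K N => (q.1 * (s q.2).1, (s q.2).2)) (h, FibredProduct.mk K a) :=
    (contMDiffAt_fst.mul h1.fst).prodMk h1.snd
  refine (ContMDiffAt.comp (g := FibredProduct.mk K) _ (hQ.contMDiff_mk _) h2).congr_of_eventuallyEq
    ?_
  have h3 : ∀ᶠ q : G × FibredProduct K N in 𝓝 (h, FibredProduct.mk K a),
      FibredProduct.mk K (s q.2) = q.2 :=
    (continuous_snd.tendsto (h, FibredProduct.mk K a)).eventually (hs.mono fun x hx => hx.2)
  filter_upwards [h3] with q hq
  conv_lhs => rw [← hq]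
  rfl

theorem tderiv_smul_tderiv_mk (hQ : IsQuotientManifold E K F N X) (g : G) (a : G × N) (A : E)
    (v : F) :
    tderiv 𝓘(ℝ, X) 𝓘(ℝ, X) (fun x : FibredProduct K N => g • x) (FibredProduct.mk K a)
      (tderiv (𝓘(ℝ, E).prod 𝓘(ℝ, F)) 𝓘(ℝ, X) (FibredProduct.mk K) a (A, v)) =
    tderiv (𝓘(ℝ, E).prod 𝓘(ℝ, F)) 𝓘(ℝ, X) (FibredProduct.mk K) (g * a.1, a.2)
      (tderiv 𝓘(ℝ, E) 𝓘(ℝ, E) (fun x : G => g * x) a.1 A, v) := by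
  have := hQ.contMDiffSMul
  have hl : ContMDiff (𝓘(ℝ, E).prod 𝓘(ℝ, F)) (𝓘(ℝ, E).prod 𝓘(ℝ, F)) ∞
      (fun b : G × N => (g * b.1, b.2)) := (contMDiff_const.mul contMDiff_fst).prodMk contMDiff_snd
  have e1 := tderiv_comp_apply (g := fun x : FibredProduct K N => g • x) (f := FibredProduct.mk K)
    (x := a) ((contMDiff_smul_const (E := E) (F := X) this g).mdiff _) (hQ.contMDiff_mk.mdiff a)
    (A, v)
  have e2 := tderiv_comp_apply (g := FibredProduct.mk K) (f := fun b : G × N => (g * b.1, b.2))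
    (x := a) (hQ.contMDiff_mk.mdiff _) (hl.mdiff a) (A, v)
  refine e1.symm.trans (e2.trans (congrArg _ ?_))
  rw [tderiv_prod_apply hl.contMDiffAt]
  have e3 := tderiv_comp_apply (g := fun x : G => g * x) (f := (Prod.fst : G × N → G))
    (x := a) (I₁ := 𝓘(ℝ, E).prod 𝓘(ℝ, F)) (mdiff_lmul (E := E) g _) (contMDiff_fst (n := ∞).mdiff a) (A, v)
  rw [e3, tderiv_fst, tderiv_snd]
  rfl

/-- The generating fields of left multiplication lift to right-invariant fields on G with no
component along N. -/
theorem fundamentalVector_mk (hQ : IsQuotientManifold E K F N X) (Z : E) (a : G × N) :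
    fundamentalVector (E := X) (H := G) (EH := E) Z (FibredProduct.mk K a) =
      tderiv (𝓘(ℝ, E).prod 𝓘(ℝ, F)) 𝓘(ℝ, X) (FibredProduct.mk K) a
        (tderiv 𝓘(ℝ, E) 𝓘(ℝ, E) (fun x : G => x * a.1) 1 Z, 0) := by
  have hl : ContMDiff 𝓘(ℝ, E) (𝓘(ℝ, E).prod 𝓘(ℝ, F)) ∞
      (fun g : G => (g * a.1, a.2)) := (contMDiff_id.mul contMDiff_const).prodMk contMDiff_const
  have e2 := tderiv_comp_apply (g := FibredProduct.mk K) (f := fun g : G => (g * a.1, a.2))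
    (x := 1) (hQ.contMDiff_mk.mdiff _) (hl.mdiff 1) Z
  rw [tderiv_prod_apply hl.contMDiffAt, tderiv_const, one_mul] at e2
  exact e2

end IsQuotientManifold

end QuotientManifold

/-! ### Pullbacks of closed 2-forms -/

section PullbackForms

variable {V : Type*} [NormedAddCommGroup V] [NormedSpace ℝ V] [FiniteDimensional ℝ V]
  {W : Type*} [NormedAddCommGroup W] [NormedSpace ℝ W]

theorem two_le_minSmoothness : minSmoothness ℝ 2 ≤ ∞ := by
  rw [minSmoothness_of_isRCLikeNormedField]
  exact ENat.LEInfty.out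

theorem contDiffAt_alt_pullback {η : W → W [⋀^Fin 2]→L[ℝ] ℝ} {f : V → W} {y : V}
    (hη : ContDiffAt ℝ ∞ η (f y)) (hf : ContDiffAt ℝ ∞ f y) :
    ContDiffAt ℝ ∞ (fun y => (η (f y)).compContinuousLinearMap (fderiv ℝ f y)) y := by
  let c : (W [⋀^Fin 2]→L[ℝ] ℝ) →L[ℝ] (W →L[ℝ] W →L[ℝ] ℝ) :=
    (ContinuousLinearMap.compL ℝ W (W [⋀^Fin 1]→L[ℝ] ℝ) (W →L[ℝ] ℝ)
      ((covectorEquiv W).symm : (W [⋀^Fin 1]→L[ℝ] ℝ) →L[ℝ] (W →L[ℝ] ℝ))).comp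
      (ContinuousAlternatingMap.curryLeftLI (n := 1) (𝕜 := ℝ) (E := W) (F := ℝ)).toContinuousLinearMap
  have hc : ∀ Ω v w, c Ω v w = Ω ![v, w] := fun Ω v w => by
    refine congrArg Ω ?_
    ext i
    fin_cases i <;> rfl
  have hcs : ContDiff ℝ ∞ (fun Ω : W [⋀^Fin 2]→L[ℝ] ℝ => c Ω) :=
    ContinuousLinearMap.contDiff (𝕜 := ℝ) (E := W [⋀^Fin 2]→L[ℝ] ℝ) (F := W →L[ℝ] W →L[ℝ] ℝ) c
  refine contDiffAt_alt_of_apply fun v w => ?_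
  simp only [alt_comp_apply, ← hc]
  have hd : ContDiffAt ℝ ∞ (fderiv ℝ f) y := hf.fderiv_right (by simp)
  have h1 : ContDiffAt ℝ ∞ (fun y => c (η (f y))) y :=
    hcs.contDiffAt.comp y (hη.comp y hf)
  exact (h1.clm_apply (hd.clm_apply contDiffAt_const)).clm_apply (hd.clm_apply contDiffAt_const)

variable {N : Type*} [TopologicalSpace N] [ChartedSpace W N] [IsManifold 𝓘(ℝ, W) ∞ N]

/-- The pullback of a smooth closed 2-form to a vector space is smooth and closed. -/
theorem TwoForm.contDiffAt_extDeriv_pullback {ν : TwoForm W N} (hs : ν.IsSmooth)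
    (hcl : ν.IsClosed) {f : V → N} {y₀ : V}
    (hf : ∀ᶠ y in 𝓝 y₀, ContMDiffAt 𝓘(ℝ, V) 𝓘(ℝ, W) ∞ f y) :
    ContDiffAt ℝ ∞ (fun y => (ν.onModel (f y)).compContinuousLinearMap
        (tderiv 𝓘(ℝ, V) 𝓘(ℝ, W) f y)) y₀ ∧
      extDeriv (fun y => (ν.onModel (f y)).compContinuousLinearMap
        (tderiv 𝓘(ℝ, V) 𝓘(ℝ, W) f y)) y₀ = 0 := by
  set φ := chartAt W (f y₀) with hφ
  let q : V → W := fun y => φ (f y)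
  have h0 : f y₀ ∈ φ.source := mem_chart_source W _
  have hsrc : ∀ᶠ y in 𝓝 y₀, f y ∈ φ.source :=
    hf.self_of_nhds.continuousAt.eventually (φ.open_source.mem_nhds h0)
  have hq : ∀ y, ContMDiffAt 𝓘(ℝ, V) 𝓘(ℝ, W) ∞ f y → f y ∈ φ.source →
      ContMDiffAt 𝓘(ℝ, V) 𝓘(ℝ, W) ∞ q y := fun y h1 h2 =>
    ContMDiffAt.comp (g := φ) (f := f) y (contMDiffAt_chartAt h2) h1
  have hq0 : ContDiffAt ℝ ∞ q y₀ := (hq y₀ hf.self_of_nhds h0).contDiffAt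
  -- Near y₀ the pullback along f is the pullback, between vector spaces, of the coordinate
  -- expression of ν along φ ∘ f; there d commutes with pullback.
  have heq : (fun y => (ν.onModel (f y)).compContinuousLinearMap (tderiv 𝓘(ℝ, V) 𝓘(ℝ, W) f y))
      =ᶠ[𝓝 y₀] fun y => (ν.inChart (f y₀) (q y)).compContinuousLinearMap (fderiv ℝ q y) := by
    filter_upwards [hf, hsrc, hsrc.eventually_nhds] with y h1 h2 h3
    have e1 : tderiv 𝓘(ℝ, V) 𝓘(ℝ, W) f y =
        (tderiv 𝓘(ℝ, W) 𝓘(ℝ, W) φ.symm (q y)).comp (fderiv ℝ q y) := by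
      rw [← tderiv_eq_fderiv, ← tderiv_comp (f := q) (contMDiffAt_chartAt_symm (φ.map_source h2)).mdiff
        (hq y h1 h2).mdiff]
      exact tderiv_congr (h3.mono fun z hz => (φ.left_inv hz).symm)
    have e2 : φ.symm (q y) = f y := φ.left_inv h2
    refine alt_ext fun v w => ?_
    rw [alt_comp_apply, alt_comp_apply, e1]
    have e3 : ∀ (m : N) (_ : m = f y) (v w : W), ν.onModel (f y) ![v, w] = ν.onModel m ![v, w] := by
      rintro m rfl v w
      rfl
    refine (e3 _ e2 _ _).trans ?_
    exact (alt_comp_apply (ν.onModel (φ.symm (q y))) (tderiv 𝓘(ℝ, W) 𝓘(ℝ, W) φ.symm (q y))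
      (fderiv ℝ q y v) (fderiv ℝ q y w)).symm
  have hη : ContDiffAt ℝ ∞ (ν.inChart (f y₀)) (q y₀) :=
    (hs (f y₀)).contDiffAt (φ.open_target.mem_nhds (φ.map_source h0))
  refine ⟨(contDiffAt_alt_pullback hη hq0).congr_of_eventuallyEq heq, ?_⟩
  rw [heq.extDeriv_eq, extDeriv_pullback (hη.differentiableAt (by simp)) hq0 two_le_minSmoothness,
    hcl (f y₀) (q y₀) (φ.map_source h0)]
  rfl

end PullbackForms

/-! ### Pullbacks of the lifted form are closed -/

section LiftFormPullback

variable {E : Type*} [NormedAddCommGroup E] [NormedSpace ℝ E] [FiniteDimensional ℝ E]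
  [CompleteSpace E]
  {G : Type*} [TopologicalSpace G] [ChartedSpace E G] [Group G] [LieGroup 𝓘(ℝ, E) ∞ G]
  {EK : Type*} [NormedAddCommGroup EK] [NormedSpace ℝ EK] [FiniteDimensional ℝ EK]
  [CompleteSpace EK]
  {K : Subgroup G} [ChartedSpace EK K] [LieGroup 𝓘(ℝ, EK) ∞ K]
  {F : Type*} [NormedAddCommGroup F] [NormedSpace ℝ F]
  {N : Type*} [TopologicalSpace N] [ChartedSpace F N] [IsManifold 𝓘(ℝ, F) ∞ N] [MulAction K N]
  {V : Type*} [NormedAddCommGroup V] [NormedSpace ℝ V] [FiniteDimensional ℝ V]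
  {ν : TwoForm F N} {Φ : N → Module.Dual ℝ (LieAlg EK K)} {π : E →L[ℝ] EK}

/-- This identifies the lifted form as ν + d⟨Φ, πθ⟩, tested on maps from vector spaces. The exterior
derivative of ⟨c, l⟩ produces the two dΦ terms and ⟨c, dl⟩, and the Maurer–Cartan equation turns the
latter into the bracket term. -/
theorem liftForm_pullback_eq (hN : IsHamiltonianAction ν Φ) {f : V → G × N} {y₀ : V}
    (hf : ∀ᶠ y in 𝓝 y₀, ContMDiffAt 𝓘(ℝ, V) (𝓘(ℝ, E).prod 𝓘(ℝ, F)) ∞ f y) :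
    ContDiffAt ℝ ∞ (fun y => covectorEquiv V ((comoment π Φ (f y).2).comp
        (leftLogDeriv E (fun y => (f y).1) y))) y₀ ∧
    (liftForm ν Φ π (f y₀)).compContinuousLinearMap
        (tderiv 𝓘(ℝ, V) (𝓘(ℝ, E).prod 𝓘(ℝ, F)) f y₀) =
      (ν.onModel (f y₀).2).compContinuousLinearMap
          (tderiv 𝓘(ℝ, V) 𝓘(ℝ, F) (fun y => (f y).2) y₀) +
        extDeriv (fun y => covectorEquiv V ((comoment π Φ (f y).2).comp
          (leftLogDeriv E (fun y => (f y).1) y))) y₀ := by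
  let l := leftLogDeriv E (fun y => (f y).1)
  let c : V → E →L[ℝ] ℝ := fun y => comoment π Φ (f y).2
  have hf0 := hf.self_of_nhds
  obtain ⟨hl, hl2⟩ := contDiffAt_leftLogDeriv (hf.mono fun y hy => hy.fst)
  have hcM : ContMDiffAt 𝓘(ℝ, V) 𝓘(ℝ, E →L[ℝ] ℝ) ∞ c y₀ :=
    ContMDiffAt.comp (g := comoment π Φ) (f := fun y => (f y).2) y₀
      ((contMDiff_comoment hN) _) hf0.snd
  have hc : ContDiffAt ℝ ∞ c y₀ := hcM.contDiffAt
  have hc' : ∀ u, fderiv ℝ c y₀ u =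
      comomentDeriv Φ π (f y₀).2 (tderiv 𝓘(ℝ, V) 𝓘(ℝ, F) (fun y => (f y).2) y₀ u) := fun u => by
    rw [← tderiv_eq_fderiv]
    exact tderiv_comp_apply (f := fun y => (f y).2) ((contMDiff_comoment hN).mdiff _)
      hf0.snd.mdiff u
  have hcl : ContDiffAt ℝ ∞ (fun y => (c y).comp (l y)) y₀ := hc.clm_comp hl
  have hα : ContDiffAt ℝ ∞ (fun y => covectorEquiv V ((c y).comp (l y))) y₀ :=
    (covectorEquiv V).contDiff.contDiffAt.comp y₀ hcl
  refine ⟨hα, alt_ext fun u v => ?_⟩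
  have h : ∀ (A B : V [⋀^Fin 2]→L[ℝ] ℝ) (m : Fin 2 → V), (A + B) m = A m + B m :=
    fun _ _ _ => rfl
  have hd : ∀ u v, fderiv ℝ (fun y => (c y).comp (l y) v) y₀ u =
      fderiv ℝ c y₀ u (l y₀ v) + c y₀ (fderiv ℝ l y₀ u v) := fun u v => by
    have h1 := (hc.differentiableAt (by simp)).hasFDerivAt.clm_apply
      ((hl.differentiableAt (by simp)).hasFDerivAt.clm_apply (hasFDerivAt_const v y₀))
    have h2 := DFunLike.congr_fun h1.fderiv u
    refine h2.trans ?_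
    simp [l, add_comm]
  have hext : extDeriv (fun y => covectorEquiv V ((c y).comp (l y))) y₀ ![u, v] =
      fderiv ℝ (fun y => (c y).comp (l y) v) y₀ u - fderiv ℝ (fun y => (c y).comp (l y) u) y₀ v := by
    rw [extDeriv_apply (hα.differentiableAt (by simp)), Fin.sum_univ_two]
    simp only [covectorEquiv_apply]
    simp [Fin.removeNth, sub_eq_add_neg]
  rw [h, alt_comp_apply, alt_comp_apply, hext, hd, hd, hc', hc', tderiv_prod_apply hf0,
    tderiv_prod_apply hf0, liftForm_apply, baseForm_apply]
  have e := congrArg (c y₀) (hl2 u v)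
  rw [map_sub, map_neg] at e
  have e' : ∀ w, l y₀ w = leftTriv E (f y₀).1 (tderiv 𝓘(ℝ, V) 𝓘(ℝ, E) (fun y => (f y).1) y₀ w) :=
    fun w => rfl
  rw [← e', ← e']
  change c y₀ (fderiv ℝ l y₀ u v) - c y₀ (fderiv ℝ l y₀ v u) = - c y₀ (lieBr E G (l y₀ u) (l y₀ v))
    at e
  linarith

/-- The pullback of the lifted form to a vector space is smooth and closed. -/
theorem liftForm_contDiffAt_extDeriv_pullback (hN : IsHamiltonianAction ν Φ) {f : V → G × N}
    {y₀ : V} (hf : ∀ᶠ y in 𝓝 y₀, ContMDiffAt 𝓘(ℝ, V) (𝓘(ℝ, E).prod 𝓘(ℝ, F)) ∞ f y) :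
    ContDiffAt ℝ ∞ (fun y => (liftForm ν Φ π (f y)).compContinuousLinearMap
        (tderiv 𝓘(ℝ, V) (𝓘(ℝ, E).prod 𝓘(ℝ, F)) f y)) y₀ ∧
      extDeriv (fun y => (liftForm ν Φ π (f y)).compContinuousLinearMap
        (tderiv 𝓘(ℝ, V) (𝓘(ℝ, E).prod 𝓘(ℝ, F)) f y)) y₀ = 0 := by
  have heq := hf.eventually_nhds.mono fun y hy => (liftForm_pullback_eq (π := π) hN hy).2
  obtain ⟨h1, h2⟩ := TwoForm.contDiffAt_extDeriv_pullback hN.symplectic.smooth hN.symplectic.closed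
    (hf.mono fun y hy => hy.snd)
  have hα := (liftForm_pullback_eq (π := π) hN hf).1
  have h3 : ContDiffAt ℝ ∞ (extDeriv (fun y => covectorEquiv V ((comoment π Φ (f y).2).comp
      (leftLogDeriv E (fun y => (f y).1) y)))) y₀ := by
    have h4 : ContDiffAt ℝ ∞ (fderiv ℝ (fun y => covectorEquiv V ((comoment π Φ (f y).2).comp
      (leftLogDeriv E (fun y => (f y).1) y)))) y₀ := hα.fderiv_right (by simp)
    exact (ContinuousLinearMap.contDiff (𝕜 := ℝ)
      (ContinuousAlternatingMap.alternatizeUncurryFinCLM ℝ V ℝ (n := 1))).contDiffAt.comp y₀ h4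
  refine ⟨(h1.add h3).congr_of_eventuallyEq heq, ?_⟩
  rw [Filter.EventuallyEq.extDeriv_eq heq, extDeriv_fun_add (h1.differentiableAt (by simp))
    (h3.differentiableAt (by simp)), h2, extDeriv_extDeriv_apply hα two_le_minSmoothness, zero_add]

end LiftFormPullback

/-! ### The induced form: existence, closedness, nondegeneracy, uniqueness -/

section InducedForm

variable {E : Type*} [NormedAddCommGroup E] [NormedSpace ℝ E] [FiniteDimensional ℝ E]
  [CompleteSpace E]
  {G : Type*} [TopologicalSpace G] [ChartedSpace E G] [Group G] [LieGroup 𝓘(ℝ, E) ∞ G]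
  {EK : Type*} [NormedAddCommGroup EK] [NormedSpace ℝ EK] [FiniteDimensional ℝ EK]
  [CompleteSpace EK]
  {K : Subgroup G} [ChartedSpace EK K] [LieGroup 𝓘(ℝ, EK) ∞ K]
  {F : Type*} [NormedAddCommGroup F] [NormedSpace ℝ F] [FiniteDimensional ℝ F]
  {N : Type*} [TopologicalSpace N] [ChartedSpace F N] [IsManifold 𝓘(ℝ, F) ∞ N] [MulAction K N]
  {X : Type*} [NormedAddCommGroup X] [NormedSpace ℝ X] [FiniteDimensional ℝ X]
  [ChartedSpace X (FibredProduct K N)]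

variable (K X) in
/-- The derivative of the quotient map. -/
def mkDeriv (a : G × N) : E × F →L[ℝ] X :=
  tderiv (𝓘(ℝ, E).prod 𝓘(ℝ, F)) 𝓘(ℝ, X) (FibredProduct.mk K : G × N → FibredProduct K N) a

/-- The form on `G × N` is the pullback of `Ω` by the quotient map. -/
def IsPullbackForm (ν : TwoForm F N) (Φ : N → Module.Dual ℝ (LieAlg EK K)) (π : E →L[ℝ] EK)
    (Ω : TwoForm X (FibredProduct K N)) : Prop :=
  ∀ (a : G × N) (ξ η : E × F),
    Ω.onModel (FibredProduct.mk K a) ![mkDeriv K X a ξ, mkDeriv K X a η] = liftForm ν Φ π a ![ξ, η]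

variable {ν : TwoForm F N} {Φ : N → Module.Dual ℝ (LieAlg EK K)} {π : E →L[ℝ] EK}
  {Ω : TwoForm X (FibredProduct K N)}

theorem TwoForm.onModel_congr {M : Type*} [TopologicalSpace M] [ChartedSpace X M]
    (Ω : TwoForm X M) {x y : M} (h : x = y) (v w : X) :
    Ω.onModel x ![v, w] = Ω.onModel y ![v, w] := by
  rw [h]

/-- At each point, pull the lifted form back along a local section. That the result pulls back to
the original form follows by comparing two lifts of the quotient map, the identity and the section
composed with it. -/
theorem exists_isPullbackForm (hQ : IsQuotientManifold E K F N X) (hN : IsHamiltonianAction ν Φ)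
    (hπ : IsEquivariantProjection K π) (hKG : IsLieSubgroup E EK K) :
    ∃ Ω : TwoForm X (FibredProduct K N), IsPullbackForm ν Φ π Ω := by
  have : IsTopologicalGroup G := topologicalGroup_of_lieGroup 𝓘(ℝ, E) ∞
  have h1 : ∀ x : FibredProduct K N, ∃ s : FibredProduct K N → G × N,
      FibredProduct.mk K (s x) = x ∧ ∀ᶠ y in 𝓝 x,
        ContMDiffAt 𝓘(ℝ, X) (𝓘(ℝ, E).prod 𝓘(ℝ, F)) ∞ s y ∧ FibredProduct.mk K (s y) = y := by
    intro x
    obtain ⟨a, rfl⟩ := FibredProduct.mk_surjective x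
    obtain ⟨s, hsa, hs⟩ := hQ.exists_section a
    exact ⟨s, hs.self_of_nhds.2, hs⟩
  choose s hs1 hs2 using h1
  refine ⟨fun x => (liftForm ν Φ π (s x x)).compContinuousLinearMap
    (tderiv 𝓘(ℝ, X) (𝓘(ℝ, E).prod 𝓘(ℝ, F)) (s x) x), fun a ξ η => ?_⟩
  set p : G × N → FibredProduct K N := FibredProduct.mk K
  refine (alt_comp_apply (liftForm ν Φ π (s (p a) (p a)))
    (tderiv 𝓘(ℝ, X) (𝓘(ℝ, E).prod 𝓘(ℝ, F)) (s (p a)) (p a)) (mkDeriv K X a ξ)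
    (mkDeriv K X a η)).trans ?_
  have h2 := (hs2 (p a)).self_of_nhds.1
  have h3 : ContMDiffAt (𝓘(ℝ, E).prod 𝓘(ℝ, F)) (𝓘(ℝ, E).prod 𝓘(ℝ, F)) ∞
      (fun b => s (p a) (p b)) a := ContMDiffAt.comp (g := s (p a)) (f := p) a h2
        (hQ.contMDiff_mk a)
  have h4 := liftForm_tderiv_eq hN hπ hKG (f := fun b => b) (f' := fun b => s (p a) (p b))
    (y := a) contMDiffAt_id h3
    ((hQ.contMDiff_mk.continuous.tendsto a).eventually ((hs2 (p a)).mono fun y hy => hy.2.symm))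
    ξ η
  rw [tderiv_id] at h4
  refine Eq.trans ?_ h4
  rw [tderiv_comp_apply (g := s (p a)) (f := p) h2.mdiff (hQ.contMDiff_mk.mdiff a),
    tderiv_comp_apply (g := s (p a)) (f := p) h2.mdiff (hQ.contMDiff_mk.mdiff a)]
  rfl

namespace IsPullbackForm

theorem isInvariant (hΩ : IsPullbackForm ν Φ π Ω) (hQ : IsQuotientManifold E K F N X) :
    Ω.IsInvariant G := by
  have : IsTopologicalGroup G := topologicalGroup_of_lieGroup 𝓘(ℝ, E) ∞
  intro g x v w
  obtain ⟨a, rfl⟩ := FibredProduct.mk_surjective x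
  obtain ⟨⟨A, v⟩, rfl⟩ := hQ.tderiv_mk_surjective a v
  obtain ⟨⟨B, w⟩, rfl⟩ := hQ.tderiv_mk_surjective a w
  have e1 := hQ.tderiv_smul_tderiv_mk g a A v
  have e2 := hQ.tderiv_smul_tderiv_mk g a B w
  have h1 := hΩ (g * a.1, a.2) (tderiv 𝓘(ℝ, E) 𝓘(ℝ, E) (fun x : G => g * x) a.1 A, v)
    (tderiv 𝓘(ℝ, E) 𝓘(ℝ, E) (fun x : G => g * x) a.1 B, w)
  rw [liftForm_apply, leftTriv_tderiv_mul_left, leftTriv_tderiv_mul_left] at h1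
  have h2 := hΩ a (A, v) (B, w)
  rw [liftForm_apply, ← h1] at h2
  refine Eq.trans ?_ h2.symm
  unfold mkDeriv
  rw [← e1, ← e2]
  rfl

/-- In a chart of the quotient, the form is the pullback of the lifted form along a local section
read in that chart. -/
theorem isSmooth_isClosed (hΩ : IsPullbackForm ν Φ π Ω) (hQ : IsQuotientManifold E K F N X)
    (hN : IsHamiltonianAction ν Φ) : Ω.IsSmooth ∧ Ω.IsClosed := by
  have : IsTopologicalGroup G := topologicalGroup_of_lieGroup 𝓘(ℝ, E) ∞
  have hM := hQ.isManifold
  have key : ∀ x₀ : FibredProduct K N, ∀ y₀ ∈ (chartAt X x₀).target,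
      ContDiffAt ℝ ∞ (Ω.inChart x₀) y₀ ∧ extDeriv (Ω.inChart x₀) y₀ = 0 := by
    intro x₀ y₀ hy₀
    set φ := chartAt X x₀
    obtain ⟨a, ha⟩ := FibredProduct.mk_surjective (φ.symm y₀)
    obtain ⟨s, hsa, hs⟩ := hQ.exists_section a
    rw [ha] at hs
    have hφs : ∀ᶠ y in 𝓝 y₀, y ∈ φ.target := φ.open_target.mem_nhds hy₀
    have hφ := (contMDiffAt_chartAt_symm (x := x₀) hy₀).continuousAt
    have hs' := hφ.eventually hs
    let f : X → G × N := fun y => s (φ.symm y)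
    have hf : ∀ᶠ y in 𝓝 y₀, ContMDiffAt 𝓘(ℝ, X) (𝓘(ℝ, E).prod 𝓘(ℝ, F)) ∞ f y := by
      filter_upwards [hφs, hs'] with y hy1 hy2
      exact ContMDiffAt.comp (g := s) (f := φ.symm) y hy2.1 (contMDiffAt_chartAt_symm hy1)
    obtain ⟨h1, h2⟩ := liftForm_contDiffAt_extDeriv_pullback (π := π) hN hf
    have heq : Ω.inChart x₀ =ᶠ[𝓝 y₀] fun y => (liftForm ν Φ π (f y)).compContinuousLinearMap
        (tderiv 𝓘(ℝ, X) (𝓘(ℝ, E).prod 𝓘(ℝ, F)) f y) := by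
      filter_upwards [hf, hs', hs'.eventually_nhds] with y hy1 hy2 hy3
      have e1 : ∀ u, tderiv 𝓘(ℝ, X) 𝓘(ℝ, X) φ.symm y u =
          mkDeriv K X (f y) (tderiv 𝓘(ℝ, X) (𝓘(ℝ, E).prod 𝓘(ℝ, F)) f y u) := fun u => by
        rw [mkDeriv, ← tderiv_comp_apply (f := f) (hQ.contMDiff_mk.mdiff _) hy1.mdiff]
        exact DFunLike.congr_fun (tderiv_congr (hy3.mono fun z hz => hz.2.symm)) u
      refine alt_ext fun u v => ?_
      rw [alt_comp_apply, ← hΩ]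
      refine (alt_comp_apply (Ω.onModel (φ.symm y)) (tderiv 𝓘(ℝ, X) 𝓘(ℝ, X) φ.symm y) u v).trans ?_
      rw [e1, e1]
      exact Ω.onModel_congr hy2.2.symm _ _
    exact ⟨h1.congr_of_eventuallyEq heq, heq.extDeriv_eq.trans h2⟩
  exact ⟨fun x₀ y hy => (key x₀ y hy).1.contDiffWithinAt, fun x₀ y hy => (key x₀ y hy).2⟩

end IsPullbackForm

/-- Every tangent vector of the fibred product comes from `T N ⊕ ker π`, left translated. -/
theorem exists_mkDeriv_horizontal (hQ : IsQuotientManifold E K F N X)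
    (hπ : IsEquivariantProjection K π) (hKG : IsLieSubgroup E EK K)
    (hN : IsHamiltonianAction ν Φ) (a : G × N) (ξ : X) :
    ∃ (Z : E) (v : F), π Z = 0 ∧ mkDeriv K X a (leftTrans E a.1 Z, v) = ξ := by
  have := hN.smooth_action
  obtain ⟨⟨A, v⟩, rfl⟩ := hQ.tderiv_mk_surjective a ξ
  let Y := leftTriv E a.1 A
  refine ⟨Y - inclE E EK K (π Y), v + orbitDeriv EK K F a.2 (π Y), ?_, ?_⟩
  · rw [map_sub, hπ.retract, sub_self]
  · have h1 := tderiv_mk_vertical hKG a (hQ.contMDiff_mk.mdiff a) (π Y)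
    have h2 : ((leftTrans E a.1 (Y - inclE E EK K (π Y)), v + orbitDeriv EK K F a.2 (π Y)) : E × F)
        = (A, v) + (leftTrans E a.1 (- inclE E EK K (π Y)), orbitDeriv EK K F a.2 (π Y)) := by
      rw [Prod.mk_add_mk, sub_eq_add_neg, map_add, leftTrans_leftTriv]
    rw [h2, map_add]
    unfold mkDeriv
    rw [h1, add_zero]

theorem comomentDeriv_eq_zero (hN : IsHamiltonianAction ν Φ) (n : N) (v : F) {Y : E}
    (hY : π Y = 0) : comomentDeriv Φ π n v Y = 0 := by
  rw [← tderiv_comoment_apply hN]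
  have : (fun m => comoment π Φ m Y) = fun _ => (0 : ℝ) := by
    ext m
    rw [comoment_apply, hY]
    exact map_zero (Φ m)
  rw [this, tderiv_const]
  rfl

/-- The mixed terms pair dΦ with vectors of ker π, where the extended momentum map vanishes
identically. -/
theorem IsPullbackForm.apply_horizontal (hΩ : IsPullbackForm ν Φ π Ω)
    (hN : IsHamiltonianAction ν Φ) (a : G × N) {Z Y : E} (hZ : π Z = 0) (hY : π Y = 0) (v w : F) :
    Ω.onModel (FibredProduct.mk K a)
        ![mkDeriv K X a (leftTrans E a.1 Z, v), mkDeriv K X a (leftTrans E a.1 Y, w)] =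
      ν.onModel a.2 ![v, w] - comoment π Φ a.2 (lieBr E G Z Y) := by
  rw [hΩ, liftForm_apply, leftTriv_leftTrans, leftTriv_leftTrans, baseForm_apply,
    comomentDeriv_eq_zero hN a.2 v hY, comomentDeriv_eq_zero hN a.2 w hZ]
  ring

/-- The induced form is nondegenerate over the strongly elliptic set. -/
theorem IsPullbackForm.isNondegenerate (hΩ : IsPullbackForm ν Φ π Ω)
    (hQ : IsQuotientManifold E K F N X) (hπ : IsEquivariantProjection K π)
    (hKG : IsLieSubgroup E EK K) (hN : IsHamiltonianAction ν Φ)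
    (hell : ∀ n Z, π Z = 0 → (∀ Y, π Y = 0 → comoment π Φ n (lieBr E G Z Y) = 0) → Z = 0) :
    Ω.IsNondegenerate := by
  have : IsTopologicalGroup G := topologicalGroup_of_lieGroup 𝓘(ℝ, E) ∞
  intro x ξ hξ
  obtain ⟨a, rfl⟩ := FibredProduct.mk_surjective x
  obtain ⟨Z, v, hZ, rfl⟩ := exists_mkDeriv_horizontal hQ hπ hKG hN a ξ
  have h1 : ∀ Y, π Y = 0 → ∀ w : F,
      ν.onModel a.2 ![v, w] - comoment π Φ a.2 (lieBr E G Z Y) = 0 := fun Y hY w =>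
    (hΩ.apply_horizontal hN a hZ hY v w).symm.trans (hξ (mkDeriv K X a (leftTrans E a.1 Y, w)))
  -- Testing against (0, w) isolates ν, and testing against (Y, 0) isolates the bracket pairing on
  -- ker π.
  have hv : v = 0 := hN.symplectic.nondegenerate a.2 v fun w => by
    have := h1 0 (map_zero π) w
    rwa [map_zero, map_zero, sub_zero] at this
  have hZ0 : Z = 0 := hell a.2 Z hZ fun Y hY => by
    have := h1 Y hY 0
    rwa [alt_zero_right, zero_sub, neg_eq_zero] at this
  rw [hv, hZ0, map_zero]
  exact map_zero (mkDeriv K X a)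

theorem tangentAtUnit_eq (n : N) (v : F) (Z : E) :
    tangentAtUnit E K X n v Z = mkDeriv K X ((1 : G), n) (leftTrans E (1 : G) Z, v) := by
  have h : leftTrans E (1 : G) Z = Z := by
    have := leftTriv_leftTrans (1 : G) Z
    rwa [leftTriv_one] at this
  rw [h]
  rfl

theorem IsPullbackForm.isInducedForm (hΩ : IsPullbackForm ν Φ π Ω)
    (hQ : IsQuotientManifold E K F N X) (hN : IsHamiltonianAction ν Φ)
    (hp : ∀ Y : E, Y ∈ killingComplement E EK K ↔ π Y = 0)
    (hext : ∀ ξ Z, extendDual E EK K ξ Z = ξ (π Z)) : IsInducedForm E EK K ν Φ Ω := by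
  refine ⟨hΩ.isInvariant hQ, fun n v w Z hZ Y hY => ?_⟩
  refine (congrArg₂ (fun ξ η : X => Ω.onModel (FibredProduct.mk K ((1 : G), n)) ![ξ, η])
    (tangentAtUnit_eq (E := E) (F := F) n v Z) (tangentAtUnit_eq (E := E) (F := F) n w Y)).trans ?_
  refine (hΩ.apply_horizontal hN (1, n) ((hp Z).mp hZ) ((hp Y).mp hY) v w).trans ?_
  rw [hext, bracket_eq_lieBr]
  rfl

/-- An induced form is determined by its invariance and its values along `N`. -/
theorem IsInducedForm.eq (hQ : IsQuotientManifold E K F N X) (hπ : IsEquivariantProjection K π)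
    (hKG : IsLieSubgroup E EK K) (hN : IsHamiltonianAction ν Φ)
    (hp : ∀ Y : E, Y ∈ killingComplement E EK K ↔ π Y = 0)
    {Ω' : TwoForm X (FibredProduct K N)} (h : IsInducedForm E EK K ν Φ Ω)
    (h' : IsInducedForm E EK K ν Φ Ω') : Ω' = Ω := by
  have : IsTopologicalGroup G := topologicalGroup_of_lieGroup 𝓘(ℝ, E) ∞
  have h1 : ∀ (n : N) (ξ η : X), Ω'.onModel (FibredProduct.mk K ((1 : G), n)) ![ξ, η] =
      Ω.onModel (FibredProduct.mk K ((1 : G), n)) ![ξ, η] := fun n ξ η => by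
    obtain ⟨Z, v, hZ, rfl⟩ := exists_mkDeriv_horizontal hQ hπ hKG hN (1, n) ξ
    obtain ⟨Y, w, hY, rfl⟩ := exists_mkDeriv_horizontal hQ hπ hKG hN (1, n) η
    have e := h.formula n v w Z ((hp Z).mpr hZ) Y ((hp Y).mpr hY)
    have e' := h'.formula n v w Z ((hp Z).mpr hZ) Y ((hp Y).mpr hY)
    rw [tangentAtUnit_eq, tangentAtUnit_eq] at e e'
    exact e'.trans e.symm
  funext x
  refine alt_ext (V := X) fun ξ η => ?_
  obtain ⟨⟨g, n⟩, rfl⟩ := FibredProduct.mk_surjective x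
  have e1 := h.invariant g⁻¹ (FibredProduct.mk K (g, n)) ξ η
  have e2 := h'.invariant g⁻¹ (FibredProduct.mk K (g, n)) ξ η
  refine e2.symm.trans (Eq.trans ?_ e1)
  have e3 : g⁻¹ • FibredProduct.mk K (g, n) = FibredProduct.mk K ((1 : G), n) := by
    rw [FibredProduct.smul_mk, inv_mul_cancel]
  refine (Ω'.onModel_congr e3 _ _).trans ((h1 n _ _).trans (Ω.onModel_congr e3 _ _).symm)

end InducedForm

/-! ### The induced momentum map -/

section InducedMomentumMap

variable {E : Type*} [NormedAddCommGroup E] [NormedSpace ℝ E] [FiniteDimensional ℝ E]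
  [CompleteSpace E]
  {G : Type*} [TopologicalSpace G] [ChartedSpace E G] [Group G] [LieGroup 𝓘(ℝ, E) ∞ G]
  {EK : Type*} [NormedAddCommGroup EK] [NormedSpace ℝ EK] [FiniteDimensional ℝ EK]
  [CompleteSpace EK]
  {K : Subgroup G} [ChartedSpace EK K] [LieGroup 𝓘(ℝ, EK) ∞ K]
  {F : Type*} [NormedAddCommGroup F] [NormedSpace ℝ F] [FiniteDimensional ℝ F]
  {N : Type*} [TopologicalSpace N] [ChartedSpace F N] [IsManifold 𝓘(ℝ, F) ∞ N] [MulAction K N]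
  {X : Type*} [NormedAddCommGroup X] [NormedSpace ℝ X] [FiniteDimensional ℝ X]
  [ChartedSpace X (FibredProduct K N)]
  {ν : TwoForm F N} {Φ : N → Module.Dual ℝ (LieAlg EK K)} {π : E →L[ℝ] EK}
  {Ω : TwoForm X (FibredProduct K N)}

theorem contMDiff_comoment_Ad_inv (hN : IsHamiltonianAction ν Φ) (Z : E) :
    ContMDiff (𝓘(ℝ, E).prod 𝓘(ℝ, F)) 𝓘(ℝ, ℝ) ∞
      (fun a : G × N => comoment π Φ a.2 (Ad E a.1⁻¹ Z)) :=
  ((contMDiff_comoment hN).comp contMDiff_snd).clm_apply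
    ((contMDiff_Ad.comp ((contMDiff_inv 𝓘(ℝ, E) ∞).comp contMDiff_fst)).clm_apply contMDiff_const)

theorem tderiv_comoment_Ad_inv (hN : IsHamiltonianAction ν Φ) (Z : E) (a : G × N) (A : E) (v : F) :
    tderiv (𝓘(ℝ, E).prod 𝓘(ℝ, F)) 𝓘(ℝ, ℝ)
        (fun a : G × N => comoment π Φ a.2 (Ad E a.1⁻¹ Z)) a (A, v) =
      comomentDeriv Φ π a.2 v (Ad E a.1⁻¹ Z) -
        comoment π Φ a.2 (lieBr E G (leftTriv E a.1 A) (Ad E a.1⁻¹ Z)) := by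
  have hA : ContMDiff 𝓘(ℝ, E) 𝓘(ℝ, E) ∞ (fun g : G => Ad E g⁻¹ Z) :=
    (contMDiff_Ad.comp (contMDiff_inv 𝓘(ℝ, E) ∞)).clm_apply contMDiff_const
  have hc := contMDiff_comoment (π := π) hN
  have e := tderiv_bilin (ContinuousLinearMap.id ℝ (E →L[ℝ] ℝ))
    (f := fun a : G × N => comoment π Φ a.2) (g := fun a : G × N => Ad E a.1⁻¹ Z) (x := a)
    ((hc.comp contMDiff_snd).mdiff a) ((hA.comp contMDiff_fst).mdiff a) (A, v)
  have e1 := tderiv_comp_apply (I₁ := 𝓘(ℝ, E).prod 𝓘(ℝ, F)) (f := (Prod.snd : G × N → N))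
    (x := a) (hc.mdiff _) (contMDiff_snd (n := ∞).mdiff a) (A, v)
  have e2 := tderiv_comp_apply (I₁ := 𝓘(ℝ, E).prod 𝓘(ℝ, F)) (f := (Prod.fst : G × N → G))
    (x := a) (hA.mdiff _) (contMDiff_fst (n := ∞).mdiff a) (A, v)
  rw [tderiv_snd] at e1
  rw [tderiv_fst, tderiv_Ad_inv_apply] at e2
  rw [e1, e2, map_neg] at e
  simpa [comomentDeriv, sub_eq_add_neg, add_comm] using e

/-- The momentum map of the induced action. -/
theorem IsPullbackForm.exists_momentumMap (hΩ : IsPullbackForm ν Φ π Ω)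
    (hQ : IsQuotientManifold E K F N X) (hπ : IsEquivariantProjection K π)
    (hN : IsHamiltonianAction ν Φ) (hext : ∀ ξ Z, extendDual E EK K ξ Z = ξ (π Z)) :
    ∃ ΦM : FibredProduct K N → Module.Dual ℝ (LieAlg E G),
      (∀ (g : G) (n : N), ΦM (FibredProduct.mk K (g, n)) =
        coadjointAction E g (extendDual E EK K (Φ n))) ∧ IsMomentumMap Ω ΦM := by
  have : IsTopologicalGroup G := topologicalGroup_of_lieGroup 𝓘(ℝ, E) ∞
  have hval : ∀ (a : G × N) (Z : E), coadjointAction E a.1 (extendDual E EK K (Φ a.2)) Z =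
      comoment π Φ a.2 (Ad E a.1⁻¹ Z) := fun a Z => hext _ _
  let ΦM : FibredProduct K N → Module.Dual ℝ (LieAlg E G) := Quotient.lift
    (fun a : G × N => coadjointAction E a.1 (extendDual E EK K (Φ a.2))) (by
      rintro a b ⟨k, rfl⟩
      refine LinearMap.ext fun Z : E => (hval _ _).trans (Eq.trans ?_ (hval _ _).symm)
      simp only
      rw [mul_inv_rev, inv_inv, Ad_mul_apply, comoment_smul hN hπ])
  have hM : ∀ (a : G × N) (Z : E), ΦM (FibredProduct.mk K a) Z =
      comoment π Φ a.2 (Ad E a.1⁻¹ Z) := hval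
  have hs : ∀ Z : E, ContMDiff 𝓘(ℝ, X) 𝓘(ℝ, ℝ) ∞ (fun x : FibredProduct K N => ΦM x Z) :=
    fun Z => hQ.contMDiff_of_comp_mk (by
      have := contMDiff_comoment_Ad_inv (G := G) (π := π) hN Z
      simpa only [← hM] using this)
  refine ⟨ΦM, fun g n => rfl, hs, fun h x => ?_, fun (Z : E) x ξ => ?_⟩
  · obtain ⟨a, rfl⟩ := FibredProduct.mk_surjective x
    refine LinearMap.ext fun Z : E => ?_
    refine (hM (h * a.1, a.2) Z).trans (Eq.trans ?_ (hM a (Ad E h⁻¹ Z)).symm)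
    rw [← Ad_mul_apply, mul_inv_rev]
  · obtain ⟨a, rfl⟩ := FibredProduct.mk_surjective x
    obtain ⟨⟨A, v⟩, rfl⟩ := hQ.tderiv_mk_surjective a ξ
    -- The second argument is the right-invariant lift of the vector field of Z, whose left
    -- trivialization is Ad(g⁻¹)Z; the value then coincides with `tderiv_comoment_Ad_inv`.
    have e1 := hΩ a (A, v) (tderiv 𝓘(ℝ, E) 𝓘(ℝ, E) (fun x : G => x * a.1) 1 Z, 0)
    rw [liftForm_apply, baseForm_apply, leftTriv_tderiv_mul_right, alt_zero_right, map_zero,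
      zero_add] at e1
    have e2 := tderiv_comp_apply (g := fun x => ΦM x Z) (f := FibredProduct.mk K) (x := a)
      ((hs Z).mdiff _) (hQ.contMDiff_mk.mdiff a) (A, v)
    simp only [hM] at e2
    rw [tderiv_comoment_Ad_inv hN] at e2
    refine Eq.trans ?_ e2
    refine (congrArg (fun η : X => Ω.onModel (FibredProduct.mk K a) ![mkDeriv K X a (A, v), η])
      (hQ.fundamentalVector_mk Z a)).trans ?_
    refine e1.trans ?_
    simp

end InducedMomentumMap

end

/-! ### Assembly of the theorem -/

theorem mainTheorem9
    -- the connected semisimple Lie group `G` with finite centre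
    {E : Type*} [NormedAddCommGroup E] [NormedSpace ℝ E] [FiniteDimensional ℝ E] [CompleteSpace E]
    {G : Type*} [TopologicalSpace G] [T2Space G] [SecondCountableTopology G] [ConnectedSpace G]
    [ChartedSpace E G] [Group G] [LieGroup 𝓘(ℝ, E) ∞ G]
    (hG : LieAlgebra.IsSemisimple ℝ (LieAlg E G)) (hZ : Finite (Subgroup.center G))
    -- the maximal compact subgroup `K`
    {EK : Type*} [NormedAddCommGroup EK] [NormedSpace ℝ EK] [FiniteDimensional ℝ EK]
    [CompleteSpace EK]
    (K : Subgroup G) [ChartedSpace EK K] [LieGroup 𝓘(ℝ, EK) ∞ K]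
    (hK : IsMaximalCompactSubgroup K) (hKG : IsLieSubgroup E EK K)
    -- the maximal torus `T` of `K`, whose Lie algebra is a Cartan subalgebra of that of `G`
    {ET : Type*} [NormedAddCommGroup ET] [NormedSpace ℝ ET] [FiniteDimensional ℝ ET]
    (T : Subgroup K) [ChartedSpace ET T]
    (hT : IsMaximalTorus T) (hTK : IsLieSubgroup EK ET T) (hTG : IsCartanIn E EK ET T)
    -- the positive Weyl chamber
    (C : Set (Module.Dual ℝ (LieAlg EK K))) (hC : IsWeylChamber E EK ET T C)
    -- the Hamiltonian `K`-manifold `(N, ν, Φ)`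
    {F : Type*} [NormedAddCommGroup F] [NormedSpace ℝ F] [FiniteDimensional ℝ F]
    {N : Type*} [TopologicalSpace N] [T2Space N] [SecondCountableTopology N]
    [ChartedSpace F N] [IsManifold 𝓘(ℝ, F) ∞ N] [MulAction K N]
    (ν : TwoForm F N) (Φ : N → Module.Dual ℝ (LieAlg EK K))
    (hN : IsHamiltonianAction ν Φ)
    (hΦ : ∀ n : N, Φ n ∈ stronglyEllipticSet E EK ET T C) :
    -- `G ×_K N` is a smooth manifold
    T2Space (FibredProduct K N) ∧ SecondCountableTopology (FibredProduct K N) ∧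
    (∃ _ : ChartedSpace (FibredModel E EK F) (FibredProduct K N),
      IsQuotientManifold E K F N (FibredModel E EK F)) ∧
    -- with its smooth structure, it carries the induced form and the induced momentum map
    ∀ [ChartedSpace (FibredModel E EK F) (FibredProduct K N)],
      IsQuotientManifold E K F N (FibredModel E EK F) →
      ∃ Ω : TwoForm (FibredModel E EK F) (FibredProduct K N),
        IsInducedForm E EK K ν Φ Ω ∧ (∀ Ω', IsInducedForm E EK K ν Φ Ω' → Ω' = Ω) ∧
        Ω.IsSymplectic ∧
        ∃ ΦM : FibredProduct K N → Module.Dual ℝ (LieAlg E G),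
          (∀ (g : G) (n : N), ΦM (FibredProduct.mk K (g, n)) =
            coadjointAction E g (extendDual E EK K (Φ n))) ∧
          IsHamiltonianAction Ω ΦM := by
  have hKc : IsCompact (K : Set G) := hK.1
  have : IsTopologicalGroup G := topologicalGroup_of_lieGroup 𝓘(ℝ, E) ∞
  have := hN.smooth_action
  have : ContinuousSMul K N := ContMDiffSMul.continuousSMul (I := 𝓘(ℝ, EK)) (I' := 𝓘(ℝ, F)) ∞
  obtain ⟨π, h1, h2, h3, h4, h5⟩ := exists_equivariant_projection hG hKc hKG hTK hTG hC
  have hπ : IsEquivariantProjection K π := ⟨h1, h3⟩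
  refine ⟨FibredProduct.t2Space hKc, FibredProduct.secondCountableTopology,
    hKG.exists_isQuotientManifold π h1, ?_⟩
  intro _ hQ
  obtain ⟨Ω, hΩ⟩ := exists_isPullbackForm hQ hN hπ hKG
  have hI := hΩ.isInducedForm hQ hN h2 h4
  obtain ⟨hs, hc⟩ := hΩ.isSmooth_isClosed hQ hN
  -- Strong ellipticity of the values of Φ enters here, to make the bracket pairing on ker π
  -- nondegenerate.
  have hsymp : Ω.IsSymplectic := ⟨hs, hc, hΩ.isNondegenerate hQ hπ hKG hN fun n => h5 _ (hΦ n)⟩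
  obtain ⟨ΦM, hM, hmom⟩ := hΩ.exists_momentumMap hQ hπ hN h4
  exact ⟨Ω, hI, fun Ω' h' => hI.eq hQ hπ hKG hN h2 h', hsymp, ΦM, hM,
    hsymp, hQ.contMDiffSMul, hI.invariant, hmom⟩
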